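/- For $d\ge 1$ and $n\ge 1$, let $C=[C_{i_1,\dots,i_d}]$ be an $n\times\cdots\times n$ $d$-dimensional array of independent $\mathrm{Exp}(1)$ random variables (exponential with mean $1$). A \emph{line} of $[n]^d$ is a set of $n$ $d$-tuples obtained by fixing all coordinates but one and letting the remaining one run through $[n]$. An \emph{axial assignment} is a set $T\subseteq[n]^d$ that contains exactly one $d$-tuple of every line (so $|T|=n^{d-1}$); its cost is $C(T)=\sum_{v\in T}C_v$, and $Z^A_d$ denotes the minimum of $C(T)$ over all axial assignments $T$. "Whp" means with probability tending to $1$ as $n\to\infty$, with $d$ fixed. (a) There is an absolute constant $c>0$ such that for every fixed $d\ge 3$, $Z^A_d\ge c\,n^{d-2}$ whp; in particular $Z^A_d=\Omega(n^{d-2})$ whp. (b) Let $d=3$. There are a constant $K$ and a deterministic algorithm, running in time polynomial in $n$ on every $n\times n\times n$ array of real costs (in a uniform random access model whose only unit-cost operations on real numbers are copying, addition, subtraction and comparison), that computes perfect matchings $M_1,\dots,M_n$ of the complete bipartite graph $K_{n,n}$ following the greedy rule: for $i=1,\dots,n$ in turn, $M_i$ is a minimum-cost perfect matching of $K_{n,n}\setminus(M_1\cup\cdots\cup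 M_{i-1})$ with respect to the edge costs $A_{j,k}=C_{i,j,k}$. On every input the set $T=\{(i,j,k):(j,k)\in M_i\}$ is an axial assignment, and on the random array $C$ its cost $Z=C(T)$ satisfies $Z\le K\,n\log n$ whp. -/

import Mathlib

open MeasureTheory Filter Topology

namespace AxialAssignment

/-! ### The random axial assignment problem -/

/-- An `n × ⋯ × n` array of real costs in `d` dimensions. -/
abbrev CostArray (d n : ℕ) : Type := (Fin d → Fin n) → ℝ

/-- The law of the random cost array: the `n ^ d` entries are independent and `Exp(1)`. -/
noncomputable def costLaw (d n : ℕ) : Measure (CostArray d n) :=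
  Measure.pi fun _ => ProbabilityTheory.expMeasure 1

/-- The line through `x` parallel to the `r`-th coordinate axis: the tuples that agree with `x`
in all coordinates except possibly the `r`-th. -/
def line {d n : ℕ} (r : Fin d) (x : Fin d → Fin n) : Set (Fin d → Fin n) :=
  Set.range fun t : Fin n => Function.update x r t

/-- A set of `d`-tuples is an axial assignment if every line contains exactly one of its tuples.
(There are `n ^ (d - 1)` disjoint lines in each direction, hence it has `n ^ (d - 1)` tuples.) -/
def IsAxialAssignment {d n : ℕ} (T : Finset (Fin d → Fin n)) : Prop :=
  ∀ (r : Fin d) (x : Fin d → Fin n), ∃! v, v ∈ T ∧ v ∈ line r x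

/-- The total cost of a set of tuples. -/
def cost {d n : ℕ} (C : CostArray d n) (T : Finset (Fin d → Fin n)) : ℝ :=
  ∑ v ∈ T, C v

/-- The optimal value: the least cost of an axial assignment. There are finitely many axial
assignments and, for `1 ≤ d`, at least one, so the infimum is a minimum. -/
noncomputable def optimalValue {d n : ℕ} (C : CostArray d n) : ℝ :=
  sInf {z : ℝ | ∃ T : Finset (Fin d → Fin n), IsAxialAssignment T ∧ cost C T = z}

/-! ### The greedy rule in three dimensions

A perfect matching of `K_{n,n}` is a permutation `σ` of `Fin n`, with the edges `(j, σ j)`. -/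

/-- The matching `σ` uses no edge of the matchings `M i'` with `i' < i`, i.e. it is a perfect
matching of the graph `K_{n,n} ∖ (⋃ i' < i, M i')`. -/
def AvoidsEarlier {n : ℕ} (M : Fin n → Equiv.Perm (Fin n)) (i : Fin n)
    (σ : Equiv.Perm (Fin n)) : Prop :=
  ∀ i' < i, ∀ j, σ j ≠ M i' j

/-- The cost of the matching `σ` in the plane with first coordinate `i`. -/
def matchingCost {n : ℕ} (C : CostArray 3 n) (i : Fin n) (σ : Equiv.Perm (Fin n)) : ℝ :=
  ∑ j, C ![i, j, σ j]

/-- `M` is an outcome of the greedy rule: for each `i` in turn, `M i` is a minimum-cost perfect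
matching, with respect to the costs `C i j k`, of `K_{n,n}` minus the earlier matchings. -/
def IsGreedyOutcome {n : ℕ} (C : CostArray 3 n) (M : Fin n → Equiv.Perm (Fin n)) : Prop :=
  ∀ i, AvoidsEarlier M i (M i) ∧
    ∀ σ, AvoidsEarlier M i σ → matchingCost C i (M i) ≤ matchingCost C i σ

/-- The set of triples `(i, j, k)` with `(j, k) ∈ M i`. -/
def triples {n : ℕ} (M : Fin n → Equiv.Perm (Fin n)) : Finset (Fin 3 → Fin n) :=
  Finset.univ.image fun p : Fin n × Fin n => ![p.1, p.2, M p.1 p.2]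

/-! ### A machine model with a step count

A uniform random access machine with real number cells, presented as a structured programming
language. There are arrays of natural numbers and arrays of real numbers, addressed by an array
name and three computed indices (lower-dimensional arrays and single variables use index `0` in
the unused places). Natural numbers can be added, subtracted (truncated at `0`) and compared;
real numbers can only be added, subtracted and compared: there are no multiplications, no
rounding, no real constants except `0`, and no conversions. So numbers grow by `O(1)` bits per
step, and polynomially many steps here are polynomially many bit operations whenever the input
numbers are rationals with a common denominator. -/

/-- Expressions for natural numbers. `get a i j k` reads the cell `(i, j, k)` of the array `a` of
natural numbers. -/
inductive NatExpr : Type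
  | lit (c : ℕ)
  | get (a : ℕ) (i j k : NatExpr)
  | add (e₁ e₂ : NatExpr)
  | sub (e₁ e₂ : NatExpr)

/-- Expressions for real numbers. `get a i j k` reads the cell `(i, j, k)` of the array `a` of
real numbers. -/
inductive RealExpr : Type
  | zero
  | get (a : ℕ) (i j k : NatExpr)
  | add (e₁ e₂ : RealExpr)
  | sub (e₁ e₂ : RealExpr)

/-- Tests. -/
inductive Test : Type
  | natLe (e₁ e₂ : NatExpr)
  | realLe (e₁ e₂ : RealExpr)
  | not (b : Test)
  | and (b₁ b₂ : Test)

/-- Programs. -/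
inductive Program : Type
  | skip
  | setNat (a : ℕ) (i j k e : NatExpr)
  | setReal (a : ℕ) (i j k : NatExpr) (e : RealExpr)
  | seq (P Q : Program)
  | branch (b : Test) (P Q : Program)
  | loop (b : Test) (P : Program)

/-- The content of the memory: array name, three indices, value. -/
structure Memory : Type where
  nat : ℕ → ℕ → ℕ → ℕ → ℕ
  real : ℕ → ℕ → ℕ → ℕ → ℝ

/-- Overwrite one cell. -/
def write {β : Type} (m : ℕ → ℕ → ℕ → ℕ → β) (a i j k : ℕ) (v : β) : ℕ → ℕ → ℕ → ℕ → β :=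
  fun a' i' j' k' => if a' = a ∧ i' = i ∧ j' = j ∧ k' = k then v else m a' i' j' k'

def NatExpr.eval (s : Memory) : NatExpr → ℕ
  | lit c => c
  | get a i j k => s.nat a (i.eval s) (j.eval s) (k.eval s)
  | add e₁ e₂ => e₁.eval s + e₂.eval s
  | sub e₁ e₂ => e₁.eval s - e₂.eval s

noncomputable def RealExpr.eval (s : Memory) : RealExpr → ℝ
  | zero => 0
  | get a i j k => s.real a (i.eval s) (j.eval s) (k.eval s)
  | add e₁ e₂ => e₁.eval s + e₂.eval s
  | sub e₁ e₂ => e₁.eval s - e₂.eval s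

def Test.Holds (s : Memory) : Test → Prop
  | natLe e₁ e₂ => e₁.eval s ≤ e₂.eval s
  | realLe e₁ e₂ => e₁.eval s ≤ e₂.eval s
  | not b => ¬ b.Holds s
  | and b₁ b₂ => b₁.Holds s ∧ b₂.Holds s

/-- `Exec P s t s'`: the program `P`, started with memory `s`, halts after `t` steps with memory
`s'`. Every assignment and every evaluation of a test is one step; the expressions have a size
that is fixed by the program, so counting single operations instead would change the number of
steps by at most a constant factor that depends on the program only. -/
inductive Exec : Program → Memory → ℕ → Memory → Prop
  | skip (s : Memory) : Exec .skip s 1 s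
  | setNat (a : ℕ) (i j k e : NatExpr) (s : Memory) :
      Exec (.setNat a i j k e) s 1
        { s with nat := write s.nat a (i.eval s) (j.eval s) (k.eval s) (e.eval s) }
  | setReal (a : ℕ) (i j k : NatExpr) (e : RealExpr) (s : Memory) :
      Exec (.setReal a i j k e) s 1
        { s with real := write s.real a (i.eval s) (j.eval s) (k.eval s) (e.eval s) }
  | seq {P Q : Program} {s s' s'' : Memory} {t t' : ℕ} :
      Exec P s t s' → Exec Q s' t' s'' → Exec (.seq P Q) s (t + t') s''
  | branchTrue {b : Test} {P Q : Program} {s s' : Memory} {t : ℕ} :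
      b.Holds s → Exec P s t s' → Exec (.branch b P Q) s (t + 1) s'
  | branchFalse {b : Test} {P Q : Program} {s s' : Memory} {t : ℕ} :
      ¬ b.Holds s → Exec Q s t s' → Exec (.branch b P Q) s (t + 1) s'
  | loopTrue {b : Test} {P : Program} {s s' s'' : Memory} {t t' : ℕ} :
      b.Holds s → Exec P s t s' → Exec (.loop b P) s' t' s'' →
      Exec (.loop b P) s (t + t' + 1) s''
  | loopFalse {b : Test} {P : Program} {s : Memory} :
      ¬ b.Holds s → Exec (.loop b P) s 1 s

/-- The initial memory for the input `C`: the size `n` is in cell `(0, 0, 0)` of the array `0` of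
natural numbers, the costs are in the array `0` of real numbers, all other cells hold `0`. -/
noncomputable def inputMemory {n : ℕ} (C : CostArray 3 n) : Memory where
  nat a i j k := if a = 0 ∧ i = 0 ∧ j = 0 ∧ k = 0 then n else 0
  real a i j k :=
    if h : a = 0 ∧ i < n ∧ j < n ∧ k < n then
      C ![⟨i, h.2.1⟩, ⟨j, h.2.2.1⟩, ⟨k, h.2.2.2⟩]
    else 0

/-- The final memory `s` shows the matchings `M`: the cell `(i, j, 0)` of the array `1` of natural
numbers holds the partner of `j` in `M i`. -/
def Outputs {n : ℕ} (s : Memory) (M : Fin n → Equiv.Perm (Fin n)) : Prop :=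
  ∀ i j : Fin n, s.nat 1 i j 0 = M i j

/-- The single program `P` computes the map `f`, on all sizes `n` and all real cost arrays, within
a number of steps that is bounded by a polynomial in `n`. -/
def ComputesInPolyTime (P : Program)
    (f : ∀ n : ℕ, CostArray 3 n → Fin n → Equiv.Perm (Fin n)) : Prop :=
  ∃ p : Polynomial ℕ, ∀ (n : ℕ) (C : CostArray 3 n), ∃ (t : ℕ) (s : Memory),
    Exec P (inputMemory C) t s ∧ t ≤ p.eval n ∧ Outputs s (f n C)

end AxialAssignment

open AxialAssignment

/-! (a) An axial assignment has at least n^(d-1) tuples, while a Chernoff bound (`costLaw_card_le`)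
shows that whp fewer than n^(d-1)/2 of all n^d entries are at most 1/(8n). So at least half of the
required tuples cost more than 1/(8n) each, which gives n^(d-2)/16 (`le_optimalValue`).

(b) After k rounds the remaining graph is r-regular with r = n - k, so the heart is an exponential
moment bound for the least cost Z of a perfect matching of an r-regular bipartite graph G. By LP
duality Z is the maximum of ∑ y_v subject to y_j + y_k ≤ x_(jk) on G, and regularity gives r Z = ∑
(y_j + y_k), summed over the edges of G, at an optimal y. A canonical optimal y is the feasible
point nearest to (κ, …, κ) with κ large (`minCost_le_sum`). If the cost of an edge e = (j, k) is
lowered to some t in [0, y_j + y_k), then e becomes critical: relaxing it brings the polyhedron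
closer to (κ, …, κ). Hence y_j + y_k is at most the length of the set of t in [0, x_e] at which e is
critical (`inner_le_lintegral_isCritical`). For an Exp(1) variable the mean of such a length is the
probability that e is critical, by integration by parts. Critical constraints are tight, and for
generic costs at most 2n constraints, the dimension, are tight at once. So r E[Z] ≤ 2n. A weight
e^(lZ) costs only a factor 1/(1-l), because Z grows at most as fast as any single cost: this is
`lintegral_minCost_mul_exp_le`. Integrating in l gives E[e^(Z/2)] ≤ 2^N as soon as N r ≥ 4n and N >
0 (`expMoment_half_le`).

The graph left in a round depends on the earlier planes only. Summing over all possible sequences of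
matchings and using the independence of the planes, the moment bounds multiply
(`costLaw_greedy_le`); the harmonic sum makes the total exponent O(n log n), and Markov's inequality
finishes.

The algorithm is the Hungarian method, which inserts the rows one at a time along augmenting paths
of tight edges. Its dual solutions certify that every M_i is optimal
(`PlaneState.exists_isGreedyOutcome`). The program is verified in a small calculus of invariants
with step bounds (`Runs`). -/

namespace AxialAssignment

/-! ### Nearest points of polyhedra and critical constraints. -/

section Polyhedron
variable {E H : Type*} [NormedAddCommGroup H]

/-- `y` is a point of `s` that is nearest to `p`. -/
def IsNearest (p : H) (s : Set H) (y : H) : Prop := y ∈ s ∧ ∀ z ∈ s, dist p y ≤ dist p z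

lemma IsNearest.infEDist_eq {p : H} {s : Set H} {y : H} (h : IsNearest p s y) :
    Metric.infEDist p s = edist p y := by
  refine le_antisymm (Metric.infEDist_le_edist_of_mem h.1) (Metric.le_infEDist.2 fun z hz => ?_)
  rw [edist_dist, edist_dist]
  exact ENNReal.ofReal_le_ofReal (h.2 z hz)

variable [InnerProductSpace ℝ H]

/-- The points that satisfy the constraints `⟪a e, y⟫ ≤ c e` for `e ∈ G`. -/
def polyhedron (a : E → H) (G : Finset E) (c : E → ℝ) : Set H :=
  {y | ∀ e ∈ G, inner ℝ (a e) y ≤ c e}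

lemma isClosed_polyhedron (a : E → H) (G : Finset E) (c : E → ℝ) :
    IsClosed (polyhedron a G c) := by
  have : polyhedron a G c = ⋂ e ∈ G, {y | inner ℝ (a e) y ≤ c e} := by
    ext y; simp [polyhedron]
  rw [this]
  refine isClosed_biInter fun e _ => isClosed_le (by fun_prop) continuous_const

lemma polyhedron_mono (a : E → H) (G : Finset E) {c c' : E → ℝ} (h : ∀ e, c e ≤ c' e) :
    polyhedron a G c ⊆ polyhedron a G c' := fun _ hy e he => (hy e he).trans (h e)

lemma zero_mem_polyhedron (a : E → H) (G : Finset E) {c : E → ℝ} (h : ∀ e, 0 ≤ c e) :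
    (0 : H) ∈ polyhedron a G c := fun e _ => by simpa using h e

lemma exists_isNearest [FiniteDimensional ℝ H] (p : H) {s : Set H} (hs : IsClosed s)
    (hne : s.Nonempty) : ∃ y, IsNearest p s y := by
  have : ProperSpace H := FiniteDimensional.proper ℝ H
  obtain ⟨y, hy, h⟩ := hs.exists_infDist_eq_dist hne p
  exact ⟨y, hy, fun z hz => h ▸ Metric.infDist_le_dist_of_mem hz⟩

variable [DecidableEq E]

/-- Relaxing the constraint `e` brings the polyhedron closer to `p`. -/
def IsCritical (p : H) (a : E → H) (G : Finset E) (e : E) (c : E → ℝ) : Prop :=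
  Metric.infEDist p (polyhedron a G (Function.update c e (c e + 1)))
    < Metric.infEDist p (polyhedron a G c)

lemma IsNearest.isCritical_iff {p : H} {a : E → H} {G : Finset E} {c : E → ℝ} {y : H}
    (h : IsNearest p (polyhedron a G c) y) (e : E) :
    IsCritical p a G e c ↔
      ∃ z ∈ polyhedron a G (Function.update c e (c e + 1)), dist p z < dist p y := by
  rw [IsCritical, h.infEDist_eq, Metric.infEDist_lt_iff]
  simp only [edist_dist]
  refine exists_congr fun z => and_congr_right fun _ => ?_
  rw [ENNReal.ofReal_lt_ofReal_iff_of_nonneg dist_nonneg]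

/-- Moving slightly from `y` towards a point that is at least as close to `p`, we get closer. -/
lemma exists_closer {p : H} {a : E → H} {G : Finset E} {c : E → ℝ} {y z : H} {e : E} {d : ℝ}
    (hy : y ∈ polyhedron a G c) (hyd : inner ℝ (a e) y < d)
    (hz : ∀ e' ∈ G, e' ≠ e → inner ℝ (a e') z ≤ c e') (hzy : z ≠ y) (hd : dist p z ≤ dist p y) :
    ∃ w ∈ polyhedron a G (Function.update c e d), dist p w < dist p y := by
  obtain ⟨s, hs0, hs1, hs⟩ : ∃ s : ℝ, 0 < s ∧ s < 1 ∧
      inner ℝ (a e) y + s * (inner ℝ (a e) z - inner ℝ (a e) y) ≤ d := by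
    set g := d - inner ℝ (a e) y with hg
    set b := |inner ℝ (a e) z - inner ℝ (a e) y| with hb
    have hg0 : 0 < g := by linarith
    have hb0 : 0 ≤ b := abs_nonneg _
    -- The step s satisfies s * b ≤ g, so the constraint `e` stays below `d`; the summand 1 makes s
    -- < 1 even when b = 0.
    refine ⟨g / (g + b + 1), by positivity, ?_, ?_⟩
    · rw [div_lt_one (by positivity)]; linarith
    · have h1 : inner ℝ (a e) z - inner ℝ (a e) y ≤ b := le_abs_self _
      have h2 : g / (g + b + 1) * (inner ℝ (a e) z - inner ℝ (a e) y) ≤ g / (g + b + 1) * b :=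
        mul_le_mul_of_nonneg_left h1 (by positivity)
      have h3 : g / (g + b + 1) * b ≤ g := by
        rw [div_mul_eq_mul_div, div_le_iff₀ (by positivity)]; nlinarith
      linarith
  refine ⟨y + s • (z - y), fun e' he' => ?_, ?_⟩
  · rw [inner_add_right, inner_smul_right, inner_sub_right]
    by_cases h : e' = e
    · subst h; simpa using hs
    · rw [Function.update_of_ne h]
      have h1 := hy e' he'
      have h2 := hz e' he' h
      nlinarith
  · rw [dist_eq_norm, dist_eq_norm] at *
    have h0 : 0 < ‖z - y‖ := norm_pos_iff.2 (sub_ne_zero.2 hzy)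
    have e1 : p - (y + s • (z - y)) = (p - y) - s • (z - y) := by abel
    have e2 : p - z = (p - y) - (z - y) := by abel
    have h1 : ‖p - z‖ ^ 2 ≤ ‖p - y‖ ^ 2 := by gcongr
    rw [e2, norm_sub_sq_real] at h1
    rw [e1]
    -- Strict convexity of the squared norm: an inner point of the segment from `y` to `z` is
    -- strictly closer to `p` than `y`, even if `z` is only as close as `y`.
    refine lt_of_pow_lt_pow_left₀ 2 (norm_nonneg _) ?_
    rw [norm_sub_sq_real, inner_smul_right, norm_smul, Real.norm_eq_abs, mul_pow, sq_abs]
    nlinarith [mul_pos hs0 (pow_pos h0 2), mul_pos (mul_pos hs0 (pow_pos h0 2)) (sub_pos.2 hs1)]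

/-- If the constraint were slack at `y`, a short move towards a closer point of the relaxed
polyhedron would stay in the original one and contradict the choice of `y`. -/
lemma IsCritical.tight [FiniteDimensional ℝ H] {p : H} {a : E → H} {G : Finset E} {c : E → ℝ}
    {y : H} {e : E} (h : IsCritical p a G e c) (hy : IsNearest p (polyhedron a G c) y)
    (he : e ∈ G) : inner ℝ (a e) y = c e := by
  refine le_antisymm (hy.1 e he) (not_lt.1 fun hlt => ?_)
  obtain ⟨z, hz, hzy⟩ := (hy.isCritical_iff e).1 h
  obtain ⟨w, hw, hwy⟩ := exists_closer (p := p) (z := z) hy.1 hlt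
    (fun e' he' hne => by simpa [hne] using hz e' he') (by rintro rfl; exact lt_irrefl _ hzy) hzy.le
  rw [Function.update_eq_self] at hw
  exact absurd (hy.2 w hw) (not_le.2 hwy)

/-- The old nearest point `y` lies outside the tightened polyhedron but violates only the constraint
`e`, and it is at least as close to `p` as the new nearest point. A short move towards it uses only
a relaxation of `e`. -/
lemma isCritical_update [FiniteDimensional ℝ H] {p : H} {a : E → H} {G : Finset E} {c : E → ℝ}
    {y : H} {e : E} {t : ℝ} (hy : IsNearest p (polyhedron a G c) y) (he : e ∈ G)
    (hne : (polyhedron a G (Function.update c e t)).Nonempty) (ht : t < inner ℝ (a e) y) :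
    IsCritical p a G e (Function.update c e t) := by
  obtain ⟨y', hy'⟩ := exists_isNearest p (isClosed_polyhedron a G _) hne
  rw [hy'.isCritical_iff, Function.update_idem]
  have h1 : inner ℝ (a e) y' ≤ t := by simpa using hy'.1 e he
  have hsub : polyhedron a G (Function.update c e t) ⊆ polyhedron a G c := by
    refine polyhedron_mono a G fun e' => ?_
    by_cases h : e' = e
    · subst h; simpa using (ht.trans_le (hy.1 _ he)).le
    · simp [h]
  have := exists_closer (p := p) (z := y) (d := t + 1) hy'.1 (by linarith)
    (fun e' he' hne => by simpa [hne] using hy.1 e' he')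
    (by rintro rfl; linarith) (hy.2 _ (hsub hy'.1))
  simpa using this

/-- The value of a constraint at the nearest point is at most the measure of the set of those
`t ∈ [0, c e]` for which the constraint becomes critical when `c e` is replaced by `t`. -/
lemma inner_le_lintegral_isCritical [FiniteDimensional ℝ H] {p : H} {a : E → H} {G : Finset E}
    {c : E → ℝ} {y : H} {e : E} (hc : ∀ e, 0 ≤ c e) (hy : IsNearest p (polyhedron a G c) y)
    (he : e ∈ G) :
    ENNReal.ofReal (inner ℝ (a e) y) ≤
      ∫⁻ t in Set.Icc 0 (c e), {t | IsCritical p a G e (Function.update c e t)}.indicator 1 t := by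
  have h1 : Set.Ico 0 (inner ℝ (a e) y) ⊆ {t | IsCritical p a G e (Function.update c e t)} := by
    intro t ht
    refine isCritical_update hy he ⟨0, zero_mem_polyhedron a G fun e' => ?_⟩ ht.2
    by_cases h : e' = e
    · subst h; simpa using ht.1
    · simpa [h] using hc e'
  have h2 : Set.Ico 0 (inner ℝ (a e) y) ⊆ Set.Icc 0 (c e) :=
    fun t ht => ⟨ht.1, ht.2.le.trans (hy.1 e he)⟩
  calc ENNReal.ofReal (inner ℝ (a e) y) = ∫⁻ t in Set.Ico 0 (inner ℝ (a e) y), 1 := by simp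
    _ ≤ ∫⁻ t in Set.Ico 0 (inner ℝ (a e) y),
        {t | IsCritical p a G e (Function.update c e t)}.indicator 1 t := by
      refine setLIntegral_mono_ae' measurableSet_Ico (Eventually.of_forall fun t ht => ?_)
      rw [Set.indicator_of_mem (h1 ht)]; simp
    _ ≤ _ := lintegral_mono_set h2

/-- Shifting a feasible point slightly along `-w` makes all constraints strict. So the right-hand
sides `c` whose polyhedron comes within distance less than `r` of `p` form a union of open sets, and
the distance is a measurable function of `c`. -/
lemma measurableSet_isCritical [Fintype E] (p : H) {a : E → H} (G : Finset E) (e : E) {w : H}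
    (hw : ∀ e ∈ G, 0 < inner ℝ (a e) w) : MeasurableSet {c | IsCritical p a G e c} := by
  have key : Measurable fun c : E → ℝ => Metric.infEDist p (polyhedron a G c) := by
    refine measurable_of_Iio fun r => IsOpen.measurableSet ?_
    have : (fun c : E → ℝ => Metric.infEDist p (polyhedron a G c)) ⁻¹' Set.Iio r =
        ⋃ y ∈ Metric.eball p r, {c : E → ℝ | ∀ e ∈ G, inner ℝ (a e) y < c e} := by
      ext c
      simp only [Set.mem_preimage, Set.mem_Iio, Metric.infEDist_lt_iff, Set.mem_iUnion,
        Set.mem_ofPred_eq, exists_prop]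
      constructor
      · rintro ⟨y, hy, hpy⟩
        have hcont : Continuous fun η : ℝ => y - η • w := by fun_prop
        have hop : IsOpen {η : ℝ | y - η • w ∈ Metric.eball p r} :=
          Metric.isOpen_eball.preimage hcont
        obtain ⟨ε, hε, hball⟩ := Metric.isOpen_iff.1 hop 0 (by simpa [edist_comm] using hpy)
        refine ⟨y - (ε / 2) • w, hball ?_, fun e he => ?_⟩
        · rw [Metric.mem_ball, Real.dist_eq, sub_zero, abs_of_pos (by positivity)]; linarith
        · rw [inner_sub_right, inner_smul_right]
          have := hy e he
          have := mul_pos (half_pos hε) (hw e he)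
          linarith
      · rintro ⟨y, hy, h⟩
        exact ⟨y, fun e he => (h e he).le, by simpa [edist_comm] using hy⟩
    rw [this]
    refine isOpen_biUnion fun y _ => ?_
    have : {c : E → ℝ | ∀ e ∈ G, inner ℝ (a e) y < c e} =
        ⋂ e ∈ G, {c : E → ℝ | inner ℝ (a e) y < c e} := by ext; simp
    rw [this]
    exact isOpen_biInter_finset fun e _ => isOpen_lt continuous_const (continuous_apply e)
  refine measurableSet_lt (key.comp ?_) key
  refine measurable_pi_lambda _ fun e' => ?_
  by_cases h : e' = e
  · subst h; simpa using (measurable_pi_apply e').add_const 1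
  · simpa [h] using measurable_pi_apply e'

/-- Outside finitely many hyperplanes, at most `dim H` constraints are critical. -/
lemma exists_relations_card_isCritical_le [Fintype E] [FiniteDimensional ℝ H] (a : E → H)
    (G : Finset E) :
    ∃ D : Finset (E → ℝ), 0 ∉ D ∧ ∀ c : E → ℝ, (∀ e, 0 ≤ c e) →
      (∀ d ∈ D, ∑ e, d e * c e ≠ 0) → ∀ (p : H) (S : Finset E), S ⊆ G →
        (∀ e ∈ S, IsCritical p a G e c) → S.card ≤ Module.finrank ℝ H := by
  classical
  have key : ∀ S : Finset E, Module.finrank ℝ H < S.card → ∃ d : E → ℝ, d ≠ 0 ∧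
      ∀ (c : E → ℝ) (y : H), (∀ e ∈ S, inner ℝ (a e) y = c e) → ∑ e, d e * c e = 0 := by
    intro S hS
    -- More than dim H vectors `a e` are linearly dependent. When these constraints are all tight,
    -- the same relation holds between the numbers `c e`, and there are only finitely many sets `S`
    -- to consider.
    have hker := LinearMap.ker_ne_bot_of_finrank_lt
      (f := Fintype.linearCombination ℝ fun e : S => a e) (by simpa using hS)
    obtain ⟨x, hx, hx0⟩ := (Submodule.ne_bot_iff _).1 hker
    rw [LinearMap.mem_ker, Fintype.linearCombination_apply] at hx
    refine ⟨fun e => if h : e ∈ S then x ⟨e, h⟩ else 0, fun h0 => hx0 ?_, fun c y h => ?_⟩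
    · ext e
      simpa using congrFun h0 e
    · have h1 : ∑ e, (if h : e ∈ S then x ⟨e, h⟩ else 0) * c e = ∑ e : S, x e * c e := by
        rw [← Finset.sum_subset (Finset.subset_univ S) (by intro e _ he; simp [he]),
          ← Finset.sum_coe_sort S]
        simp
      rw [h1, ← inner_zero_left (𝕜 := ℝ) y, ← hx, sum_inner]
      refine Finset.sum_congr rfl fun e _ => ?_
      rw [inner_smul_left, h e e.2]; rfl
  choose d hd0 hd using key
  refine ⟨Finset.univ.image fun S : {S : Finset E // Module.finrank ℝ H < S.card} => d S S.2, ?_,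
    fun c hc hD p S hSG hS => ?_⟩
  · simp only [Finset.mem_image, Finset.mem_univ, true_and, Subtype.exists, not_exists]
    exact fun S hS => hd0 _ _
  · by_contra! hlt
    obtain ⟨y, hy⟩ := exists_isNearest p (isClosed_polyhedron a G c)
      ⟨0, zero_mem_polyhedron a G hc⟩
    refine hD (d S hlt) ?_ (hd S hlt c y fun e he => (hS e he).tight hy (hSG he))
    exact Finset.mem_image.2 ⟨⟨S, hlt⟩, Finset.mem_univ _, rfl⟩

end Polyhedron
end AxialAssignment

/-! ### Integrals over independent exponential variables. -/

namespace AxialAssignment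
open ProbabilityTheory ENNReal

instance : IsProbabilityMeasure (expMeasure 1) := isProbabilityMeasure_expMeasure one_pos

lemma lintegral_pi_prod {ι : Type*} [Fintype ι] {X : ι → Type*} [∀ i, MeasurableSpace (X i)]
    (μ : ∀ i, Measure (X i)) [∀ i, IsProbabilityMeasure (μ i)] {f : ∀ i, X i → ℝ≥0∞}
    (hf : ∀ i, Measurable (f i)) :
    ∫⁻ x, ∏ i, f i (x i) ∂Measure.pi μ = ∏ i, ∫⁻ x, f i x ∂μ i := by
  have hind : iIndepFun (fun i (x : ∀ i, X i) => f i (x i)) (Measure.pi μ) :=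
    iIndepFun_pi fun i => (hf i).aemeasurable
  have h := lintegral_prod_eq_prod_lintegral_of_indepFun Finset.univ _ hind
    fun i => (hf i).comp (measurable_pi_apply i)
  refine h.trans ?_
  refine Finset.prod_congr rfl fun i _ => ?_
  rw [← (measurePreserving_eval μ i).lintegral_comp (hf i)]

/-- Resampling one coordinate does not change the law of the family; this isolates a single cost for
one-dimensional arguments. -/
lemma lintegral_pi_update {ι : Type*} [Fintype ι] [DecidableEq ι] {X : ι → Type*}
    [∀ i, MeasurableSpace (X i)]
    (μ : ∀ i, Measure (X i)) [∀ i, IsProbabilityMeasure (μ i)] {f : (∀ i, X i) → ℝ≥0∞}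
    (hf : Measurable f) (i : ι) :
    ∫⁻ x, f x ∂Measure.pi μ = ∫⁻ x, ∫⁻ t, f (Function.update x i t) ∂μ i ∂Measure.pi μ := by
  have h : ∀ x : ∀ i, X i, ∫⁻ t, f (Function.update x i t) ∂μ i = lmarginal μ {i} f x := by
    intro x; rw [lmarginal_singleton]
  simp_rw [h]
  have : Nonempty (∀ i, X i) := (Measure.pi μ).nonempty_of_neZero
  obtain ⟨x⟩ := this
  rw [lintegral_eq_lmarginal_univ x, lintegral_eq_lmarginal_univ x]
  have hu : (Finset.univ : Finset ι) = insert i (Finset.univ.erase i) := by simp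
  have h1 : lmarginal μ Finset.univ f = lmarginal μ (Finset.univ.erase i) (lmarginal μ {i} f) := by
    conv_lhs => rw [← Finset.insert_erase (Finset.mem_univ i)]
    rw [lmarginal_insert' _ hf (by simp)]
    congr 1; ext y; rw [lmarginal_singleton]
  have h2 : lmarginal μ Finset.univ (lmarginal μ {i} f) =
      lmarginal μ (Finset.univ.erase i) (lmarginal μ {i} f) := by
    conv_lhs => rw [← Finset.insert_erase (Finset.mem_univ i)]
    rw [lmarginal_insert' _ (hf.lmarginal _) (by simp)]
    congr 1; ext y
    have : ∀ t, lmarginal μ {i} f (Function.update y i t) = lmarginal μ {i} f y := fun t =>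
      lmarginal_update_of_mem (μ := μ) (Finset.mem_singleton_self i) f y t
    simp [this]
  rw [h1, h2]

lemma lintegral_expMeasure (f : ℝ → ℝ≥0∞) (hf : Measurable f) :
    ∫⁻ x, f x ∂expMeasure 1 = ∫⁻ x in Set.Ici 0, ENNReal.ofReal (Real.exp (-x)) * f x := by
  have h : expMeasure 1 = volume.withDensity (exponentialPDF 1) := rfl
  have hm : Measurable (exponentialPDF 1) := (measurable_exponentialPDFReal 1).ennreal_ofReal
  rw [h, lintegral_withDensity_eq_lintegral_mul _ hm hf, ← lintegral_indicator measurableSet_Ici]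
  congr 1; ext x
  by_cases hx : 0 ≤ x
  · rw [Set.indicator_of_mem (show x ∈ Set.Ici 0 from hx)]
    simp [exponentialPDF_of_nonneg hx]
  · rw [Set.indicator_of_notMem (show x ∉ Set.Ici 0 from hx)]
    simp [exponentialPDF_of_neg (not_le.1 hx)]

lemma expMeasure_absolutelyContinuous : expMeasure 1 ≪ volume :=
  withDensity_absolutelyContinuous _ _

instance : NullSingletonClass (expMeasure 1) :=
  ⟨fun x => expMeasure_absolutelyContinuous (by simp)⟩

lemma ae_nonneg_expMeasure : ∀ᵐ x ∂expMeasure 1, 0 ≤ x := by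
  rw [ae_iff]
  have hS : MeasurableSet {x : ℝ | ¬ 0 ≤ x} :=
    (measurableSet_le measurable_const measurable_id).compl
  rw [← lintegral_indicator_one hS, lintegral_expMeasure _ (measurable_one.indicator hS)]
  refine (setLIntegral_congr_fun measurableSet_Ici (g := fun _ => 0) fun x hx => ?_).trans (by simp)
  simp only [Set.mem_Ici] at hx
  simp [hx]

lemma lintegral_exp_mul_expMeasure {l : ℝ} (hl : l < 1) :
    ∫⁻ x, ENNReal.ofReal (Real.exp (l * x)) ∂expMeasure 1 = ENNReal.ofReal (1 - l)⁻¹ := by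
  rw [lintegral_expMeasure _ (by fun_prop)]
  have h1 : ∀ x : ℝ, ENNReal.ofReal (Real.exp (-x)) * ENNReal.ofReal (Real.exp (l * x)) =
      ENNReal.ofReal (Real.exp (-(1 - l) * x)) := by
    intro x
    rw [← ENNReal.ofReal_mul (Real.exp_nonneg _), ← Real.exp_add]; congr 2; ring
  simp_rw [h1]
  rw [setLIntegral_congr Ioi_ae_eq_Ici.symm, ← ofReal_integral_eq_lintegral_ofReal]
  · rw [integral_exp_mul_Ioi (by linarith)]; simp [neg_div, ← inv_neg]
  · exact exp_neg_integrableOn_Ioi 0 (by linarith)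
  · exact Eventually.of_forall fun x => Real.exp_nonneg _

/-- The hyperplane `∑ i, d i * x i = 0` is null for independent exponential variables. -/
lemma ae_sum_mul_ne_zero {ι : Type*} [Fintype ι] {d : ι → ℝ} (hd : d ≠ 0) :
    ∀ᵐ x : ι → ℝ ∂Measure.pi fun _ => expMeasure 1, ∑ i, d i * x i ≠ 0 := by
  classical
  obtain ⟨i, hi⟩ := Function.ne_iff.1 hd
  have hS : MeasurableSet {x : ι → ℝ | ∑ i, d i * x i = 0} :=
    measurableSet_eq_fun (by fun_prop) measurable_const
  rw [ae_iff]
  simp only [ne_eq, not_not]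
  rw [← lintegral_indicator_one hS, lintegral_pi_update _ (measurable_one.indicator hS) i]
  refine (lintegral_congr fun x => ?_).trans lintegral_zero
  -- As `d i ≠ 0`, for fixed other coordinates at most one value of the `i`-th coordinate lies on
  -- the hyperplane.
  have hsub : (fun t => {x : ι → ℝ | ∑ i, d i * x i = 0}.indicator (1 : (ι → ℝ) → ℝ≥0∞)
      (Function.update x i t)) ≤ ({-(∑ j ∈ Finset.univ.erase i, d j * x j) / d i} : Set ℝ).indicator 1 := by
    intro t
    by_cases ht : Function.update x i t ∈ {x : ι → ℝ | ∑ i, d i * x i = 0}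
    · have h2 : ∑ j, d j * Function.update x i t j = 0 := ht
      rw [← Finset.add_sum_erase _ _ (Finset.mem_univ i), Function.update_self,
        Finset.sum_congr rfl (g := fun j => d j * x j) (fun j hj => by
          rw [Function.update_of_ne (Finset.ne_of_mem_erase hj)])] at h2
      have : t = -(∑ j ∈ Finset.univ.erase i, d j * x j) / d i := by
        rw [eq_div_iff hi]; linarith
      simp only []
      rw [Set.indicator_of_mem ht, Set.indicator_of_mem (by simpa using this)]; simp
    · simp only []
      rw [Set.indicator_of_notMem ht]; exact zero_le
  refine le_antisymm ((lintegral_mono hsub).trans ?_) zero_le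
  rw [lintegral_indicator_one (measurableSet_singleton _)]
  simp

/-- Integration by parts for the exponential distribution, for functions that grow slowly. -/
lemma lintegral_expMeasure_mul_lintegral_le {g I : ℝ → ℝ≥0∞} (hg : Measurable g)
    (hI : Measurable I) {l : ℝ} (hl : l < 1)
    (hgl : ∀ t s, 0 ≤ s → g (t + s) ≤ ENNReal.ofReal (Real.exp (l * s)) * g t) :
    ∫⁻ x, g x * (∫⁻ t in Set.Icc 0 x, I t) ∂expMeasure 1 ≤
      ENNReal.ofReal (1 - l)⁻¹ * ∫⁻ x, I x * g x ∂expMeasure 1 := by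
  have hF : Measurable (Function.uncurry fun x t : ℝ => {q : ℝ × ℝ | 0 ≤ q.2 ∧ q.2 ≤ q.1}.indicator
      (fun q => ENNReal.ofReal (Real.exp (-q.1)) * g q.1 * I q.2) (x, t)) := by
    refine Measurable.indicator (by fun_prop) ?_
    exact (measurableSet_le measurable_const measurable_snd).inter
      (measurableSet_le measurable_snd measurable_fst)
  have h0 : ∀ x : ℝ, ENNReal.ofReal (Real.exp (-x)) * (g x * ∫⁻ t in Set.Icc 0 x, I t) =
      ∫⁻ t, {q : ℝ × ℝ | 0 ≤ q.2 ∧ q.2 ≤ q.1}.indicator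
      (fun q => ENNReal.ofReal (Real.exp (-q.1)) * g q.1 * I q.2) (x, t) := by
    intro x
    rw [← mul_assoc, ← lintegral_const_mul _ hI, ← lintegral_indicator measurableSet_Icc]
    congr 1
  have h1 : ∀ t : ℝ, ∫⁻ x, {q : ℝ × ℝ | 0 ≤ q.2 ∧ q.2 ≤ q.1}.indicator
      (fun q => ENNReal.ofReal (Real.exp (-q.1)) * g q.1 * I q.2) (x, t) ≤
      (Set.Ici 0).indicator (fun t => ENNReal.ofReal (1 - l)⁻¹ *
        (ENNReal.ofReal (Real.exp (-t)) * (I t * g t))) t := by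
    intro t
    by_cases ht : 0 ≤ t
    -- After Fubini, substitute x = s + t. By e^(-(s+t)) = e^(-s) e^(-t) and the growth bound on
    -- `g`, the integral over s splits off as that of e^(-s) e^(ls), which is 1/(1-l).
    · rw [Set.indicator_of_mem (show t ∈ Set.Ici 0 from ht),
        ← lintegral_add_right_eq_self _ t]
      calc _ ≤ ∫⁻ s, (Set.Ici 0).indicator (fun s => ENNReal.ofReal (Real.exp (-s)) *
            ENNReal.ofReal (Real.exp (l * s))) s *
              (ENNReal.ofReal (Real.exp (-t)) * (I t * g t)) := by
            refine lintegral_mono fun s => ?_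
            by_cases hs : 0 ≤ s
            · rw [Set.indicator_of_mem (by simpa using ⟨ht, hs⟩),
                Set.indicator_of_mem (show s ∈ Set.Ici 0 from hs)]
              calc _ ≤ ENNReal.ofReal (Real.exp (-(s + t))) *
                    (ENNReal.ofReal (Real.exp (l * s)) * g t) * I t := by
                    gcongr
                    rw [add_comm]; exact hgl t s hs
                _ = _ := by
                    rw [neg_add, Real.exp_add, ENNReal.ofReal_mul (Real.exp_nonneg _)]; ring
            · rw [Set.indicator_of_notMem (by simp; intro _; linarith)]; exact zero_le
        _ = _ := by
            rw [lintegral_mul_const _ (Measurable.indicator (by fun_prop) measurableSet_Ici),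
              lintegral_indicator measurableSet_Ici, ← lintegral_exp_mul_expMeasure hl,
              lintegral_expMeasure _ (by fun_prop)]
    · rw [Set.indicator_of_notMem (show t ∉ Set.Ici 0 from ht)]
      simp [ht]
  have hmeas : Measurable fun x => ∫⁻ t in Set.Icc 0 x, I t := by
    have h2 : ∀ x, ∫⁻ t in Set.Icc 0 x, I t = ∫⁻ t, {q : ℝ × ℝ | 0 ≤ q.2 ∧ q.2 ≤ q.1}.indicator
        (fun q => I q.2) (x, t) := by
      intro x
      rw [← lintegral_indicator measurableSet_Icc]; congr 1
    simp_rw [h2]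
    refine Measurable.lintegral_prod_right' ?_
    refine Measurable.indicator (by fun_prop) ?_
    exact (measurableSet_le measurable_const measurable_snd).inter
      (measurableSet_le measurable_snd measurable_fst)
  rw [lintegral_expMeasure (fun x => g x * ∫⁻ t in Set.Icc 0 x, I t) (hg.mul hmeas),
    lintegral_expMeasure (fun x => I x * g x) (hI.mul hg)]
  simp_rw [h0]
  refine (setLIntegral_le_lintegral _ _).trans ?_
  rw [lintegral_lintegral_swap hF.aemeasurable]
  refine (lintegral_mono h1).trans ?_
  rw [lintegral_indicator measurableSet_Ici, lintegral_const_mul _ (by fun_prop)]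
end AxialAssignment

namespace AxialAssignment
open ProbabilityTheory ENNReal

/-! ### Linear programming duality for matchings in one plane. -/

section Plane
variable {n : ℕ}

/-- The cost of a perfect matching in a plane. -/
def planeCost (x : Fin n × Fin n → ℝ) (σ : Equiv.Perm (Fin n)) : ℝ := ∑ j, x (j, σ j)

/-- The perfect matchings of a bipartite graph. -/
def matchings (G : Finset (Fin n × Fin n)) : Finset (Equiv.Perm (Fin n)) :=
  Finset.univ.filter fun σ => ∀ j, (j, σ j) ∈ G

lemma mem_matchings {G : Finset (Fin n × Fin n)} {σ : Equiv.Perm (Fin n)} :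
    σ ∈ matchings G ↔ ∀ j, (j, σ j) ∈ G := by simp [matchings]

/-- The least cost of a perfect matching of `G`. -/
noncomputable def minCost {G : Finset (Fin n × Fin n)} (hG : (matchings G).Nonempty)
    (x : Fin n × Fin n → ℝ) : ℝ := (matchings G).inf' hG (planeCost x)

lemma measurable_planeCost (σ : Equiv.Perm (Fin n)) :
    Measurable fun x : Fin n × Fin n → ℝ => planeCost x σ := by
  unfold planeCost; fun_prop

lemma measurable_minCost {G : Finset (Fin n × Fin n)} (hG : (matchings G).Nonempty) :
    Measurable (minCost hG) := by
  refine Continuous.measurable (Continuous.finset_inf'_apply hG fun σ _ => ?_)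
  unfold planeCost; fun_prop

/-- A matching uses each edge at most once. This is the slow growth that the weighted integration by
parts requires. -/
lemma minCost_update_add_le {G : Finset (Fin n × Fin n)} (hG : (matchings G).Nonempty)
    (x : Fin n × Fin n → ℝ) (e : Fin n × Fin n) (t : ℝ) {s : ℝ} (hs : 0 ≤ s) :
    minCost hG (Function.update x e (t + s)) ≤ minCost hG (Function.update x e t) + s := by
  obtain ⟨σ, hσ, h⟩ := Finset.exists_mem_eq_inf' hG (planeCost (Function.update x e t))
  rw [minCost, minCost, h]
  refine (Finset.inf'_le _ hσ).trans ?_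
  unfold planeCost
  have key : ∀ j, Function.update x e (t + s) (j, σ j) ≤
      Function.update x e t (j, σ j) + if j = e.1 then s else 0 := by
    intro j
    by_cases h : (j, σ j) = e
    · subst h; simp
    · rw [Function.update_of_ne h, Function.update_of_ne h]
      split_ifs <;> simp [hs]
  refine (Finset.sum_le_sum fun j _ => key j).trans ?_
  rw [Finset.sum_add_distrib]; simp

/-- The incidence vector of an edge. -/
noncomputable def edgeVector (e : Fin n × Fin n) : EuclideanSpace ℝ (Fin n ⊕ Fin n) :=
  EuclideanSpace.single (Sum.inl e.1) 1 + EuclideanSpace.single (Sum.inr e.2) 1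

lemma inner_edgeVector (e : Fin n × Fin n) (y : EuclideanSpace ℝ (Fin n ⊕ Fin n)) :
    inner ℝ (edgeVector e) y = y (Sum.inl e.1) + y (Sum.inr e.2) := by
  simp [edgeVector, inner_add_left, EuclideanSpace.inner_single_left]

/-- The vector with all coordinates `κ`. -/
noncomputable def constVector (n : ℕ) (κ : ℝ) : EuclideanSpace ℝ (Fin n ⊕ Fin n) :=
  WithLp.toLp 2 fun _ => κ

lemma inner_constVector (κ : ℝ) (y : EuclideanSpace ℝ (Fin n ⊕ Fin n)) :
    inner ℝ (constVector n κ) y = κ * ∑ v, y v := by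
  simp [constVector, PiLp.inner_apply, mul_comm, Finset.mul_sum, mul_add]

lemma sum_eq_sum_perm (y : EuclideanSpace ℝ (Fin n ⊕ Fin n)) (σ : Equiv.Perm (Fin n)) :
    ∑ v, y v = ∑ j, (y (Sum.inl j) + y (Sum.inr (σ j))) := by
  rw [Fintype.sum_sum_type, Finset.sum_add_distrib,
    Equiv.sum_comp σ fun k => y (Sum.inr k)]

lemma convex_polyhedron {E H : Type*} [NormedAddCommGroup H] [InnerProductSpace ℝ H] (a : E → H)
    (G : Finset E) (c : E → ℝ) : Convex ℝ (polyhedron a G c) := by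
  intro y hy z hz s t hs ht hst e he
  rw [inner_add_right, inner_smul_right, inner_smul_right]
  have h1 := mul_le_mul_of_nonneg_left (hy e he) hs
  have h2 := mul_le_mul_of_nonneg_left (hz e he) ht
  calc _ ≤ s * c e + t * c e := add_le_add h1 h2
    _ = c e := by rw [← add_mul, hst, one_mul]

/-- The variational inequality for the projection onto a convex set. -/
lemma IsNearest.inner_nonpos {H : Type*} [NormedAddCommGroup H] [InnerProductSpace ℝ H] {p y : H}
    {s : Set H} (h : IsNearest p s y) (hs : Convex ℝ s) {z : H} (hz : z ∈ s) :
    inner ℝ (p - y) (z - y) ≤ 0 := by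
  refine (norm_eq_iInf_iff_real_inner_le_zero hs h.1).1 ?_ z hz
  have : Nonempty s := ⟨⟨y, h.1⟩⟩
  refine le_antisymm (le_ciInf fun w => ?_) (ciInf_le ⟨0, ?_⟩ (⟨y, h.1⟩ : s))
  · simpa [dist_eq_norm] using h.2 w w.2
  · rintro _ ⟨w, rfl⟩; exact norm_nonneg _

/-- If `κ` is large enough, then the feasible dual solution nearest to `(κ, …, κ)` is optimal. -/
lemma minCost_le_sum {G : Finset (Fin n × Fin n)} (hG : (matchings G).Nonempty)
    {x : Fin n × Fin n → ℝ} (hx : ∀ e, 0 ≤ x e) {κ : ℝ} (hκ0 : 0 < κ)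
    (hκ : 2 * n * minCost hG x < κ) {y : EuclideanSpace ℝ (Fin n ⊕ Fin n)}
    (hy : IsNearest (constVector n κ) (polyhedron edgeVector G x) y) :
    minCost hG x ≤ ∑ v, y v := by
  classical
  obtain ⟨σ₀, hσ₀, h₀⟩ := Finset.exists_mem_eq_inf' hG (planeCost x)
  have hweak : ∑ v, y v ≤ minCost hG x := by
    rw [minCost, h₀, sum_eq_sum_perm y σ₀]
    refine Finset.sum_le_sum fun j _ => ?_
    rw [← inner_edgeVector (j, σ₀ j)]
    exact hy.1 _ (mem_matchings.1 hσ₀ j)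
  -- The variational inequality tested at the feasible point 0, combined with weak duality.
  have hnorm : ‖y‖ ^ 2 ≤ κ * minCost hG x := by
    have h := hy.inner_nonpos (convex_polyhedron _ _ _) (zero_mem_polyhedron _ _ hx)
    rw [zero_sub, inner_neg_right, inner_sub_left, inner_constVector,
      real_inner_self_eq_norm_sq] at h
    have := mul_le_mul_of_nonneg_left hweak hκ0.le
    linarith
  -- Hall's condition for the graph of tight edges. If `A` violates it, raising the duals on `A` and
  -- lowering them on its tight neighbours `N` by the same small amount keeps `y` feasible.
  have hall : ∀ A : Finset (Fin n), A.card ≤ (A.biUnion fun j => Finset.univ.filter fun k =>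
      (j, k) ∈ G ∧ y (Sum.inl j) + y (Sum.inr k) = x (j, k)).card := by
    intro A
    by_contra! hlt
    set N := A.biUnion fun j => Finset.univ.filter fun k =>
      (j, k) ∈ G ∧ y (Sum.inl j) + y (Sum.inr k) = x (j, k) with hN
    set w : EuclideanSpace ℝ (Fin n ⊕ Fin n) := WithLp.toLp 2 (Sum.elim
      (fun j => if j ∈ A then 1 else 0) fun k => if k ∈ N then -1 else 0) with hw
    have hwl : ∀ j, w (Sum.inl j) = if j ∈ A then 1 else 0 := fun j => rfl
    have hwr : ∀ j, w (Sum.inr j) = if j ∈ N then -1 else 0 := fun j => rfl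
    obtain ⟨s, hs0, hs⟩ : ∃ s : ℝ, 0 < s ∧ y + s • w ∈ polyhedron edgeVector G x := by
      have : ∀ e ∈ G, ∀ᶠ s in 𝓝[>] (0 : ℝ), inner ℝ (edgeVector e) (y + s • w) ≤ x e := by
        intro e he
        have hle := hy.1 e he
        rw [inner_edgeVector] at hle
        rcases hle.lt_or_eq with hlt' | heq
        · have hc : ContinuousAt (fun s : ℝ => inner ℝ (edgeVector e) (y + s • w)) 0 := by
            fun_prop
          have : ∀ᶠ s in 𝓝 (0 : ℝ), inner ℝ (edgeVector e) (y + s • w) < x e := by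
            refine hc.eventually_lt continuousAt_const ?_
            simpa [inner_edgeVector] using hlt'
          exact (this.filter_mono nhdsWithin_le_nhds).mono fun _ h => h.le
        · filter_upwards [self_mem_nhdsWithin] with s hs
          rw [inner_add_right, inner_smul_right, inner_edgeVector, inner_edgeVector, heq, hwl, hwr]
          by_cases hA : e.1 ∈ A
          · have : e.2 ∈ N := Finset.mem_biUnion.2 ⟨e.1, hA, by simpa using ⟨he, heq⟩⟩
            simp [hA, this]
          · have hs' : 0 < s := hs
            split_ifs <;> simp [hs'.le]
      have hall := (Finset.eventually_all G).2 this
      obtain ⟨s, hs, hs0⟩ := (hall.and self_mem_nhdsWithin).exists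
      exact ⟨s, hs0, hs⟩
    have h := hy.inner_nonpos (convex_polyhedron _ _ _) hs
    rw [add_sub_cancel_left, inner_smul_right] at h
    have h' : inner ℝ (constVector n κ - y) w ≤ 0 := by
      by_contra! h2; exact absurd h (not_le.2 (mul_pos hs0 h2))
    have hsum : ∑ v, w v = (A.card : ℝ) - N.card := by
      rw [Fintype.sum_sum_type]; simp only [hwl, hwr]
      simp [Finset.sum_ite_mem, Finset.sum_neg_distrib, sub_eq_add_neg]
    have hwn : ‖w‖ ^ 2 ≤ 2 * n := by
      rw [EuclideanSpace.norm_sq_eq, Fintype.sum_sum_type, two_mul]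
      refine add_le_add ?_ ?_ <;>
      · refine (Finset.sum_le_card_nsmul _ _ 1 fun j _ => ?_).trans (by simp)
        simp only [hwl, hwr]; split_ifs <;> simp
    rw [inner_sub_left, inner_constVector, hsum] at h'
    have hcard : (1 : ℝ) ≤ A.card - N.card := by
      have : ((N.card + 1 : ℕ) : ℝ) ≤ A.card := by exact_mod_cast hlt
      push_cast at this; linarith
    -- The direction `w` has coordinate sum at least 1, so κ ≤ ⟨y, w⟩. Squaring yields κ² ≤ κ *
    -- minCost * 2n, against the choice of κ.
    have h1 : κ ≤ ‖y‖ * ‖w‖ := by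
      have := real_inner_le_norm y w
      nlinarith
    have h2 : κ ^ 2 ≤ ‖y‖ ^ 2 * ‖w‖ ^ 2 := by rw [← mul_pow]; gcongr
    have h3 : ‖y‖ ^ 2 * ‖w‖ ^ 2 ≤ κ * minCost hG x * (2 * n) :=
      mul_le_mul hnorm hwn (by positivity) ((sq_nonneg _).trans hnorm)
    nlinarith
  obtain ⟨f, hf, hft⟩ := (Finset.all_card_le_biUnion_card_iff_exists_injective _).1 hall
  simp only [Finset.mem_filter, Finset.mem_univ, true_and] at hft
  let σ := Equiv.ofBijective f (Finite.injective_iff_bijective.1 hf)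
  have hσ : σ ∈ matchings G := mem_matchings.2 fun j => (hft j).1
  rw [sum_eq_sum_perm y σ]
  refine (Finset.inf'_le _ hσ).trans (le_of_eq ?_)
  exact Finset.sum_congr rfl fun j _ => (hft j).2.symm

/-- The bipartite graph `G` is `r`-regular. -/
def IsRegular (G : Finset (Fin n × Fin n)) (r : ℕ) : Prop :=
  (∀ j, (G.filter fun e => e.1 = j).card = r) ∧ ∀ k, (G.filter fun e => e.2 = k).card = r

/-- Every vertex lies on `r` edges, so summing the constraint values over the edges counts the dual
objective `r` times. -/
lemma IsRegular.sum_inner {G : Finset (Fin n × Fin n)} {r : ℕ} (h : IsRegular G r)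
    (y : EuclideanSpace ℝ (Fin n ⊕ Fin n)) :
    ∑ e ∈ G, inner ℝ (edgeVector e) y = r * ∑ v, y v := by
  simp only [inner_edgeVector, Finset.sum_add_distrib, Fintype.sum_sum_type, mul_add]
  congr 1
  · rw [← Finset.sum_fiberwise G (fun e => e.1), Finset.mul_sum]
    refine Finset.sum_congr rfl fun j _ => ?_
    rw [Finset.sum_congr rfl (g := fun _ => y (Sum.inl j))
      (fun e he => by rw [(Finset.mem_filter.1 he).2]), Finset.sum_const, h.1, nsmul_eq_mul]
  · rw [← Finset.sum_fiberwise G (fun e => e.2), Finset.mul_sum]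
    refine Finset.sum_congr rfl fun j _ => ?_
    rw [Finset.sum_congr rfl (g := fun _ => y (Sum.inr j))
      (fun e he => by rw [(Finset.mem_filter.1 he).2]), Finset.sum_const, h.2, nsmul_eq_mul]

end Plane
end AxialAssignment

namespace AxialAssignment
open ProbabilityTheory ENNReal

/-! ### Exponential moments of the least matching cost in a regular graph. -/

section PlaneMoments
variable {n : ℕ}

/-- The law of the costs in one plane. -/
noncomputable def planeLaw (n : ℕ) : Measure (Fin n × Fin n → ℝ) :=
  Measure.pi fun _ => expMeasure 1

instance : IsProbabilityMeasure (planeLaw n) := by unfold planeLaw; infer_instance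

lemma ae_planeLaw_nonneg : ∀ᵐ x ∂planeLaw n, ∀ e, 0 ≤ x e := by
  rw [ae_all_iff]
  intro e
  exact (measurePreserving_eval (fun _ : Fin n × Fin n => expMeasure 1) e).quasiMeasurePreserving.ae
    ae_nonneg_expMeasure

/-- The exponential moment of the least cost of a perfect matching of `G`. -/
noncomputable def expMoment {G : Finset (Fin n × Fin n)} (hG : (matchings G).Nonempty) (l : ℝ) :
    ℝ≥0∞ := ∫⁻ x, ENNReal.ofReal (Real.exp (l * minCost hG x)) ∂planeLaw n

/-- The dual variables live in dimension 2n, and the exceptional hyperplanes are null. -/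
lemma ae_card_isCritical_le (G : Finset (Fin n × Fin n))
    (p : EuclideanSpace ℝ (Fin n ⊕ Fin n)) :
    ∀ᵐ x ∂planeLaw n, ∑ e ∈ G, {x | IsCritical p edgeVector G e x}.indicator (1 : (Fin n × Fin n → ℝ) → ℝ≥0∞) x
      ≤ 2 * n := by
  classical
  obtain ⟨D, hD0, hD⟩ := exists_relations_card_isCritical_le (edgeVector (n := n)) G
  have h1 : ∀ᵐ x ∂planeLaw n, ∀ d ∈ D, ∑ e, d e * x e ≠ 0 :=
    (Finset.eventually_all D).2 fun d hd =>
      ae_sum_mul_ne_zero (by rintro rfl; exact hD0 hd)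
  filter_upwards [h1, ae_planeLaw_nonneg] with x hx h0
  have h := hD x h0 hx p (G.filter fun e => IsCritical p edgeVector G e x)
    (Finset.filter_subset _ _) fun e he => (Finset.mem_filter.1 he).2
  have h2 : ∑ e ∈ G, {x | IsCritical p edgeVector G e x}.indicator (1 : (Fin n × Fin n → ℝ) → ℝ≥0∞) x =
      ((G.filter fun e => IsCritical p edgeVector G e x).card : ℝ≥0∞) := by
    rw [Finset.card_eq_sum_ones, Finset.sum_filter]
    push_cast
    refine Finset.sum_congr rfl fun e _ => ?_
    simp [Set.indicator_apply]
  rw [h2]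
  have h3 : Module.finrank ℝ (EuclideanSpace ℝ (Fin n ⊕ Fin n)) = 2 * n := by
    simp [two_mul]
  rw [h3] at h
  exact_mod_cast h

lemma edgeVector_pos (e : Fin n × Fin n) : 0 < inner ℝ (edgeVector e) (constVector n 1) := by
  rw [inner_edgeVector]; simp [constVector]

/-- The constraint `e` contributes its criticality probability to the weighted integral. -/
lemma lintegral_mul_lintegral_isCritical_le {G : Finset (Fin n × Fin n)}
    (hG : (matchings G).Nonempty) (p : EuclideanSpace ℝ (Fin n ⊕ Fin n)) (e : Fin n × Fin n)
    {l : ℝ} (hl0 : 0 ≤ l) (hl : l < 1) :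
    Measurable (fun x : Fin n × Fin n → ℝ => ∫⁻ t in Set.Icc 0 (x e),
      {t | IsCritical p edgeVector G e (Function.update x e t)}.indicator (1 : ℝ → ℝ≥0∞) t) ∧
    ∫⁻ x, ENNReal.ofReal (Real.exp (l * minCost hG x)) * (∫⁻ t in Set.Icc 0 (x e),
      {t | IsCritical p edgeVector G e (Function.update x e t)}.indicator 1 t) ∂planeLaw n ≤
    ENNReal.ofReal (1 - l)⁻¹ * ∫⁻ x, {x | IsCritical p edgeVector G e x}.indicator 1 x *
      ENNReal.ofReal (Real.exp (l * minCost hG x)) ∂planeLaw n := by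
  have hC : MeasurableSet {x | IsCritical p edgeVector G e x} :=
    measurableSet_isCritical p G e fun e _ => edgeVector_pos e
  have hZ : Measurable fun x => ENNReal.ofReal (Real.exp (l * minCost hG x)) := by
    have := measurable_minCost hG; fun_prop
  have hup : Measurable fun q : (Fin n × Fin n → ℝ) × ℝ => Function.update q.1 e q.2 := by
    refine measurable_pi_lambda _ fun e' => ?_
    by_cases h : e' = e
    · subst h; simpa using measurable_snd
    · simp only [Function.update_of_ne h]; fun_prop
  have hup' : ∀ x : Fin n × Fin n → ℝ, Measurable fun t : ℝ => Function.update x e t :=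
    fun x => hup.comp (measurable_const.prodMk measurable_id)
  have hmeas : Measurable (fun x : Fin n × Fin n → ℝ => ∫⁻ t in Set.Icc 0 (x e),
      {t | IsCritical p edgeVector G e (Function.update x e t)}.indicator (1 : ℝ → ℝ≥0∞) t) := by
    have h2 : ∀ x : Fin n × Fin n → ℝ, ∫⁻ t in Set.Icc 0 (x e),
        {t | IsCritical p edgeVector G e (Function.update x e t)}.indicator (1 : ℝ → ℝ≥0∞) t =
        ∫⁻ t, ({q : (Fin n × Fin n → ℝ) × ℝ | 0 ≤ q.2 ∧ q.2 ≤ q.1 e} ∩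
          (fun q => Function.update q.1 e q.2) ⁻¹' {x | IsCritical p edgeVector G e x}).indicator
            1 (x, t) := by
      intro x
      rw [← lintegral_indicator measurableSet_Icc]
      refine lintegral_congr fun t => ?_
      rw [Set.indicator_indicator]; rfl
    simp_rw [h2]
    refine Measurable.lintegral_prod_right' (measurable_one.indicator ?_)
    exact ((measurableSet_le measurable_const measurable_snd).inter (measurableSet_le measurable_snd
      (by fun_prop))).inter (hup hC)
  refine ⟨hmeas, ?_⟩
  have hm₁ : Measurable fun x => ENNReal.ofReal (Real.exp (l * minCost hG x)) *
      (∫⁻ t in Set.Icc 0 (x e),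
        {t | IsCritical p edgeVector G e (Function.update x e t)}.indicator (1 : ℝ → ℝ≥0∞) t) :=
    hZ.mul hmeas
  have hm₂ : Measurable fun x => {x | IsCritical p edgeVector G e x}.indicator 1 x *
      ENNReal.ofReal (Real.exp (l * minCost hG x)) := (measurable_one.indicator hC).mul hZ
  unfold planeLaw
  -- With the cost of `e` resampled on both sides, the claim reduces to the one-dimensional
  -- integration by parts.
  rw [lintegral_pi_update _ hm₁ e, lintegral_pi_update _ hm₂ e,
    ← lintegral_const_mul _ ?_]
  · refine lintegral_mono fun x => ?_
    simp only [Function.update_idem, Function.update_self]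
    exact lintegral_expMeasure_mul_lintegral_le (hZ.comp (hup' x))
      (I := {t | IsCritical p edgeVector G e (Function.update x e t)}.indicator 1)
      (measurable_one.indicator (hup' x hC)) hl fun t s hs => by
        simp only [Function.comp_apply]
        rw [← ENNReal.ofReal_mul (Real.exp_nonneg _), ← Real.exp_add]
        refine ENNReal.ofReal_le_ofReal (Real.exp_le_exp.2 ?_)
        have := mul_le_mul_of_nonneg_left (minCost_update_add_le hG x e t hs) hl0
        linarith
  · exact Measurable.lintegral_prod_right' (hm₂.comp hup)

/-- The least cost of a perfect matching of an `r`-regular bipartite graph is of order `n / r`,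
in the exponentially tilted mean. -/
lemma lintegral_minCost_mul_exp_le {G : Finset (Fin n × Fin n)} (hG : (matchings G).Nonempty)
    {r : ℕ} (hr : IsRegular G r) {l : ℝ} (hl0 : 0 ≤ l) (hl : l < 1) :
    ∫⁻ x, ENNReal.ofReal (r * minCost hG x) * ENNReal.ofReal (Real.exp (l * minCost hG x))
      ∂planeLaw n ≤ ENNReal.ofReal (1 - l)⁻¹ * (2 * n) * expMoment hG l := by
  have hZ : Measurable fun x => ENNReal.ofReal (Real.exp (l * minCost hG x)) := by
    have := measurable_minCost hG; fun_prop
  set N : ℕ → (Fin n × Fin n → ℝ) → ℝ≥0∞ := fun κ x =>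
    ∑ e ∈ G, ENNReal.ofReal (Real.exp (l * minCost hG x)) * (∫⁻ t in Set.Icc 0 (x e),
      {t | IsCritical (constVector n κ) edgeVector G e (Function.update x e t)}.indicator 1 t)
    with hN
  -- The required size of κ depends on `x`, so no single κ serves for all costs. The bound holds for
  -- all large integers κ, and Fatou's lemma passes it to the integral.
  have hpt : ∀ᵐ x ∂planeLaw n, ENNReal.ofReal (r * minCost hG x) *
      ENNReal.ofReal (Real.exp (l * minCost hG x)) ≤ liminf (fun κ => N κ x) atTop := by
    filter_upwards [ae_planeLaw_nonneg] with x hx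
    refine le_liminf_of_le (by isBoundedDefault) ?_
    filter_upwards [eventually_gt_atTop ⌈2 * n * minCost hG x⌉₊] with κ hκ
    obtain ⟨y, hy⟩ := exists_isNearest (constVector n (κ : ℝ))
      (isClosed_polyhedron edgeVector G x) ⟨0, zero_mem_polyhedron _ _ hx⟩
    have h1 := minCost_le_sum hG hx (by exact_mod_cast (Nat.zero_le _).trans_lt hκ)
      (Nat.lt_of_ceil_lt hκ) hy
    rw [mul_comm, hN]
    simp only []
    rw [← Finset.mul_sum]
    gcongr
    calc ENNReal.ofReal (r * minCost hG x) ≤ ENNReal.ofReal (∑ e ∈ G, inner ℝ (edgeVector e) y) := by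
          rw [hr.sum_inner]; gcongr
      _ ≤ ∑ e ∈ G, ENNReal.ofReal (inner ℝ (edgeVector e) y) := by
          exact Finset.le_sum_of_subadditive ENNReal.ofReal ENNReal.ofReal_zero.le
            (fun _ _ => ENNReal.ofReal_add_le) G _
      _ ≤ _ := Finset.sum_le_sum fun e he => inner_le_lintegral_isCritical hx hy he
  refine (lintegral_mono_ae hpt).trans ((lintegral_liminf_le fun κ => ?_).trans ?_)
  · refine Finset.measurable_sum _ fun e _ => hZ.mul
      (lintegral_mul_lintegral_isCritical_le hG (constVector n κ) e hl0 hl).1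
  · refine liminf_le_of_le (by isBoundedDefault) fun b hb => ?_
    obtain ⟨κ, hκ⟩ := hb.exists
    refine hκ.trans ?_
    rw [hN, lintegral_finsetSum]
    swap
    · exact fun e _ => hZ.mul
        (lintegral_mul_lintegral_isCritical_le hG (constVector n κ) e hl0 hl).1
    refine (Finset.sum_le_sum fun e _ =>
      (lintegral_mul_lintegral_isCritical_le hG (constVector n κ) e hl0 hl).2).trans ?_
    rw [← Finset.mul_sum, mul_assoc, ← lintegral_finsetSum]
    · gcongr
      rw [expMoment, ← lintegral_const_mul _ hZ]
      refine lintegral_mono_ae ?_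
      filter_upwards [ae_card_isCritical_le G (constVector n κ)] with x hx
      rw [← Finset.sum_mul]
      gcongr
    · exact fun e _ => (measurable_one.indicator
        (measurableSet_isCritical _ G e fun e _ => edgeVector_pos e)).mul hZ

/-- A single matching costs at most the sum of all entries. Finiteness is what permits absorbing
half of the moment in `expMoment_half_le`. -/
lemma expMoment_lt_top {G : Finset (Fin n × Fin n)} (hG : (matchings G).Nonempty) {l : ℝ}
    (hl0 : 0 ≤ l) (hl : l < 1) : expMoment hG l < ⊤ := by
  obtain ⟨σ, hσ⟩ := hG
  have h1 : expMoment ⟨σ, hσ⟩ l ≤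
      ∫⁻ x, ∏ e : Fin n × Fin n, ENNReal.ofReal (Real.exp (l * x e)) ∂planeLaw n := by
    refine lintegral_mono_ae ?_
    filter_upwards [ae_planeLaw_nonneg] with x hx
    rw [← ENNReal.ofReal_prod_of_nonneg fun _ _ => Real.exp_nonneg _, ← Real.exp_sum]
    refine ENNReal.ofReal_le_ofReal (Real.exp_le_exp.2 ?_)
    rw [← Finset.mul_sum]
    refine mul_le_mul_of_nonneg_left ((Finset.inf'_le _ hσ).trans ?_) hl0
    unfold planeCost
    rw [← Finset.sum_image (f := x) (g := fun j => (j, σ j)) (s := Finset.univ)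
      (fun a _ b _ h => (Prod.ext_iff.1 h).1)]
    exact Finset.sum_le_sum_of_subset_of_nonneg (Finset.subset_univ _) fun e _ _ => hx e
  refine h1.trans_lt ?_
  unfold planeLaw
  rw [lintegral_pi_prod (f := fun _ t => ENNReal.ofReal (Real.exp (l * t))) _
    fun e => by fun_prop]
  refine ENNReal.prod_lt_top fun e _ => ?_
  rw [lintegral_exp_mul_expMeasure hl]
  exact ENNReal.ofReal_lt_top

/-- The tilted bound is a differential inequality for the moment as a function of `l`. It is
integrated from 0 to 1/2 in `N` steps of length 1/(2N), and each step at most doubles the moment. -/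
lemma expMoment_half_le {G : Finset (Fin n × Fin n)} (hG : (matchings G).Nonempty)
    {r N : ℕ} (hr : IsRegular G r) (hN0 : 0 < N) (hN : 4 * n ≤ N * r) :
    expMoment hG (1 / 2) ≤ 2 ^ N := by
  have hm := measurable_minCost hG
  have hr0 : n = 0 ∨ 0 < r := by
    rcases Nat.eq_zero_or_pos r with h | h
    · left; subst h; omega
    · exact Or.inr h
  have key : ∀ k ≤ N, expMoment hG ((k : ℝ) / (2 * N)) ≤ 2 ^ k := by
    intro k
    induction k with
    | zero => intro _; simp [expMoment]
    | succ k ih =>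
      intro hk
      have hN' : (0 : ℝ) < N := by exact_mod_cast hN0
      set l : ℝ := ((k + 1 : ℕ) : ℝ) / (2 * N) with hl
      set δ : ℝ := 1 / (2 * N) with hδ
      have hδ0 : 0 < δ := by positivity
      have hl0 : 0 ≤ l := by positivity
      have hl2 : l ≤ 1 / 2 := by
        rw [hl, div_le_div_iff₀ (by positivity) two_pos]
        have : ((k + 1 : ℕ) : ℝ) ≤ N := by exact_mod_cast hk
        linarith
      have hlδ : (k : ℝ) / (2 * N) = l - δ := by rw [hl, hδ]; push_cast; ring
      have h1 : expMoment hG l ≤ expMoment hG (l - δ) + 2⁻¹ * expMoment hG l := by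
        -- This is 1 - δz ≤ e^(-δz), multiplied by e^(lz).
        have hstep : ∀ x, ENNReal.ofReal (Real.exp (l * minCost hG x)) ≤
            ENNReal.ofReal (Real.exp ((l - δ) * minCost hG x)) +
            ENNReal.ofReal (δ * minCost hG x) * ENNReal.ofReal (Real.exp (l * minCost hG x)) := by
          intro x
          set z := minCost hG x
          rw [← ENNReal.ofReal_mul' (Real.exp_nonneg _)]
          refine (ENNReal.ofReal_le_ofReal ?_).trans ENNReal.ofReal_add_le
          have h2 : Real.exp ((l - δ) * z) = Real.exp (l * z) * Real.exp (-(δ * z)) := by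
            rw [← Real.exp_add]; congr 1; ring
          have h3 := Real.add_one_le_exp (-(δ * z))
          have h4 := Real.exp_pos (l * z)
          rw [h2]
          nlinarith
        have hsum : expMoment hG l ≤ expMoment hG (l - δ) + ∫⁻ x,
            ENNReal.ofReal (δ * minCost hG x) * ENNReal.ofReal (Real.exp (l * minCost hG x))
              ∂planeLaw n := by
          rw [expMoment, expMoment, ← lintegral_add_left (by fun_prop)]
          exact lintegral_mono hstep
        refine hsum.trans (add_le_add le_rfl ?_)
        rcases hr0 with h0 | hr0
        · subst h0
          have : ∀ x, minCost hG x = 0 := by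
            intro x
            obtain ⟨σ, hσ, h⟩ := Finset.exists_mem_eq_inf' hG (planeCost x)
            rw [minCost, h]; simp [planeCost]
          simp [this]
        · have hr' : (0 : ℝ) < r := by exact_mod_cast hr0
          have h5 : ∀ x, ENNReal.ofReal (δ * minCost hG x) *
              ENNReal.ofReal (Real.exp (l * minCost hG x)) = ENNReal.ofReal (δ / r) *
              (ENNReal.ofReal (r * minCost hG x) *
                ENNReal.ofReal (Real.exp (l * minCost hG x))) := by
            intro x
            rw [← mul_assoc, ← ENNReal.ofReal_mul (p := δ / r) (by positivity)]
            congr 2; field_simp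
          simp_rw [h5]
          rw [lintegral_const_mul _ (by fun_prop)]
          refine (mul_le_mul_right (lintegral_minCost_mul_exp_le hG hr hl0 (by linarith)) _).trans ?_
          rw [← mul_assoc]
          refine mul_le_mul_left ?_ _
          have h6 : (2 * n : ℝ≥0∞) = ENNReal.ofReal (2 * n) := by
            rw [ENNReal.ofReal_mul two_pos.le]; simp
          rw [h6, ← ENNReal.ofReal_mul (by rw [inv_nonneg]; linarith),
            ← ENNReal.ofReal_mul (by positivity)]
          have h7 : (2⁻¹ : ℝ≥0∞) = ENNReal.ofReal (1 / 2) := by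
            rw [one_div, ENNReal.ofReal_inv_of_pos two_pos]; simp
          rw [h7]
          refine ENNReal.ofReal_le_ofReal ?_
          -- With l ≤ 1/2 the total factor is at most 4nδ/r = 2n/(Nr) ≤ 1/2, by the hypothesis 4n ≤
          -- Nr.
          have h8 : (1 - l)⁻¹ ≤ 2 := by
            rw [inv_le_comm₀ (by linarith) two_pos]; linarith
          have h9 : (4 * n : ℝ) ≤ N * r := by exact_mod_cast hN
          calc δ / r * ((1 - l)⁻¹ * (2 * n)) ≤ δ / r * (2 * (2 * n)) := by gcongr
            _ ≤ 1 / 2 := by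
              rw [hδ, div_div, div_mul_eq_mul_div, div_le_div_iff₀ (by positivity) two_pos]
              linarith
      have h2 : expMoment hG l ≤ 2 * expMoment hG (l - δ) := by
        have hfin := (expMoment_lt_top hG hl0 (by linarith)).ne
        have h3 : expMoment hG l = 2⁻¹ * expMoment hG l + 2⁻¹ * expMoment hG l := by
          rw [← add_mul, ENNReal.inv_two_add_inv_two, one_mul]
        have h4 : 2⁻¹ * expMoment hG l ≤ expMoment hG (l - δ) := by
          refine (ENNReal.add_le_add_iff_right (a := 2⁻¹ * expMoment hG l)
            (ENNReal.mul_ne_top (by simp) hfin)).1 ?_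
          exact h3.symm.le.trans h1
        calc expMoment hG l = 2 * (2⁻¹ * expMoment hG l) := by
              rw [← mul_assoc, ENNReal.mul_inv_cancel two_ne_zero (by simp), one_mul]
          _ ≤ _ := by gcongr
      refine h2.trans ?_
      rw [pow_succ', ← hlδ]
      gcongr
      exact ih (by omega)
  have := key N le_rfl
  have hN' : (N : ℝ) ≠ 0 := by exact_mod_cast hN0.ne'
  rwa [show (N : ℝ) / (2 * N) = 1 / 2 by field_simp] at this

end PlaneMoments
end AxialAssignment

namespace AxialAssignment
open ProbabilityTheory ENNReal

/-! ### The lower bound for the optimal value. -/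

section LowerBound

/-- Every one of the n^(d+1) tuples arises from a tuple of `T` by changing the coordinate 0, in at
most `n` ways per tuple of `T`. -/
lemma IsAxialAssignment.le_card {d n : ℕ} {T : Finset (Fin (d + 1) → Fin n)} (hn : 0 < n)
    (hT : IsAxialAssignment T) : n ^ d ≤ T.card := by
  have hsurj : Function.Surjective fun q : T × Fin n =>
      Function.update (q.1 : Fin (d + 1) → Fin n) 0 q.2 := by
    intro x
    obtain ⟨v, ⟨hv, t, rfl⟩, -⟩ := hT 0 x
    exact ⟨(⟨_, hv⟩, x 0), by simp⟩
  have h := Fintype.card_le_of_surjective _ hsurj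
  simp only [Fintype.card_pi, Fintype.card_fin, Finset.prod_const, Finset.card_univ,
    Fintype.card_prod, Fintype.card_coe] at h
  rw [pow_succ] at h
  exact Nat.le_of_mul_le_mul_right h hn

/-- The tuples with coordinate sum 0 modulo `n`. Existence matters because the infimum of the empty
set would be 0. -/
lemma exists_isAxialAssignment {d n : ℕ} (hn : 0 < n) :
    ∃ T : Finset (Fin d → Fin n), IsAxialAssignment T := by
  have : NeZero n := ⟨hn.ne'⟩
  refine ⟨Finset.univ.filter fun x => ∑ i, x i = 0, fun r x => ?_⟩
  have key : ∀ t : Fin n, ∑ i, Function.update x r t i = 0 ↔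
      t = -∑ i ∈ Finset.univ \ {r}, x i := by
    intro t
    rw [Finset.sum_update_of_mem (Finset.mem_univ r), eq_neg_iff_add_eq_zero]
  refine ⟨Function.update x r (-∑ i ∈ Finset.univ \ {r}, x i), ⟨?_, _, rfl⟩, ?_⟩
  · simpa using (key _).2 rfl
  · rintro _ ⟨hv, t, rfl⟩
    rw [Finset.mem_filter, key] at hv
    rw [← hv.2]

lemma expMeasure_Iic_le {t : ℝ} : expMeasure 1 (Set.Iic t) ≤ ENNReal.ofReal t := by
  rw [← lintegral_indicator_one measurableSet_Iic,
    lintegral_expMeasure _ (measurable_one.indicator measurableSet_Iic)]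
  calc _ ≤ ∫⁻ x in Set.Ici 0, (Set.Iic t).indicator 1 x := by
        refine setLIntegral_mono' measurableSet_Ici fun x hx => ?_
        refine mul_le_of_le_one_left zero_le ?_
        rw [ENNReal.ofReal_le_one, Real.exp_le_one_iff]
        simpa using hx
    _ = ENNReal.ofReal t := by
        rw [lintegral_indicator_one measurableSet_Iic, Measure.restrict_apply measurableSet_Iic,
          Set.inter_comm, Set.Ici_inter_Iic, Real.volume_Icc, sub_zero]

/-- With high probability, few entries of the array are small. -/
lemma costLaw_card_le {d n : ℕ} (hn : 0 < n) :
    costLaw (d + 1) n {C | n ^ d ≤ 2 * (Finset.univ.filter fun v => C v ≤ 1 / (8 * n)).card} ≤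
      ENNReal.ofReal ((Real.exp (3 / 8) / 2) ^ (n ^ d)) := by
  classical
  set t : ℝ := 1 / (8 * n) with ht
  have hn' : (0 : ℝ) < n := by exact_mod_cast hn
  -- Chernoff weights: a small entry counts 4, any other 1, so n^d/2 small entries give a product of
  -- at least 2^(n^d). The mean weight is at most e^(3t), and over n^(d+1) entries with t = 1/(8n)
  -- this makes e^((3/8) n^d).
  set f : ℝ → ℝ≥0∞ := fun x => 1 + 3 * (Set.Iic t).indicator 1 x with hf
  have hfm : Measurable f :=
    ((measurable_one.indicator measurableSet_Iic).const_mul 3).const_add 1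
  have hint : ∫⁻ x, f x ∂expMeasure 1 ≤ ENNReal.ofReal (Real.exp (3 * t)) := by
    rw [hf, lintegral_add_left measurable_const,
      lintegral_const_mul _ (measurable_one.indicator measurableSet_Iic),
      lintegral_indicator_one measurableSet_Iic]
    simp only [lintegral_const, measure_univ, mul_one]
    calc (1 : ℝ≥0∞) + 3 * expMeasure 1 (Set.Iic t) ≤ 1 + 3 * ENNReal.ofReal t := by
          gcongr; exact expMeasure_Iic_le
      _ = ENNReal.ofReal (1 + 3 * t) := by
          rw [ENNReal.ofReal_add one_pos.le (by positivity), ENNReal.ofReal_mul (by norm_num)]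
          simp
      _ ≤ _ := by
          refine ENNReal.ofReal_le_ofReal ?_
          linarith [Real.add_one_le_exp (3 * t)]
  have hE : ∫⁻ C, ∏ v, f (C v) ∂costLaw (d + 1) n ≤ ENNReal.ofReal (Real.exp (3 / 8) ^ (n ^ d)) := by
    unfold costLaw
    rw [lintegral_pi_prod (f := fun _ => f) _ fun _ => hfm]
    calc _ ≤ ∏ _v : Fin (d + 1) → Fin n, ENNReal.ofReal (Real.exp (3 * t)) :=
          Finset.prod_le_prod' fun _ _ => hint
      _ = ENNReal.ofReal (Real.exp (3 / 8) ^ (n ^ d)) := by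
          rw [Finset.prod_const, ← ENNReal.ofReal_pow (Real.exp_nonneg _), ← Real.exp_nat_mul,
            ← Real.exp_nat_mul]
          congr 2
          simp only [Finset.card_univ, Fintype.card_pi, Fintype.card_fin, Finset.prod_const]
          rw [ht]; push_cast; field_simp
          ring
  have hsub : ∀ C ∈ {C : CostArray (d + 1) n |
      n ^ d ≤ 2 * (Finset.univ.filter fun v => C v ≤ t).card},
      (2 : ℝ≥0∞) ^ (n ^ d) ≤ ∏ v, f (C v) := by
    intro C hC
    have h1 : ∏ v, f (C v) = 4 ^ (Finset.univ.filter fun v => C v ≤ t).card := by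
      rw [← Finset.prod_const, Finset.prod_filter]
      refine Finset.prod_congr rfl fun v _ => ?_
      simp only [hf, Set.indicator_apply, Set.mem_Iic]
      split_ifs <;> norm_num
    rw [h1, show (4 : ℝ≥0∞) = 2 ^ 2 by norm_num, ← pow_mul]
    exact pow_le_pow_right₀ (by norm_num) hC
  have hmk := mul_meas_ge_le_lintegral (μ := costLaw (d + 1) n)
    (f := fun C => ∏ v, f (C v))
    (Finset.measurable_prod _ fun v _ => hfm.comp (measurable_pi_apply v)) ((2 : ℝ≥0∞) ^ (n ^ d))
  have h2 : (2 : ℝ≥0∞) ^ (n ^ d) ≠ 0 := by simp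
  have h3 : (2 : ℝ≥0∞) ^ (n ^ d) ≠ ⊤ := by simp
  rw [div_pow, ENNReal.ofReal_div_of_pos (by positivity), ENNReal.ofReal_pow two_pos.le,
    ENNReal.ofReal_ofNat, ENNReal.le_div_iff_mul_le (Or.inl h2) (Or.inl h3), mul_comm]
  refine le_trans ?_ (hmk.trans hE)
  gcongr
  exact hsub _

/-- At least n^(d+1)/2 tuples of any assignment cost more than 1/(8n) each. -/
lemma le_optimalValue {d n : ℕ} (hn : 0 < n) {C : CostArray (d + 2) n} (hC : ∀ v, 0 ≤ C v)
    (hcard : 2 * (Finset.univ.filter fun v => C v ≤ 1 / (8 * n)).card < n ^ (d + 1)) :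
    1 / 16 * (n : ℝ) ^ d ≤ optimalValue C := by
  have hn' : (0 : ℝ) < n := by exact_mod_cast hn
  obtain ⟨T₀, hT₀⟩ := exists_isAxialAssignment (d := d + 2) hn
  refine le_csInf ⟨_, T₀, hT₀, rfl⟩ ?_
  rintro _ ⟨T, hT, rfl⟩
  set S := Finset.univ.filter fun v => C v ≤ 1 / (8 * (n : ℝ)) with hS
  have h1 := hT.le_card hn
  have h2 : T.card ≤ (T \ S).card + S.card := by
    rw [Finset.card_sdiff_add_card]; exact Finset.card_le_card Finset.subset_union_left
  have h3 : (T \ S).card • (1 / (8 * (n : ℝ))) ≤ ∑ v ∈ T \ S, C v := by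
    refine Finset.card_nsmul_le_sum _ _ _ fun v hv => ?_
    simp only [hS, Finset.mem_sdiff, Finset.mem_filter, Finset.mem_univ, true_and, not_le] at hv
    exact hv.2.le
  have h4 : ∑ v ∈ T \ S, C v ≤ cost C T :=
    Finset.sum_le_sum_of_subset_of_nonneg Finset.sdiff_subset fun v _ _ => hC v
  refine le_trans ?_ (h3.trans h4)
  have h5 : n ^ (d + 1) ≤ 2 * (T \ S).card := by omega
  have h6 : (n : ℝ) ^ (d + 1) ≤ 2 * (T \ S).card := by exact_mod_cast h5
  rw [nsmul_eq_mul, mul_one_div, le_div_iff₀ (by positivity)]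
  calc 1 / 16 * (n : ℝ) ^ d * (8 * n) = n ^ (d + 1) / 2 := by ring
    _ ≤ _ := by linarith

lemma ae_costLaw_nonneg (d n : ℕ) : ∀ᵐ C ∂costLaw d n, ∀ v, 0 ≤ C v := by
  rw [ae_all_iff]
  intro e
  exact (measurePreserving_eval (fun _ : Fin d → Fin n => expMeasure 1)
    e).quasiMeasurePreserving.ae ae_nonneg_expMeasure

theorem tendsto_costLaw_optimalValue (d : ℕ) (hd : 3 ≤ d) :
    Tendsto (fun n : ℕ => costLaw d n {C | ¬ 1 / 16 * (n : ℝ) ^ (d - 2) ≤ optimalValue C})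
      atTop (𝓝 0) := by
  obtain ⟨d, rfl⟩ : ∃ k, d = k + 2 := ⟨d - 2, by omega⟩
  simp only [Nat.add_sub_cancel]
  -- The constant 1/8 in the threshold makes 3/8 smaller than log 2.
  have hlt : Real.exp (3 / 8) / 2 < 1 := by
    rw [div_lt_one two_pos, ← Real.lt_log_iff_exp_lt two_pos]
    linarith [Real.log_two_gt_d9]
  have h1 : Tendsto (fun n : ℕ => ENNReal.ofReal ((Real.exp (3 / 8) / 2) ^ (n ^ (d + 1))))
      atTop (𝓝 0) := by
    rw [← ENNReal.ofReal_zero]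
    refine ENNReal.tendsto_ofReal ?_
    exact (tendsto_pow_atTop_nhds_zero_of_lt_one (by positivity) hlt).comp
      (tendsto_pow_atTop (by omega))
  refine tendsto_of_tendsto_of_tendsto_of_le_of_le' tendsto_const_nhds h1
    (Eventually.of_forall fun _ => zero_le) ?_
  filter_upwards [eventually_gt_atTop 0] with n hn
  refine le_trans (measure_mono_ae ?_) (costLaw_card_le (d := d + 1) hn)
  filter_upwards [ae_costLaw_nonneg (d + 2) n] with C hC
  intro h
  by_contra h2
  exact h (le_optimalValue hn hC (not_le.1 h2))

end LowerBound
end AxialAssignment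

namespace AxialAssignment
open ProbabilityTheory ENNReal

/-! ### Regular bipartite graphs and the edges left by disjoint matchings. -/

section Regular
variable {n : ℕ}

/-- Hall's condition by double counting: the r|A| edges at `A` all end in the neighbourhood `N`,
which carries only r|N| edges. -/
lemma IsRegular.matchings_nonempty {G : Finset (Fin n × Fin n)} {r : ℕ} (h : IsRegular G r)
    (hr : 0 < r) : (matchings G).Nonempty := by
  classical
  have hall : ∀ A : Finset (Fin n), A.card ≤ (A.biUnion fun j => Finset.univ.filter fun k =>
      (j, k) ∈ G).card := by
    intro A
    set N := A.biUnion fun j => Finset.univ.filter fun k => (j, k) ∈ G with hN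
    have h1 : (G.filter fun e => e.1 ∈ A).card = r * A.card := by
      rw [Finset.card_eq_sum_card_fiberwise (f := Prod.fst) (t := A)
        (s := G.filter fun e => e.1 ∈ A)
        (fun e he => (Finset.mem_filter.1 (Finset.mem_coe.1 he)).2), mul_comm, ← smul_eq_mul, ← Finset.sum_const]
      refine Finset.sum_congr rfl fun j hj => ?_
      rw [Finset.filter_filter, ← h.1 j]
      congr 1; ext e
      simp only [Finset.mem_filter]
      constructor
      · rintro ⟨a, -, c⟩; exact ⟨a, c⟩
      · rintro ⟨a, rfl⟩; exact ⟨a, hj, rfl⟩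
    have h2 : (G.filter fun e => e.2 ∈ N).card = r * N.card := by
      rw [Finset.card_eq_sum_card_fiberwise (f := Prod.snd) (t := N)
        (s := G.filter fun e => e.2 ∈ N)
        (fun e he => (Finset.mem_filter.1 (Finset.mem_coe.1 he)).2), mul_comm, ← smul_eq_mul, ← Finset.sum_const]
      refine Finset.sum_congr rfl fun j hj => ?_
      rw [Finset.filter_filter, ← h.2 j]
      congr 1; ext e
      simp only [Finset.mem_filter]
      constructor
      · rintro ⟨a, -, c⟩; exact ⟨a, c⟩
      · rintro ⟨a, rfl⟩; exact ⟨a, hj, rfl⟩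
    have h3 : (G.filter fun e => e.1 ∈ A).card ≤ (G.filter fun e => e.2 ∈ N).card := by
      refine Finset.card_le_card fun e he => ?_
      rw [Finset.mem_filter] at he ⊢
      exact ⟨he.1, Finset.mem_biUnion.2 ⟨e.1, he.2, by simpa using he.1⟩⟩
    rw [h1, h2] at h3
    exact Nat.le_of_mul_le_mul_left h3 hr
  obtain ⟨f, hf, hfG⟩ := (Finset.all_card_le_biUnion_card_iff_exists_injective _).1 hall
  refine ⟨Equiv.ofBijective f (Finite.injective_iff_bijective.1 hf), mem_matchings.2 fun j => ?_⟩
  simpa using hfG j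

/-- The edges that are not in any of the matchings `m a`. -/
def avail {k : ℕ} (m : Fin k → Equiv.Perm (Fin n)) : Finset (Fin n × Fin n) :=
  Finset.univ.filter fun e => ∀ a, e.2 ≠ m a e.1

/-- The matchings `m a` are pairwise disjoint. -/
def PairwiseDisjointMatchings {k : ℕ} (m : Fin k → Equiv.Perm (Fin n)) : Prop :=
  ∀ a b, a ≠ b → ∀ j, m a j ≠ m b j

/-- Disjoint matchings remove `k` different edges at every vertex on either side. -/
lemma isRegular_avail {k : ℕ} {m : Fin k → Equiv.Perm (Fin n)}
    (hm : PairwiseDisjointMatchings m) : IsRegular (avail m) (n - k) := by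
  classical
  constructor
  · intro j
    have h1 : ((avail m).filter fun e => e.1 = j) =
        (Finset.univ \ Finset.univ.image fun a => m a j).image fun k => (j, k) := by
      ext ⟨a, b⟩
      simp only [avail, Finset.mem_filter, Finset.mem_univ, true_and, Finset.mem_image,
        Finset.mem_sdiff, not_exists, Prod.mk.injEq]
      constructor
      · rintro ⟨h, rfl⟩; exact ⟨b, fun x hx => h x hx.symm, rfl, rfl⟩
      · rintro ⟨c, h, rfl, rfl⟩; exact ⟨fun x hx => h x hx.symm, rfl⟩
    rw [h1, Finset.card_image_of_injective _ (fun a b h => (Prod.ext_iff.1 h).2),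
      Finset.card_sdiff_of_subset (Finset.subset_univ _), Finset.card_image_of_injective]
    · simp
    · intro a b h
      by_contra hne
      exact hm a b hne j h
  · intro l
    have h1 : ((avail m).filter fun e => e.2 = l) =
        (Finset.univ \ Finset.univ.image fun a => (m a).symm l).image fun j => (j, l) := by
      ext ⟨a, b⟩
      simp only [avail, Finset.mem_filter, Finset.mem_univ, true_and, Finset.mem_image,
        Finset.mem_sdiff, not_exists, Prod.mk.injEq]
      constructor
      · rintro ⟨h, rfl⟩
        exact ⟨a, fun x hx => h x (by rw [← hx, Equiv.apply_symm_apply]), rfl, rfl⟩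
      · rintro ⟨c, h, rfl, rfl⟩
        exact ⟨fun x hx => h x (by rw [hx, Equiv.symm_apply_apply]), rfl⟩
    rw [h1, Finset.card_image_of_injective _ (fun a b h => (Prod.ext_iff.1 h).1),
      Finset.card_sdiff_of_subset (Finset.subset_univ _), Finset.card_image_of_injective]
    · simp
    · intro a b h
      by_contra hne
      refine hm a b hne ((m a).symm l) ?_
      simp only [] at h
      rw [Equiv.apply_symm_apply, h, Equiv.apply_symm_apply]

end Regular

/-! ### The cost of the greedy rule. -/

section Greedy
variable {n : ℕ}

/-- Almost surely, different matchings have different costs. -/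
lemma ae_planeCost_injective : ∀ᵐ x ∂planeLaw n, Function.Injective (planeCost x) := by
  have h : ∀ σ τ : Equiv.Perm (Fin n), σ ≠ τ →
      ∀ᵐ x ∂planeLaw n, planeCost x σ ≠ planeCost x τ := by
    intro σ τ hne
    classical
    -- The difference of the two permutation matrices: equal costs put `x` on the null hyperplane
    -- with these coefficients.
    set d : Fin n × Fin n → ℝ := fun e =>
      (if σ e.1 = e.2 then 1 else 0) - if τ e.1 = e.2 then 1 else 0 with hd
    have hd0 : d ≠ 0 := by
      obtain ⟨j, hj⟩ : ∃ j, σ j ≠ τ j := by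
        by_contra! h; exact hne (Equiv.ext h)
      intro h0
      have := congrFun h0 (j, σ j)
      simp [hd, hj.symm] at this
    filter_upwards [ae_sum_mul_ne_zero hd0] with x hx heq
    refine hx ?_
    have h2 : ∀ ρ : Equiv.Perm (Fin n),
        ∑ e : Fin n × Fin n, (if ρ e.1 = e.2 then 1 else 0) * x e = planeCost x ρ := by
      intro ρ
      rw [Fintype.sum_prod_type]
      simp [planeCost]
    simp only [hd, sub_mul, Finset.sum_sub_distrib, h2, heq, sub_self]
  have h' : ∀ᵐ x ∂planeLaw n, ∀ σ τ : Equiv.Perm (Fin n), σ ≠ τ →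
      planeCost x σ ≠ planeCost x τ := by
    refine ae_all_iff.2 fun σ => ae_all_iff.2 fun τ => ?_
    by_cases hne : σ = τ
    · simp [hne]
    · filter_upwards [h σ τ hne] with x hx _ using hx
  filter_upwards [h'] with x hx σ τ heq
  by_contra hne
  exact hx σ τ hne heq

/-- The set of the costs for which `σ` is an optimal perfect matching of `G`. -/
def optimalSet (G : Finset (Fin n × Fin n)) (σ : Equiv.Perm (Fin n)) :
    Set (Fin n × Fin n → ℝ) :=
  {x | σ ∈ matchings G ∧ ∀ τ ∈ matchings G, planeCost x σ ≤ planeCost x τ}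

lemma measurableSet_optimalSet (G : Finset (Fin n × Fin n)) (σ : Equiv.Perm (Fin n)) :
    MeasurableSet (optimalSet G σ) := by
  have : optimalSet G σ = {_x | σ ∈ matchings G} ∩
      ⋂ τ ∈ matchings G, {x | planeCost x σ ≤ planeCost x τ} := by
    ext; simp [optimalSet]
  rw [this]
  exact (MeasurableSet.const _).inter (Finset.measurableSet_biInter _ fun τ _ =>
    measurableSet_le (measurable_planeCost σ) (measurable_planeCost τ))

/-- The exponential weight of an optimal matching. -/
noncomputable def optimalWeight (G : Finset (Fin n × Fin n)) (σ : Equiv.Perm (Fin n)) :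
    (Fin n × Fin n → ℝ) → ℝ≥0∞ :=
  (optimalSet G σ).indicator fun x => ENNReal.ofReal (Real.exp (1 / 2 * planeCost x σ))

lemma measurable_optimalWeight (G : Finset (Fin n × Fin n)) (σ : Equiv.Perm (Fin n)) :
    Measurable (optimalWeight G σ) := by
  refine Measurable.indicator ?_ (measurableSet_optimalSet G σ)
  have := measurable_planeCost σ
  fun_prop

/-- Ties are null, so almost surely at most one matching contributes to the sum and its cost is the
minimum. -/
lemma sum_lintegral_optimalWeight_le {G : Finset (Fin n × Fin n)} (hG : (matchings G).Nonempty) :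
    ∑ σ, ∫⁻ x, optimalWeight G σ x ∂planeLaw n ≤ expMoment hG (1 / 2) := by
  rw [← lintegral_finsetSum _ fun σ _ => measurable_optimalWeight G σ]
  refine lintegral_mono_ae ?_
  filter_upwards [ae_planeCost_injective] with x hx
  obtain ⟨σ, hσ, h⟩ := Finset.exists_mem_eq_inf' hG (planeCost x)
  rw [Finset.sum_eq_single σ]
  · unfold optimalWeight minCost
    rw [h]
    exact Set.indicator_le_self _ _ _
  · intro τ _ hne
    refine Set.indicator_of_notMem (fun hτ => hne (hx (le_antisymm (hτ.2 σ hσ) ?_))) _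
    have := Finset.inf'_le (planeCost x) hτ.1
    rwa [h] at this
  · simp

/-- A sum over sequences of products of weights that depend on the past. -/
lemma sum_prod_le {P : Type*} [Fintype P] (g : ∀ k : ℕ, (Fin k → P) → P → ℝ≥0∞) (B : ℕ → ℝ≥0∞)
    (N : ℕ) (hg : ∀ k < N, ∀ m, ∑ p, g k m p ≤ B k) :
    ∑ M : Fin N → P, ∏ i : Fin N, g i (fun a : Fin i => M (Fin.castLE i.2.le a)) (M i) ≤
      ∏ k ∈ Finset.range N, B k := by
  induction N with
  | zero => simp
  | succ N ih =>
    rw [← (Fin.snocEquiv fun _ => P).sum_comp, Fintype.sum_prod_type_right]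
    rw [Finset.prod_range_succ]
    calc _ = ∑ M : Fin N → P, ∑ p, (∏ i : Fin N,
            g i (fun a : Fin i => M (Fin.castLE i.2.le a)) (M i)) * g N M p := by
          refine Finset.sum_congr rfl fun M _ => Finset.sum_congr rfl fun p _ => ?_
          rw [Fin.prod_univ_castSucc]
          congr 1
          · refine Finset.prod_congr rfl fun i _ => ?_
            congr 1
            · ext a
              exact Fin.snoc_castSucc (α := fun _ => P) p M (Fin.castLE i.2.le a)
            · exact Fin.snoc_castSucc (α := fun _ => P) p M i
          · congr 1
            · ext a
              exact Fin.snoc_castSucc (α := fun _ => P) p M a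
            · exact Fin.snoc_last (α := fun _ => P) p M
      _ ≤ ∑ M : Fin N → P, (∏ i : Fin N,
            g i (fun a : Fin i => M (Fin.castLE i.2.le a)) (M i)) * B N := by
          refine Finset.sum_le_sum fun M _ => ?_
          rw [← Finset.mul_sum]
          gcongr
          exact hg N N.lt_succ_self M
      _ ≤ _ := by
          rw [← Finset.sum_mul]
          gcongr
          exact ih fun k hk => hg k (hk.trans N.lt_succ_self)

/-- The costs in the `i`-th plane. -/
def plane (C : CostArray 3 n) (i : Fin n) : Fin n × Fin n → ℝ := fun e => C ![i, e.1, e.2]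

/-- Reindexing the triples and currying shows that the `n` planes are independent copies of
`planeLaw n`. -/
lemma measurePreserving_plane :
    MeasurePreserving (plane (n := n)) (costLaw 3 n) (Measure.pi fun _ => planeLaw n) := by
  let f : Fin n × (Fin n × Fin n) ≃ (Fin 3 → Fin n) :=
    { toFun := fun q => ![q.1, q.2.1, q.2.2]
      invFun := fun v => (v 0, v 1, v 2)
      left_inv := fun q => rfl
      right_inv := fun v => by ext i; fin_cases i <;> rfl }
  have h1 := (measurePreserving_piCongrLeft (fun _ : Fin 3 → Fin n => expMeasure 1) f).symm
  have h2 : MeasurePreserving (MeasurableEquiv.curry (Fin n) (Fin n × Fin n) ℝ)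
      (Measure.pi fun _ => expMeasure 1) (Measure.pi fun _ => planeLaw n) := by
    refine ⟨MeasurableEquiv.measurable _, ?_⟩
    have := Measure.infinitePi_map_curry
      (fun (_ : Fin n) (_ : Fin n × Fin n) => expMeasure 1)
    simp only [Measure.infinitePi_eq_pi] at this
    exact this
  exact h2.comp h1

lemma avoidsEarlier_iff (M : Fin n → Equiv.Perm (Fin n)) (i : Fin n) (σ : Equiv.Perm (Fin n)) :
    AvoidsEarlier M i σ ↔ σ ∈ matchings (avail fun a : Fin i => M (Fin.castLE i.2.le a)) := by
  simp only [AvoidsEarlier, mem_matchings, avail, Finset.mem_filter, Finset.mem_univ, true_and]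
  constructor
  · intro h j a
    exact h (Fin.castLE i.2.le a) (by rw [Fin.lt_def]; exact a.2) j
  · intro h i' hi' j
    exact h j ⟨i', hi'⟩

lemma IsGreedyOutcome.pairwiseDisjoint {C : CostArray 3 n} {M : Fin n → Equiv.Perm (Fin n)}
    (hM : IsGreedyOutcome C M) : PairwiseDisjointMatchings M := by
  intro a b hne j
  rcases lt_or_gt_of_ne hne with h | h
  · exact ((hM b).1 a h j).symm
  · exact (hM a).1 b h j

/-- The array of the M_i is a Latin square: along the first coordinate `n` pairwise disjoint
matchings give an injection of `Fin n`, hence a bijection; along the other two, each `M i` is a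
permutation. -/
lemma triples_isAxialAssignment {M : Fin n → Equiv.Perm (Fin n)}
    (hM : PairwiseDisjointMatchings M) : IsAxialAssignment (triples M) := by
  have hmem : ∀ v : Fin 3 → Fin n, v ∈ triples M ↔ M (v 0) (v 1) = v 2 := by
    intro v
    simp only [triples, Finset.mem_image, Finset.mem_univ, true_and, Prod.exists]
    constructor
    · rintro ⟨a, b, rfl⟩; rfl
    · intro h; exact ⟨v 0, v 1, by ext i; fin_cases i <;> simp [h]⟩
  intro r x
  have key : ∃! t : Fin n, Function.update x r t ∈ triples M := by
    simp only [hmem]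
    fin_cases r
    · have hb : Function.Bijective fun i => M i (x 1) :=
        Finite.injective_iff_bijective.1 fun a b h => by
          by_contra hne; exact hM a b hne _ h
      simpa using hb.existsUnique (x 2)
    · simpa using (M (x 0)).bijective.existsUnique (x 2)
    · exact ⟨M (x 0) (x 1), by simp, fun t ht => by simpa using ht.symm⟩
  obtain ⟨t, ht, hu⟩ := key
  refine ⟨_, ⟨ht, t, rfl⟩, ?_⟩
  rintro _ ⟨hv, s, rfl⟩
  simp only [] at hv ⊢
  rw [hu s hv]

lemma cost_triples (C : CostArray 3 n) (M : Fin n → Equiv.Perm (Fin n)) :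
    cost C (triples M) = ∑ i, planeCost (plane C i) (M i) := by
  unfold cost triples
  rw [Finset.sum_image, Fintype.sum_prod_type]
  · rfl
  · rintro ⟨a, b⟩ - ⟨c, d⟩ - h
    have h0 := congrFun h 0
    have h1 := congrFun h 1
    simp only [Matrix.cons_val_zero, Matrix.cons_val_one] at h0 h1
    rw [h0, h1]

/-- The exponential moment of the cost of the greedy outcomes, as a tail bound. -/
lemma costLaw_greedy_le (n : ℕ) (z : ℝ) :
    costLaw 3 n {C | ∃ M, IsGreedyOutcome C M ∧ z < cost C (triples M)} ≤
      ENNReal.ofReal (Real.exp (-(1 / 2 * z))) *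
        ∏ k ∈ Finset.range n, 2 ^ (4 * n / (n - k) + 1) := by
  classical
  set w : ∀ k : ℕ, (Fin k → Equiv.Perm (Fin n)) → Equiv.Perm (Fin n) →
      (Fin n × Fin n → ℝ) → ℝ≥0∞ := fun k m σ =>
    if PairwiseDisjointMatchings m then optimalWeight (avail m) σ else 0 with hw
  have hwm : ∀ k m σ, Measurable (w k m σ) := by
    intro k m σ
    simp only [hw]
    split_ifs
    · exact measurable_optimalWeight _ _
    · exact measurable_const
  -- Summing over all conceivable histories removes the dependence of the graph on the costs: for
  -- fixed `M` the `i`-th factor is a function of the `i`-th plane alone, so the mean of the product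
  -- factorizes. Histories that are not disjoint get weight 0, which keeps all graphs that occur
  -- regular.
  set Φ : CostArray 3 n → ℝ≥0∞ := fun C => ∑ M : Fin n → Equiv.Perm (Fin n), ∏ i : Fin n,
    w i (fun a : Fin i => M (Fin.castLE i.2.le a)) (M i) (plane C i) with hΦ
  have hpm := measurePreserving_plane (n := n)
  have hprod : ∀ M : Fin n → Equiv.Perm (Fin n), Measurable fun X : Fin n → Fin n × Fin n → ℝ =>
      ∏ i : Fin n, w i (fun a : Fin i => M (Fin.castLE i.2.le a)) (M i) (X i) := fun M =>
    Finset.measurable_prod _ fun i _ => (hwm _ _ _).comp (measurable_pi_apply i)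
  have hΦm : Measurable Φ := Finset.measurable_sum _ fun M _ => (hprod M).comp hpm.measurable
  have hΦi : ∫⁻ C, Φ C ∂costLaw 3 n ≤ ∏ k ∈ Finset.range n, 2 ^ (4 * n / (n - k) + 1) := by
    rw [hΦ, lintegral_finsetSum]
    swap
    · exact fun M _ => (hprod M).comp hpm.measurable
    have h1 : ∀ M : Fin n → Equiv.Perm (Fin n), ∫⁻ C, ∏ i : Fin n,
        w i (fun a : Fin i => M (Fin.castLE i.2.le a)) (M i) (plane C i) ∂costLaw 3 n =
        ∏ i : Fin n, ∫⁻ x, w i (fun a : Fin i => M (Fin.castLE i.2.le a)) (M i) x ∂planeLaw n := by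
      intro M
      rw [← lintegral_pi_prod (fun _ : Fin n => planeLaw n) fun i => hwm _ _ _,
        ← hpm.lintegral_comp (hprod M)]
    simp_rw [h1]
    refine sum_prod_le (fun k m σ => ∫⁻ x, w k m σ x ∂planeLaw n) _ n fun k hk m => ?_
    by_cases hm : PairwiseDisjointMatchings m
    · simp only [hw, hm, if_true]
      have hreg := isRegular_avail hm
      have hr : 0 < n - k := by omega
      refine (sum_lintegral_optimalWeight_le (hreg.matchings_nonempty hr)).trans
        (expMoment_half_le _ hreg (Nat.succ_pos _) ?_)
      -- Rounding 4n/(n-k) down and adding 1 gives a positive number of steps that suffices for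
      -- `expMoment_half_le`.
      exact (Nat.lt_mul_of_div_lt (Nat.lt_succ_self _) hr).le.trans (by rw [mul_comm])
    · simp [hw, hm]
  -- A greedy outcome makes its own term of Φ equal to e^(cost/2). Markov's inequality then needs
  -- measurability of Φ only, not of the event.
  have hsub : {C | ∃ M, IsGreedyOutcome C M ∧ z < cost C (triples M)} ⊆
      {C | ENNReal.ofReal (Real.exp (1 / 2 * z)) ≤ Φ C} := by
    rintro C ⟨M, hM, hz⟩
    change _ ≤ Φ C
    refine le_trans ?_ (Finset.single_le_sum (fun _ _ => zero_le) (Finset.mem_univ M))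
    have hterm : ∀ i : Fin n, w i (fun a : Fin i => M (Fin.castLE i.2.le a)) (M i) (plane C i) =
        ENNReal.ofReal (Real.exp (1 / 2 * planeCost (plane C i) (M i))) := by
      intro i
      have hd : PairwiseDisjointMatchings fun a : Fin i => M (Fin.castLE i.2.le a) :=
        fun a b hne => hM.pairwiseDisjoint _ _ fun h => hne (Fin.castLE_injective _ h)
      simp only [hw, hd, if_true]
      have hopt : plane C i ∈ optimalSet (avail fun a : Fin i => M (Fin.castLE i.2.le a)) (M i) :=
        ⟨(avoidsEarlier_iff M i _).1 (hM i).1, fun τ hτ =>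
          (hM i).2 τ ((avoidsEarlier_iff M i _).2 hτ)⟩
      exact Set.indicator_of_mem hopt _
    simp_rw [hterm]
    rw [← ENNReal.ofReal_prod_of_nonneg fun _ _ => Real.exp_nonneg _, ← Real.exp_sum,
      ← Finset.mul_sum, ← cost_triples]
    gcongr
  refine (measure_mono hsub).trans ?_
  have hmk := (mul_meas_ge_le_lintegral (μ := costLaw 3 n) hΦm
    (ENNReal.ofReal (Real.exp (1 / 2 * z)))).trans hΦi
  calc _ = ENNReal.ofReal (Real.exp (-(1 / 2 * z))) * (ENNReal.ofReal (Real.exp (1 / 2 * z)) *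
        costLaw 3 n {C | ENNReal.ofReal (Real.exp (1 / 2 * z)) ≤ Φ C}) := by
        rw [← mul_assoc, ← ENNReal.ofReal_mul (Real.exp_nonneg _), ← Real.exp_add]
        simp
    _ ≤ _ := by gcongr

/-- Bounding the summand 1 by n/(n-k) and reversing the order turns the sum into 5n times a harmonic
number. -/
lemma sum_range_div_le (n : ℕ) :
    ((∑ k ∈ Finset.range n, (4 * n / (n - k) + 1) : ℕ) : ℝ) ≤ 5 * (n * (1 + Real.log n)) := by
  have h1 : ((∑ k ∈ Finset.range n, (4 * n / (n - k) + 1) : ℕ) : ℝ) ≤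
      ∑ k ∈ Finset.range n, (5 * n : ℝ) / ((n - 1 - k : ℕ) + 1 : ℕ) := by
    push_cast
    refine Finset.sum_le_sum fun k hk => ?_
    have hk' := Finset.mem_range.1 hk
    have e : n - k = (n - 1 - k) + 1 := by omega
    rw [e]
    have h2 : (((4 * n / (n - 1 - k + 1) : ℕ)) : ℝ) ≤ (4 * n : ℕ) / ((n - 1 - k + 1 : ℕ) : ℝ) :=
      Nat.cast_div_le
    have h3 : (1 : ℝ) ≤ n / ((n - 1 - k + 1 : ℕ) : ℝ) := by
      rw [one_le_div (by positivity)]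
      exact_mod_cast (by omega : n - 1 - k + 1 ≤ n)
    push_cast at h2 h3 ⊢
    calc _ ≤ (4 * n : ℝ) / ((n - 1 - k : ℕ) + 1) + n / ((n - 1 - k : ℕ) + 1) := add_le_add h2 h3
      _ = _ := by ring
  refine h1.trans ?_
  rw [Finset.sum_range_reflect (fun k => (5 * n : ℝ) / ((k + 1 : ℕ) : ℝ))]
  simp_rw [div_eq_mul_inv]
  rw [← Finset.mul_sum, mul_assoc]
  have h4 := harmonic_le_one_add_log n
  rw [harmonic] at h4
  push_cast at h4 ⊢
  gcongr

theorem exists_tendsto_costLaw_greedy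
    (f : ∀ n : ℕ, CostArray 3 n → Fin n → Equiv.Perm (Fin n))
    (hf : ∀ n C, IsGreedyOutcome C (f n C)) :
    ∃ K : ℝ, Tendsto (fun n : ℕ =>
      costLaw 3 n {C | ¬ cost C (triples (f n C)) ≤ K * ((n : ℝ) * Real.log n)}) atTop (𝓝 0) := by
  -- With 2 ≤ e, the exponent is at most -11 n log n + 5n(1 + log n), which is at most -n once log n
  -- ≥ 1.
  refine ⟨22, ?_⟩
  have h1 : Tendsto (fun n : ℕ => ENNReal.ofReal (Real.exp (-(n : ℝ)))) atTop (𝓝 0) := by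
    rw [← ENNReal.ofReal_zero]
    exact ENNReal.tendsto_ofReal (Real.tendsto_exp_neg_atTop_nhds_zero.comp
      tendsto_natCast_atTop_atTop)
  refine tendsto_of_tendsto_of_tendsto_of_le_of_le' tendsto_const_nhds h1
    (Eventually.of_forall fun _ => zero_le) ?_
  filter_upwards [eventually_ge_atTop 3] with n hn
  have hlog : 1 ≤ Real.log n := by
    rw [Real.le_log_iff_exp_le (by positivity)]
    have : (3 : ℝ) ≤ n := by exact_mod_cast hn
    linarith [Real.exp_one_lt_d9]
  refine (measure_mono ?_).trans ((costLaw_greedy_le n (22 * ((n : ℝ) * Real.log n))).trans ?_)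
  · intro C hC
    exact ⟨f n C, hf n C, not_le.1 hC⟩
  · rw [Finset.prod_pow_eq_pow_sum]
    have h2 : (2 : ℝ≥0∞) ≤ ENNReal.ofReal (Real.exp 1) := by
      rw [← ENNReal.ofReal_ofNat]
      exact ENNReal.ofReal_le_ofReal (by linarith [Real.add_one_le_exp (1 : ℝ)])
    calc _ ≤ ENNReal.ofReal (Real.exp (-(1 / 2 * (22 * (n * Real.log n))))) *
          ENNReal.ofReal (Real.exp 1) ^ (∑ k ∈ Finset.range n, (4 * n / (n - k) + 1)) := by
          gcongr
      _ = ENNReal.ofReal (Real.exp (-(1 / 2 * (22 * (n * Real.log n))) +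
          (∑ k ∈ Finset.range n, (4 * n / (n - k) + 1) : ℕ))) := by
          rw [← ENNReal.ofReal_pow (Real.exp_nonneg _), ← Real.exp_nat_mul,
            ← ENNReal.ofReal_mul (Real.exp_nonneg _), ← Real.exp_add, mul_one]
      _ ≤ _ := by
          refine ENNReal.ofReal_le_ofReal (Real.exp_le_exp.2 ?_)
          have h3 := sum_range_div_le n
          have hn0 : (0 : ℝ) ≤ n := by positivity
          nlinarith

end Greedy
end AxialAssignment

namespace AxialAssignment

/-! ### A calculus of invariants and step bounds for the machine. -/

section Machine

/-- The program writes to the array `a` of natural numbers. -/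
def Program.writesNat : Program → ℕ → Bool
  | skip, _ => false
  | setNat b _ _ _ _, a => a == b
  | setReal _ _ _ _ _, _ => false
  | seq P Q, a => P.writesNat a || Q.writesNat a
  | branch _ P Q, a => P.writesNat a || Q.writesNat a
  | loop _ P, a => P.writesNat a

/-- The program writes to the array `a` of real numbers. -/
def Program.writesReal : Program → ℕ → Bool
  | skip, _ => false
  | setNat _ _ _ _ _, _ => false
  | setReal b _ _ _ _, a => a == b
  | seq P Q, a => P.writesReal a || Q.writesReal a
  | branch _ P Q, a => P.writesReal a || Q.writesReal a
  | loop _ P, a => P.writesReal a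

lemma write_array_of_ne {β : Type} (m : ℕ → ℕ → ℕ → ℕ → β) {a b : ℕ} (i j k : ℕ) (v : β)
    (h : b ≠ a) : write m a i j k v b = m b := by
  funext i' j' k'; simp [write, h]

lemma Exec.nat_eq {P : Program} {s s' : Memory} {t a : ℕ} (h : Exec P s t s')
    (ha : P.writesNat a = false) : s'.nat a = s.nat a := by
  induction h with
  | skip | setReal | loopFalse => rfl
  | setNat b i j k e s =>
    refine write_array_of_ne _ _ _ _ _ ?_
    simpa [Program.writesNat] using ha
  | seq _ _ ih₁ ih₂ =>
    simp only [Program.writesNat, Bool.or_eq_false_iff] at ha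
    rw [ih₂ ha.2, ih₁ ha.1]
  | branchTrue _ _ ih =>
    simp only [Program.writesNat, Bool.or_eq_false_iff] at ha
    exact ih ha.1
  | branchFalse _ _ ih =>
    simp only [Program.writesNat, Bool.or_eq_false_iff] at ha
    exact ih ha.2
  | loopTrue _ _ _ ih₁ ih₂ => rw [ih₂ ha, ih₁ ha]

lemma Exec.real_eq {P : Program} {s s' : Memory} {t a : ℕ} (h : Exec P s t s')
    (ha : P.writesReal a = false) : s'.real a = s.real a := by
  induction h with
  | skip | setNat | loopFalse => rfl
  | setReal b i j k e s =>
    refine write_array_of_ne _ _ _ _ _ ?_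
    simpa [Program.writesReal] using ha
  | seq _ _ ih₁ ih₂ =>
    simp only [Program.writesReal, Bool.or_eq_false_iff] at ha
    rw [ih₂ ha.2, ih₁ ha.1]
  | branchTrue _ _ ih =>
    simp only [Program.writesReal, Bool.or_eq_false_iff] at ha
    exact ih ha.1
  | branchFalse _ _ ih =>
    simp only [Program.writesReal, Bool.or_eq_false_iff] at ha
    exact ih ha.2
  | loopTrue _ _ _ ih₁ ih₂ => rw [ih₂ ha, ih₁ ha]

/-- The memory `s'` agrees with `s` in all arrays that `P` does not write to. -/
def Frame (P : Program) (s s' : Memory) : Prop :=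
  (∀ a, P.writesNat a = false → s'.nat a = s.nat a) ∧
    ∀ a, P.writesReal a = false → s'.real a = s.real a

lemma Frame.refl (P : Program) (s : Memory) : Frame P s s := ⟨fun _ _ => rfl, fun _ _ => rfl⟩

lemma Frame.trans {P : Program} {s s' s'' : Memory} (h : Frame P s s') (h' : Frame P s' s'') :
    Frame P s s'' :=
  ⟨fun a ha => (h'.1 a ha).trans (h.1 a ha), fun a ha => (h'.2 a ha).trans (h.2 a ha)⟩

lemma Exec.frame {P : Program} {s s' : Memory} {t : ℕ} (h : Exec P s t s') : Frame P s s' :=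
  ⟨fun _ ha => h.nat_eq ha, fun _ ha => h.real_eq ha⟩

/-- The program `P`, started with memory `s`, halts within `T` steps with a memory that
satisfies `Q`. -/
def Runs (P : Program) (s : Memory) (T : ℕ) (Q : Memory → Prop) : Prop :=
  ∃ t s', Exec P s t s' ∧ t ≤ T ∧ Q s'

namespace Runs
variable {P R : Program} {s : Memory} {T T' : ℕ} {Q Q' : Memory → Prop}

lemma mono (h : Runs P s T Q) (hT : T ≤ T') (hQ : ∀ s', Q s' → Q' s') : Runs P s T' Q' := by
  obtain ⟨t, s', he, ht, hq⟩ := h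
  exact ⟨t, s', he, ht.trans hT, hQ _ hq⟩

lemma frame (h : Runs P s T Q) : Runs P s T fun s' => Q s' ∧ Frame P s s' := by
  obtain ⟨t, s', he, ht, hq⟩ := h
  exact ⟨t, s', he, ht, hq, he.frame⟩

lemma skip (h : Q s) : Runs .skip s 1 Q := ⟨1, s, .skip s, le_rfl, h⟩

lemma setNat {a : ℕ} {i j k e : NatExpr}
    (h : Q { s with nat := write s.nat a (i.eval s) (j.eval s) (k.eval s) (e.eval s) }) :
    Runs (.setNat a i j k e) s 1 Q := ⟨1, _, .setNat a i j k e s, le_rfl, h⟩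

lemma setReal {a : ℕ} {i j k : NatExpr} {e : RealExpr}
    (h : Q { s with real := write s.real a (i.eval s) (j.eval s) (k.eval s) (e.eval s) }) :
    Runs (.setReal a i j k e) s 1 Q := ⟨1, _, .setReal a i j k e s, le_rfl, h⟩

lemma seq (h : Runs P s T fun s' => Runs R s' T' Q) : Runs (.seq P R) s (T + T') Q := by
  obtain ⟨t, s', he, ht, t', s'', he', ht', hq⟩ := h
  exact ⟨t + t', s'', .seq he he', by omega, hq⟩

lemma branch {b : Test} (h₁ : b.Holds s → Runs P s T Q) (h₂ : ¬ b.Holds s → Runs R s T Q) :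
    Runs (.branch b P R) s (T + 1) Q := by
  by_cases hb : b.Holds s
  · obtain ⟨t, s', he, ht, hq⟩ := h₁ hb
    exact ⟨t + 1, s', .branchTrue hb he, by omega, hq⟩
  · obtain ⟨t, s', he, ht, hq⟩ := h₂ hb
    exact ⟨t + 1, s', .branchFalse hb he, by omega, hq⟩

/-- The index of the invariant is a variant that drops in every round, so it bounds the number of
rounds. A round takes one test and at most `T` steps, and one more test ends the loop. -/
lemma loop {b : Test} {Inv : ℕ → Memory → Prop}
    (step : ∀ m s', Frame P s s' → b.Holds s' → Inv m s' →
      Runs P s' T fun s'' => ∃ m' < m, Inv m' s'') {m : ℕ} (h : Inv m s) :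
    Runs (.loop b P) s (m * (T + 1) + 1) fun s' => (∃ m', Inv m' s') ∧ ¬ b.Holds s' := by
  have key : ∀ m s', Frame P s s' → Inv m s' →
      Runs (.loop b P) s' (m * (T + 1) + 1) fun s' => (∃ m', Inv m' s') ∧ ¬ b.Holds s' := by
    intro m
    induction m using Nat.strong_induction_on with
    | _ m ih =>
      intro s' hf hs'
      by_cases hb : b.Holds s'
      · obtain ⟨t, s₁, he, ht, m', hm', hq⟩ := step m s' hf hb hs'
        obtain ⟨t', s₂, he', ht', hq'⟩ := ih m' hm' s₁ (hf.trans he.frame) hq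
        refine ⟨t + t' + 1, s₂, .loopTrue hb he he', ?_, hq'⟩
        have : (m' + 1) * (T + 1) ≤ m * (T + 1) := Nat.mul_le_mul_right _ hm'
        rw [add_mul] at this
        omega
      · exact ⟨1, s', .loopFalse hb, by omega, ⟨m, hs'⟩, hb⟩
  exact key m s (Frame.refl P s) h

end Runs

/-- A scalar variable, stored in the first cell of the array `a`. -/
abbrev NatExpr.var (a : ℕ) : NatExpr := .get a (.lit 0) (.lit 0) (.lit 0)

/-- A cell of a one-dimensional array. -/
abbrev NatExpr.cell (a : ℕ) (i : NatExpr) : NatExpr := .get a i (.lit 0) (.lit 0)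

/-- A cell of a one-dimensional array. -/
abbrev RealExpr.cell (a : ℕ) (i : NatExpr) : RealExpr := .get a i (.lit 0) (.lit 0)

/-- The strict comparison of natural numbers. -/
abbrev Test.natLt (e₁ e₂ : NatExpr) : Test := .natLe (.add e₁ (.lit 1)) e₂

/-- Assign a value to a scalar variable. -/
abbrev Program.setVar (a : ℕ) (e : NatExpr) : Program := .setNat a (.lit 0) (.lit 0) (.lit 0) e

/-- Assign a value to a cell of a one-dimensional array. -/
abbrev Program.setCell (a : ℕ) (i e : NatExpr) : Program := .setNat a i (.lit 0) (.lit 0) e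

/-- Assign a value to a cell of a one-dimensional array. -/
abbrev Program.setRealCell (a : ℕ) (i : NatExpr) (e : RealExpr) : Program :=
  .setReal a i (.lit 0) (.lit 0) e

/-- Run `P` with the variable `c` taking the values from `0` up to the bound. -/
def Program.forLoop (c : ℕ) (bound : NatExpr) (P : Program) : Program :=
  .seq (.setVar c (.lit 0))
    (.loop (.natLt (.var c) bound) (.seq P (.setVar c (.add (.var c) (.lit 1)))))

/-- The counter changes between the rounds, so the invariant must not depend on its cell (`hInv`). A
round costs the body, the increment and the test; the final 2 is the initialization and the failing
test. -/
lemma Runs.forLoop {c : ℕ} {bound : NatExpr} {P : Program} {s : Memory} {N T : ℕ}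
    {Inv : ℕ → Memory → Prop} (hc : P.writesNat c = false)
    (hbound : ∀ s', Frame (.forLoop c bound P) s s' → bound.eval s' = N)
    (hInv : ∀ x s' v, Inv x s' → Inv x { s' with nat := write s'.nat c 0 0 0 v })
    (step : ∀ x < N, ∀ s', Frame (.forLoop c bound P) s s' → s'.nat c 0 0 0 = x → Inv x s' →
      Runs P s' T (Inv (x + 1))) (h0 : Inv 0 s) :
    Runs (.forLoop c bound P) s (N * (T + 2) + 2) (Inv N) := by
  set s₀ : Memory := { s with nat := write s.nat c 0 0 0 0 } with hs₀
  have hf₀ : Frame (.forLoop c bound P) s s₀ := by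
    refine ⟨fun a ha => write_array_of_ne _ _ _ _ _ ?_, fun _ _ => rfl⟩
    rintro rfl
    simp [Program.forLoop, Program.writesNat] at ha
  have hwn : ∀ a, (Program.forLoop c bound P).writesNat a =
      (Program.seq P (.setVar c (.add (.var c) (.lit 1)))).writesNat a := by
    intro a; simp [Program.forLoop, Program.writesNat, Bool.or_comm]
  have hwr : ∀ a, (Program.forLoop c bound P).writesReal a =
      (Program.seq P (.setVar c (.add (.var c) (.lit 1)))).writesReal a := by
    intro a; simp [Program.forLoop, Program.writesReal]
  have hfr : ∀ s', Frame (Program.seq P (.setVar c (.add (.var c) (.lit 1)))) s₀ s' →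
      Frame (.forLoop c bound P) s s' := fun s' h =>
    hf₀.trans ⟨fun a ha => h.1 a (by rwa [← hwn]), fun a ha => h.2 a (by rwa [← hwr])⟩
  refine Runs.mono (T := 1 + (N * (T + 1 + 1) + 1)) (Q := Inv N)
    (Runs.seq (Runs.setNat ?_)) (by ring_nf; omega) fun _ h => h
  change Runs _ s₀ _ _
  refine Runs.mono (Runs.loop (T := T + 1)
    (Inv := fun m s' => ∃ x, x + m = N ∧ s'.nat c 0 0 0 = x ∧ Inv x s' ∧
      bound.eval s' = N) ?_ (m := N)
    ⟨0, by simp, by simp [hs₀, write], hInv _ _ _ h0, hbound _ hf₀⟩) le_rfl ?_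
  · rintro m s' hf hb ⟨x, hx, hcx, hI, hbd⟩
    have hlt : x < N := by
      have : s'.nat c 0 0 0 + 1 ≤ bound.eval s' := hb
      omega
    refine Runs.seq ((step x hlt s' (hfr s' hf) hcx hI).frame.mono le_rfl ?_)
    rintro s'' ⟨hI', hf'⟩
    refine Runs.setNat ?_
    have hcx' : s''.nat c 0 0 0 = x := by rw [hf'.1 c hc, hcx]
    refine ⟨m - 1, by omega, x + 1, by omega, ?_, hInv _ _ _ hI', ?_⟩
    · simp [write, NatExpr.eval, hcx']
    · refine hbound _ (hfr _ (hf.trans ⟨fun a ha => ?_, fun a ha => ?_⟩))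
      · simp only [Program.writesNat, Bool.or_eq_false_iff] at ha
        rw [← hf'.1 a ha.1]
        refine write_array_of_ne _ _ _ _ _ ?_
        simpa using ha.2
      · simp only [Program.writesReal, Bool.or_eq_false_iff] at ha
        exact hf'.2 a ha.1
  · rintro s' ⟨⟨m, x, hx, hcx, hI, hbd⟩, hb⟩
    have : ¬ (s'.nat c 0 0 0 + 1 ≤ bound.eval s') := hb
    have : x = N := by omega
    rwa [this] at hI

end Machine
end AxialAssignment

namespace AxialAssignment

/-! ### Correctness of the Hungarian method, independently of the machine. -/

section Hungarian

/-- A feasible dual solution `u, v` together with a matching of the rows below `q` that uses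
tight allowed edges only; `p k` is the row that is matched to the column `k`, if `p k < n`. -/
structure DualState (n q : ℕ) (c : ℕ → ℕ → ℝ) (ok : ℕ → ℕ → Prop) (u v : ℕ → ℝ)
    (p : ℕ → ℕ) : Prop where
  feas : ∀ j < n, ∀ k < n, ok j k → u j + v k ≤ c j k
  tight : ∀ k < n, p k < n → ok (p k) k ∧ u (p k) + v k = c (p k) k
  inj : ∀ k < n, ∀ k' < n, p k < n → p k = p k' → k = k'
  lt : ∀ k < n, p k < n → p k < q
  surj : ∀ j < q, ∃ k < n, p k = j

/-- The search for an augmenting path from the row `q`, which is assigned to the virtual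
column `n`. The set of the columns (rows) reached is `T` (`S`), and `way k` is the predecessor of
the column `k`. -/
structure SearchState (n q : ℕ) (c : ℕ → ℕ → ℝ) (ok : ℕ → ℕ → Prop) (u v : ℕ → ℝ)
    (p : ℕ → ℕ) (T S : ℕ → Prop) (way : ℕ → ℕ) (cur τ : ℕ) : Prop where
  base : DualState n q c ok u v p
  q_lt : q < n
  p_n : p n = q
  T_n : T n
  S_iff : ∀ j < n, S j ↔ ∃ k ≤ n, T k ∧ p k = j
  cur_le : cur ≤ n
  T_cur : T cur
  matched : ∀ k < n, T k → k ≠ cur → p k < n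
  card : {k | k < n ∧ T k}.ncard = τ
  path : ∃ ord : ℕ → ℕ, (∀ k ≤ n, T k → ord k ≤ τ) ∧ ∀ k < n, T k →
    way k ≤ n ∧ T (way k) ∧ ord (way k) < ord k ∧ ok (p (way k)) k ∧
      u (p (way k)) + v k = c (p (way k)) k

variable {n q : ℕ} {c : ℕ → ℕ → ℝ} {ok : ℕ → ℕ → Prop} {u v : ℕ → ℝ} {p : ℕ → ℕ}
  {T S : ℕ → Prop} {way : ℕ → ℕ} {cur τ : ℕ}

lemma SearchState.start {p' : ℕ → ℕ} (h : DualState n q c ok u v p) (hq : q < n)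
    (hp : ∀ k < n, p' k = p k) (hpn : p' n = q) (hT : ∀ k < n, ¬ T k) (hTn : T n)
    (hS : ∀ j < n, S j ↔ j = q) : SearchState n q c ok u v p' T S way n 0 where
  base :=
    { feas := h.feas
      tight := fun k hk hlt => by rw [hp k hk] at *; exact h.tight k hk hlt
      inj := fun k hk k' hk' hlt heq => by
        rw [hp k hk] at *; rw [hp k' hk'] at heq; exact h.inj k hk k' hk' hlt heq
      lt := fun k hk hlt => by rw [hp k hk] at *; exact h.lt k hk hlt
      surj := fun j hj => by
        obtain ⟨k, hk, e⟩ := h.surj j hj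
        exact ⟨k, hk, by rw [hp k hk, e]⟩ }
  q_lt := hq
  p_n := hpn
  T_n := hTn
  S_iff := fun j hj => by
    rw [hS j hj]
    constructor
    · rintro rfl; exact ⟨n, le_rfl, hTn, hpn⟩
    · rintro ⟨k, hk, hk', rfl⟩
      rcases hk.lt_or_eq with hlt | rfl
      · exact absurd hk' (hT k hlt)
      · exact hpn
  cur_le := le_rfl
  T_cur := hTn
  matched := fun k hk hk' => absurd hk' (hT k hk)
  card := by
    have : {k | k < n ∧ T k} = ∅ := Set.eq_empty_of_forall_notMem fun k hk => hT k hk.1 hk.2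
    rw [this, Set.ncard_empty]
  path := ⟨fun _ => 0, fun _ _ _ => le_rfl, fun k hk hk' => absurd hk' (hT k hk)⟩

/-- Each round reaches a new column, so this bounds the number of rounds of a search. -/
lemma SearchState.card_le (h : SearchState n q c ok u v p T S way cur τ) : τ ≤ n := by
  rw [← h.card]
  refine (Set.ncard_le_ncard (t := ↑(Finset.range n)) (fun k hk => ?_)).trans ?_
  · simpa using hk.1
  · rw [Set.ncard_coe_finset, Finset.card_range]

lemma SearchState.all_matched (h : SearchState n q c ok u v p T S way cur τ) (hcur : p cur < n) :
    ∀ k ≤ n, T k → p k < n := by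
  intro k hk hT
  by_cases hkc : k = cur
  · rwa [hkc]
  · rcases hk.lt_or_eq with hlt | rfl
    · exact h.matched k hlt hT hkc
    · rw [h.p_n]; exact h.q_lt

/-- Injectivity extends to the virtual column `n`, because the rows matched so far are below `q`. -/
lemma SearchState.inj' (h : SearchState n q c ok u v p T S way cur τ) :
    ∀ k ≤ n, ∀ k' ≤ n, p k < n → p k = p k' → k = k' := by
  intro k hk k' hk' hlt heq
  rcases hk.lt_or_eq with h1 | h1 <;> rcases hk'.lt_or_eq with h2 | h2
  · exact h.base.inj k h1 k' h2 hlt heq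
  · subst h2
    have := h.base.lt k h1 hlt
    rw [heq, h.p_n] at this
    exact absurd this (lt_irrefl _)
  · subst h1
    have := h.base.lt k' h2 (heq ▸ hlt)
    rw [← heq, h.p_n] at this
    exact absurd this (lt_irrefl _)
  · rw [h1, h2]

/-- An allowed edge leaves the set of the columns reached, if there is an allowed perfect
matching. -/
lemma SearchState.exists_candidate (h : SearchState n q c ok u v p T S way cur τ)
    (hcur : p cur < n) {g : ℕ → ℕ} (hg : ∀ j < n, g j < n ∧ ok j (g j))
    (hgi : ∀ j < n, ∀ j' < n, g j = g j' → j = j') :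
    ∃ a ≤ n, ∃ b < n, T a ∧ ¬ T b ∧ ok (p a) b := by
  classical
  by_contra! hno
  have hm := h.all_matched hcur
  set A := (Finset.range (n + 1)).filter T with hA
  have hmem : ∀ k ∈ A, k ≤ n ∧ T k := fun k hk => by
    rw [hA, Finset.mem_filter, Finset.mem_range] at hk
    exact ⟨by omega, hk.2⟩
  have hnA : n ∈ A := by rw [hA, Finset.mem_filter, Finset.mem_range]; exact ⟨by omega, h.T_n⟩
  -- If no allowed edge leaves, the perfect matching `g` maps the rows of the reached columns
  -- injectively to reached columns other than the virtual one, of which there is one fewer.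
  have hle : A.card ≤ (A.erase n).card := by
    refine Finset.card_le_card_of_injOn (fun k => g (p k)) ?_ ?_
    · intro k hk
      obtain ⟨h1, h2⟩ := hmem k hk
      obtain ⟨h3, h4⟩ := hg _ (hm k h1 h2)
      have h5 : T (g (p k)) := by
        by_contra hT
        exact hno k h1 _ h3 h2 hT h4
      have h6 : g (p k) ∈ A := by
        rw [hA, Finset.mem_filter, Finset.mem_range]; exact ⟨by omega, h5⟩
      exact Finset.mem_coe.2 (Finset.mem_erase.2 ⟨h3.ne, h6⟩)
    · intro k hk k' hk' heq
      obtain ⟨h1, h2⟩ := hmem k hk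
      obtain ⟨h3, h4⟩ := hmem k' hk'
      exact h.inj' k h1 k' h3 (hm k h1 h2) (hgi _ (hm k h1 h2) _ (hm k' h3 h4) heq)
  have := Finset.card_erase_lt_of_mem hnA
  omega

/-- Adding the least slack δ on `S` and subtracting it on `T` keeps the edges inside the tree tight
and makes the new edge tight. Edges from `S` out of `T` stay feasible by minimality of δ, and those
from outside `S` into `T` only become looser. -/
lemma SearchState.step (h : SearchState n q c ok u v p T S way cur τ) (hcur : p cur < n)
    {a b : ℕ} (ha : a ≤ n) (hb : b < n) (hTa : T a) (hTb : ¬ T b) (hok : ok (p a) b)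
    {u' v' : ℕ → ℝ} {T' S' : ℕ → Prop} {way' : ℕ → ℕ} {δ : ℝ}
    (hδ : δ = c (p a) b - u (p a) - v b)
    (hmin : ∀ a' ≤ n, ∀ b' < n, T a' → ¬ T b' → ok (p a') b' →
      δ ≤ c (p a') b' - u (p a') - v b')
    (hu : ∀ j < n, (S j → u' j = u j + δ) ∧ (¬ S j → u' j = u j))
    (hv : ∀ k < n, (T k → v' k = v k - δ) ∧ (¬ T k → v' k = v k))
    (hT' : ∀ k ≤ n, T' k ↔ T k ∨ k = b) (hS' : ∀ j < n, S' j ↔ S j ∨ j = p b)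
    (hwb : way' b = a) (hw : ∀ k < n, k ≠ b → way' k = way k) :
    SearchState n q c ok u' v' p T' S' way' b (τ + 1) := by
  have hm := h.all_matched hcur
  have hSp : ∀ k ≤ n, p k < n → (S (p k) ↔ T k) := by
    intro k hk hlt
    rw [h.S_iff _ hlt]
    constructor
    · rintro ⟨k', hk', hT, heq⟩
      rwa [← h.inj' k' hk' k hk (heq ▸ hlt) heq]
    · exact fun hT => ⟨k, hk, hT, rfl⟩
  have hδ0 : 0 ≤ δ := by
    have := h.base.feas _ (hm a ha hTa) b hb hok
    linarith
  have hsum : ∀ k ≤ n, T k → ∀ k' < n, T k' → u' (p k) + v' k' = u (p k) + v k' := by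
    intro k hk hT k' hk' hT'
    rw [(hu _ (hm k hk hT)).1 ((hSp k hk (hm k hk hT)).2 hT), (hv k' hk').1 hT']
    ring
  exact
  { base :=
      { feas := by
          intro j hj k hk hjk
          have h0 := h.base.feas j hj k hk hjk
          by_cases hS : S j <;> by_cases hT : T k
          · rw [(hu j hj).1 hS, (hv k hk).1 hT]; linarith
          · rw [(hu j hj).1 hS, (hv k hk).2 hT]
            obtain ⟨a', ha', hTa', rfl⟩ := (h.S_iff j hj).1 hS
            have := hmin a' ha' k hk hTa' hT hjk
            linarith
          · rw [(hu j hj).2 hS, (hv k hk).1 hT]; linarith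
          · rw [(hu j hj).2 hS, (hv k hk).2 hT]; exact h0
        tight := by
          intro k hk hlt
          obtain ⟨h1, h2⟩ := h.base.tight k hk hlt
          refine ⟨h1, ?_⟩
          by_cases hT : T k
          · rw [hsum k hk.le hT k hk hT, h2]
          · rw [(hu _ hlt).2 (fun hS => hT ((hSp k hk.le hlt).1 hS)), (hv k hk).2 hT, h2]
        inj := h.base.inj
        lt := h.base.lt
        surj := h.base.surj }
    q_lt := h.q_lt
    p_n := h.p_n
    T_n := (hT' n le_rfl).2 (Or.inl h.T_n)
    S_iff := by
      intro j hj
      rw [hS' j hj, h.S_iff j hj]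
      constructor
      · rintro (⟨k, hk, hT, rfl⟩ | rfl)
        · exact ⟨k, hk, (hT' k hk).2 (Or.inl hT), rfl⟩
        · exact ⟨b, hb.le, (hT' b hb.le).2 (Or.inr rfl), rfl⟩
      · rintro ⟨k, hk, hT, rfl⟩
        rcases (hT' k hk).1 hT with h1 | rfl
        · exact Or.inl ⟨k, hk, h1, rfl⟩
        · exact Or.inr rfl
    cur_le := hb.le
    T_cur := (hT' b hb.le).2 (Or.inr rfl)
    matched := by
      intro k hk hT hne
      rcases (hT' k hk.le).1 hT with h1 | h1
      · exact hm k hk.le h1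
      · exact absurd h1 hne
    card := by
      have h1 : {k | k < n ∧ T' k} = insert b {k | k < n ∧ T k} := by
        ext k
        simp only [Set.mem_ofPred_eq, Set.mem_insert_iff]
        constructor
        · rintro ⟨hk, hT⟩
          rcases (hT' k hk.le).1 hT with h1 | h1
          · exact Or.inr ⟨hk, h1⟩
          · exact Or.inl h1
        · rintro (rfl | ⟨hk, hT⟩)
          · exact ⟨hb, (hT' k hb.le).2 (Or.inr rfl)⟩
          · exact ⟨hk, (hT' k hk.le).2 (Or.inl hT)⟩
      have hfin : {k | k < n ∧ T k}.Finite := (Set.finite_lt_nat n).subset fun k hk => hk.1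
      rw [h1, Set.ncard_insert_of_notMem (fun hk => hTb hk.2) hfin, h.card]
    path := by
      obtain ⟨ord, hord, hpath⟩ := h.path
      -- The column `b` is reached last and gets the largest rank. Ranks drop along `way`, which
      -- excludes cycles.
      refine ⟨fun k => if k = b then τ + 1 else ord k, fun k hk hT => ?_, fun k hk hT => ?_⟩
      · simp only []
        split_ifs with hkb
        · exact le_rfl
        · exact (hord k hk (((hT' k hk).1 hT).resolve_right hkb)).trans (Nat.le_succ _)
      · have hab : a ≠ b := fun e => hTb (e ▸ hTa)
        by_cases hkb : k = b
        · subst hkb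
          simp only [hwb, if_true, if_neg hab]
          refine ⟨ha, (hT' a ha).2 (Or.inl hTa), Nat.lt_succ_of_le (hord a ha hTa), hok, ?_⟩
          rw [(hu _ (hm a ha hTa)).1 ((hSp a ha (hm a ha hTa)).2 hTa), (hv k hk).2 hTb, hδ]
          ring
        · have hTk : T k := ((hT' k hk.le).1 hT).resolve_right hkb
          obtain ⟨h1, h2, h3, h4, h5⟩ := hpath k hk hTk
          have hwb' : way k ≠ b := fun e => hTb (e ▸ h2)
          rw [hw k hk hkb]
          simp only [if_neg hkb, if_neg hwb']
          refine ⟨h1, (hT' _ h1).2 (Or.inl h2), h3, h4, ?_⟩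
          rw [hsum _ h1 h2 k hk hTk, h5] }

/-- The augmentation along the path found: the column `cur` is still to be assigned the row of its
predecessor. -/
structure AugmentState (n q : ℕ) (c : ℕ → ℕ → ℝ) (ok : ℕ → ℕ → Prop) (u v : ℕ → ℝ)
    (p : ℕ → ℕ) (way : ℕ → ℕ) (cur m : ℕ) : Prop where
  q_lt : q < n
  feas : ∀ j < n, ∀ k < n, ok j k → u j + v k ≤ c j k
  tight : ∀ k < n, k ≠ cur → p k < n → ok (p k) k ∧ u (p k) + v k = c (p k) k
  inj : ∀ k ≤ n, ∀ k' ≤ n, k ≠ cur → k' ≠ cur → p k < n → p k = p k' → k = k'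
  le : ∀ k ≤ n, k ≠ cur → p k < n → p k ≤ q
  surj : ∀ j ≤ q, ∃ k ≤ n, k ≠ cur ∧ p k = j
  cur_le : cur ≤ n
  path : ∃ (T : ℕ → Prop) (ord : ℕ → ℕ), T cur ∧ ord cur ≤ m ∧
    ∀ k < n, T k → ord k ≤ ord cur → way k ≤ n ∧ T (way k) ∧ ord (way k) < ord k ∧
      ok (p (way k)) k ∧ u (p (way k)) + v k = c (p (way k)) k

lemma SearchState.toAugmentState (h : SearchState n q c ok u v p T S way cur τ)
    (hcur : ¬ p cur < n) : AugmentState n q c ok u v p way cur τ where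
  q_lt := h.q_lt
  feas := h.base.feas
  tight := fun k hk _ hlt => h.base.tight k hk hlt
  inj := fun k hk k' hk' _ _ hlt heq => h.inj' k hk k' hk' hlt heq
  le := fun k hk _ hlt => by
    rcases hk.lt_or_eq with h1 | rfl
    · exact (h.base.lt k h1 hlt).le
    · exact h.p_n.le
  surj := fun j hj => by
    have hlt := h.q_lt
    rcases hj.lt_or_eq with h1 | rfl
    · obtain ⟨k, hk, hkj⟩ := h.base.surj j h1
      exact ⟨k, hk.le, by rintro rfl; omega, hkj⟩
    · exact ⟨n, le_rfl, by rintro rfl; exact hcur (h.p_n ▸ hlt), h.p_n⟩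
  cur_le := h.cur_le
  path := by
    obtain ⟨ord, hord, hpath⟩ := h.path
    exact ⟨T, ord, h.T_cur, hord _ h.cur_le h.T_cur, fun k hk hT _ => hpath k hk hT⟩

/-- The column `cur` is a hole: it takes over the row of its predecessor, and the hole moves there.
Only columns of rank at most that of the hole matter afterwards, and the paths from them avoid the
columns already changed. -/
lemma AugmentState.step {m : ℕ} (h : AugmentState n q c ok u v p way cur m) (hcur : cur < n)
    {p' : ℕ → ℕ} (hpc : p' cur = p (way cur)) (hp : ∀ k ≤ n, k ≠ cur → p' k = p k) :
    ∃ m' < m, AugmentState n q c ok u v p' way (way cur) m' := by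
  obtain ⟨T, ord, hT, hm, hpath⟩ := h.path
  obtain ⟨hw, hTw, hlt, hok, htight⟩ := hpath cur hcur hT le_rfl
  have hne : way cur ≠ cur := fun e => by rw [e] at hlt; exact lt_irrefl _ hlt
  refine ⟨ord (way cur), hlt.trans_le hm, ?_⟩
  exact
  { q_lt := h.q_lt
    feas := h.feas
    tight := by
      intro k hk hkw hkn
      by_cases hkc : k = cur
      · subst hkc; rw [hpc]; exact ⟨hok, htight⟩
      · rw [hp k hk.le hkc] at *; exact h.tight k hk hkc hkn
    inj := by
      intro k hk k' hk' hkw hkw' hkn heq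
      by_cases hkc : k = cur <;> by_cases hkc' : k' = cur
      · rw [hkc, hkc']
      · subst hkc
        rw [hpc] at hkn
        rw [hpc, hp k' hk' hkc'] at heq
        exact absurd (h.inj _ hw k' hk' hne hkc' hkn heq).symm hkw'
      · subst hkc'
        rw [hp k hk hkc] at hkn
        rw [hpc, hp k hk hkc] at heq
        exact absurd (h.inj k hk _ hw hkc hne hkn heq) hkw
      · rw [hp k hk hkc] at *
        rw [hp k' hk' hkc'] at heq
        exact h.inj k hk k' hk' hkc hkc' hkn heq
    le := by
      intro k hk hkw hkn
      by_cases hkc : k = cur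
      · subst hkc; rw [hpc] at hkn ⊢; exact h.le _ hw hne hkn
      · rw [hp k hk hkc] at *; exact h.le k hk hkc hkn
    surj := by
      intro j hj
      obtain ⟨k, hk, hkc, hkj⟩ := h.surj j hj
      by_cases hkw : k = way cur
      · exact ⟨cur, h.cur_le, hne.symm, by rw [hpc, ← hkw, hkj]⟩
      · exact ⟨k, hk, hkw, by rw [hp k hk hkc, hkj]⟩
    cur_le := hw
    path := by
      refine ⟨T, ord, hTw, le_rfl, fun k hk hTk hle => ?_⟩
      obtain ⟨h1, h2, h3, h4⟩ := hpath k hk hTk (hle.trans hlt.le)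
      have hwk : way k ≠ cur := fun e => by rw [e] at h3; omega
      rw [hp _ h1 hwk]
      exact ⟨h1, h2, h3, h4⟩ }

/-- Once the hole is the virtual column, every row up to `q` sits in a real column. -/
lemma AugmentState.finish {m : ℕ} (h : AugmentState n q c ok u v p way cur m)
    (hcur : ¬ cur < n) : DualState n (q + 1) c ok u v p := by
  have hc : cur = n := le_antisymm h.cur_le (not_lt.1 hcur)
  subst hc
  exact
  { feas := h.feas
    tight := fun k hk hlt => h.tight k hk hk.ne hlt
    inj := fun k hk k' hk' hlt heq => h.inj k hk.le k' hk'.le hk.ne hk'.ne hlt heq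
    lt := fun k hk hlt => Nat.lt_succ_of_le (h.le k hk.le hk.ne hlt)
    surj := fun j hj => by
      obtain ⟨k, hk, hne, hkj⟩ := h.surj j (Nat.le_of_lt_succ hj)
      exact ⟨k, lt_of_le_of_ne hk hne, hkj⟩ }

/-- Choosing a column for each of the `n` rows is injective, so it exhausts the `n` columns. -/
lemma DualState.lt_of_complete (h : DualState n n c ok u v p) : ∀ k < n, p k < n := by
  classical
  intro k hk
  choose! g hg hpg using h.surj
  have hinj : Set.InjOn g (Finset.range n : Set ℕ) := fun j hj j' hj' heq => by
    rw [← hpg j (by simpa using hj), heq, hpg j' (by simpa using hj')]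
  have hsub : (Finset.range n).image g ⊆ Finset.range n := by
    intro x hx
    obtain ⟨j, hj, rfl⟩ := Finset.mem_image.1 hx
    exact Finset.mem_range.2 (hg j (Finset.mem_range.1 hj))
  have heq := Finset.eq_of_subset_of_card_le hsub (Finset.card_image_of_injOn hinj).ge
  have hk' : k ∈ (Finset.range n).image g := by rw [heq]; exact Finset.mem_range.2 hk
  obtain ⟨j, hj, rfl⟩ := Finset.mem_image.1 hk'
  rw [hpg j (Finset.mem_range.1 hj)]
  exact Finset.mem_range.1 hj

/-- The matchings `out i'` with `i' < i` are an outcome of the first `i` rounds of the greedy rule,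
with dual certificates, and `used` marks their edges. -/
structure PlaneState (n i : ℕ) (C : ℕ → ℕ → ℕ → ℝ) (out used : ℕ → ℕ → ℕ) : Prop where
  out_lt : ∀ i' < i, ∀ j < n, out i' j < n
  out_inj : ∀ i' < i, ∀ j < n, ∀ j' < n, out i' j = out i' j' → j = j'
  used_iff : ∀ j < n, ∀ k < n, used j k = 0 ↔ ∀ i' < i, out i' j ≠ k
  disjoint : ∀ i' < i, ∀ i'' < i', ∀ j < n, out i' j ≠ out i'' j
  cert : ∀ i' < i, ∃ u v : ℕ → ℝ,
    (∀ j < n, ∀ k < n, (∀ i'' < i', out i'' j ≠ k) → u j + v k ≤ C i' j k) ∧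
      ∀ j < n, u j + v (out i' j) = C i' j (out i' j)

variable {i : ℕ} {C : ℕ → ℕ → ℕ → ℝ} {out used : ℕ → ℕ → ℕ}

lemma PlaneState.start (hused : ∀ j < n, ∀ k < n, used j k = 0) :
    PlaneState n 0 C out used where
  out_lt := fun _ h => absurd h (Nat.not_lt_zero _)
  out_inj := fun _ h => absurd h (Nat.not_lt_zero _)
  used_iff := fun j hj k hk => ⟨fun _ _ h => absurd h (Nat.not_lt_zero _), fun _ => hused j hj k hk⟩
  disjoint := fun _ h => absurd h (Nat.not_lt_zero _)
  cert := fun _ h => absurd h (Nat.not_lt_zero _)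

lemma PlaneState.step (h : PlaneState n i C out used) {u v : ℕ → ℝ} {p : ℕ → ℕ}
    (hd : DualState n n (C i) (fun j k => used j k = 0) u v p) {out' used' : ℕ → ℕ → ℕ}
    (hout : ∀ i' < i, ∀ j < n, out' i' j = out i' j) (hnew : ∀ k < n, out' i (p k) = k)
    (hused : ∀ j < n, ∀ k < n, used' j k = 0 ↔ used j k = 0 ∧ p k ≠ j) :
    PlaneState n (i + 1) C out' used' := by
  have hrow : ∀ j < n, ∃ k < n, p k = j := hd.surj
  have hcol : ∀ j < n, out' i j < n ∧ p (out' i j) = j := by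
    intro j hj
    obtain ⟨k, hk, rfl⟩ := hrow j hj
    rw [hnew k hk]; exact ⟨hk, rfl⟩
  have hlt : ∀ i' < i + 1, i' < i ∨ i' = i := fun i' h => Nat.lt_succ_iff_lt_or_eq.1 h
  exact
  { out_lt := by
      intro i' hi' j hj
      rcases hlt i' hi' with h1 | rfl
      · rw [hout i' h1 j hj]; exact h.out_lt i' h1 j hj
      · exact (hcol j hj).1
    out_inj := by
      intro i' hi' j hj j' hj' heq
      rcases hlt i' hi' with h1 | rfl
      · rw [hout i' h1 j hj, hout i' h1 j' hj'] at heq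
        exact h.out_inj i' h1 j hj j' hj' heq
      · rw [← (hcol j hj).2, heq, (hcol j' hj').2]
    used_iff := by
      intro j hj k hk
      rw [hused j hj k hk, h.used_iff j hj k hk]
      constructor
      · rintro ⟨h1, h2⟩ i' hi'
        rcases hlt i' hi' with h3 | rfl
        · rw [hout i' h3 j hj]; exact h1 i' h3
        · rintro rfl; exact h2 (hcol j hj).2
      · intro h1
        refine ⟨fun i' hi' => ?_, ?_⟩
        · rw [← hout i' hi' j hj]; exact h1 i' (by omega)
        · rintro rfl; exact h1 i (by omega) (hnew k hk)
    disjoint := by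
      intro i' hi' i'' hi'' j hj
      rcases hlt i' hi' with h1 | rfl
      · rw [hout i' h1 j hj, hout i'' (by omega) j hj]
        exact h.disjoint i' h1 i'' hi'' j hj
      · rw [hout i'' hi'' j hj]
        obtain ⟨h1, h2⟩ := hcol j hj
        have h3 := (hd.tight _ h1 (by rw [h2]; exact hj)).1
        rw [h2, h.used_iff j hj _ h1] at h3
        exact (h3 i'' hi'').symm
    cert := by
      intro i' hi'
      rcases hlt i' hi' with h1 | rfl
      · obtain ⟨u, v, h2, h3⟩ := h.cert i' h1
        refine ⟨u, v, fun j hj k hk hno => h2 j hj k hk fun i'' hi'' => ?_, fun j hj => ?_⟩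
        · rw [← hout i'' (by omega) j hj]; exact hno i'' hi''
        · rw [hout i' h1 j hj]; exact h3 j hj
      · refine ⟨u, v, fun j hj k hk hno => hd.feas j hj k hk ?_, fun j hj => ?_⟩
        · rw [h.used_iff j hj k hk]
          intro i'' hi''
          rw [← hout i'' hi'' j hj]; exact hno i'' hi''
        · obtain ⟨h1, h2⟩ := hcol j hj
          have h3 := (hd.tight _ h1 (by rw [h2]; exact hj)).2
          rwa [h2] at h3 }

/-- The matchings of a plane state as permutations. -/
lemma PlaneState.exists_perm (h : PlaneState n i C out used) :
    ∃ M : Fin i → Equiv.Perm (Fin n), ∀ i' j, (M i' j : ℕ) = out i' j := by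
  have hinj : ∀ i' : Fin i, Function.Injective
      fun j : Fin n => (⟨out i' j, h.out_lt i' i'.2 j j.2⟩ : Fin n) := by
    intro i' j j' heq
    exact Fin.ext (h.out_inj i' i'.2 j j.2 j' j'.2 (Fin.mk.inj_iff.1 heq))
  exact ⟨fun i' => Equiv.ofBijective _ (Finite.injective_iff_bijective.1 (hinj i')),
    fun i' j => rfl⟩

/-- Fewer than `n` disjoint matchings leave a regular graph of positive degree. This keeps the
search from getting stuck. -/
lemma PlaneState.exists_allowed (h : PlaneState n i C out used) (hi : i < n) :
    ∃ g : ℕ → ℕ, (∀ j < n, g j < n ∧ used j (g j) = 0) ∧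
      ∀ j < n, ∀ j' < n, g j = g j' → j = j' := by
  obtain ⟨M, hM⟩ := h.exists_perm
  have hdis : PairwiseDisjointMatchings M := by
    intro a b hne j heq
    have heq' : out a j = out b j := by rw [← hM, ← hM, heq]
    rcases lt_or_gt_of_ne hne with h1 | h1
    · exact h.disjoint b b.2 a h1 j j.2 heq'.symm
    · exact h.disjoint a a.2 b h1 j j.2 heq'
  obtain ⟨σ, hσ⟩ := (isRegular_avail hdis).matchings_nonempty (by omega)
  rw [mem_matchings] at hσ
  refine ⟨fun j => if hj : j < n then σ ⟨j, hj⟩ else 0, fun j hj => ?_, fun j hj j' hj' heq => ?_⟩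
  · simp only [hj, dif_pos]
    refine ⟨(σ ⟨j, hj⟩).2, (h.used_iff j hj _ (σ ⟨j, hj⟩).2).2 fun i' hi' heq => ?_⟩
    have h1 := hσ ⟨j, hj⟩
    simp only [avail, Finset.mem_filter, Finset.mem_univ, true_and] at h1
    exact h1 ⟨i', hi'⟩ (Fin.ext (by rw [hM]; exact heq.symm))
  · simp only [hj, hj', dif_pos] at heq
    exact Fin.mk.inj_iff.1 (σ.injective (Fin.ext heq))

/-- Weak duality: the dual objective equals the cost of `M i` by tightness and bounds the cost of
every competing matching from below. -/
lemma PlaneState.exists_isGreedyOutcome (h : PlaneState n n C out used) (X : CostArray 3 n)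
    (hX : ∀ i j k : Fin n, C i j k = X ![i, j, k]) :
    ∃ M : Fin n → Equiv.Perm (Fin n), (∀ i j, (M i j : ℕ) = out i j) ∧ IsGreedyOutcome X M := by
  obtain ⟨M, hM⟩ := h.exists_perm
  refine ⟨M, hM, fun i => ⟨fun i' hi' j heq => ?_, fun σ hσ => ?_⟩⟩
  · exact h.disjoint i i.2 i' hi' j j.2 (by rw [← hM, ← hM, heq])
  · obtain ⟨u, v, h1, h2⟩ := h.cert i i.2
    have h3 : matchingCost X i (M i) = ∑ j : Fin n, u j + ∑ k : Fin n, v k := by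
      rw [← Equiv.sum_comp (M i) fun k : Fin n => v k, ← Finset.sum_add_distrib]
      refine Finset.sum_congr rfl fun j _ => ?_
      rw [← hX, hM, h2 j j.2]
    have h4 : ∑ j : Fin n, u j + ∑ k : Fin n, v k ≤ matchingCost X i σ := by
      rw [← Equiv.sum_comp σ fun k : Fin n => v k, ← Finset.sum_add_distrib]
      refine Finset.sum_le_sum fun j _ => ?_
      rw [← hX]
      refine h1 j j.2 _ (σ j).2 fun i'' hi'' heq => ?_
      exact hσ ⟨i'', hi''.trans i.2⟩ hi'' j (Fin.ext (by rw [hM]; exact heq.symm))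
    exact h3.le.trans h4

end Hungarian
end AxialAssignment

namespace AxialAssignment

/-! ### The building blocks of the program and their specifications. -/

section GreedyProgram
open Program NatExpr

/-! The arrays of natural numbers of the greedy program are: `0` the size `n`, `1` the output,
`2` the current plane, `3` the current row, `4` the marks of the used edges, `5` the row matched
to a column, `6` and `7` the marks of the columns and rows reached, `8` the predecessor of a column,
`9` the current column, `10`, `11` and `12` the two columns of the best edge leaving the search tree
and a mark that there is one, `13` and `14` loop variables. The arrays of real numbers are: `0` the
costs, `1` and `2` the dual solution, `3` the slack of the best edge. -/

/-- The costs in the current plane. -/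
def cOf (s : Memory) : ℕ → ℕ → ℝ := fun j k => s.real 0 (s.nat 2 0 0 0) j k
/-- The edges that are not used. -/
def okOf (s : Memory) : ℕ → ℕ → Prop := fun j k => s.nat 4 j k 0 = 0
/-- The dual variables of the rows. -/
def uOf (s : Memory) : ℕ → ℝ := fun j => s.real 1 j 0 0
/-- The dual variables of the columns. -/
def vOf (s : Memory) : ℕ → ℝ := fun k => s.real 2 k 0 0
/-- The row that is matched to a column. -/
def pOf (s : Memory) : ℕ → ℕ := fun k => s.nat 5 k 0 0
/-- The columns reached. -/
def TOf (s : Memory) : ℕ → Prop := fun k => 1 ≤ s.nat 6 k 0 0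
/-- The rows reached. -/
def SOf (s : Memory) : ℕ → Prop := fun j => 1 ≤ s.nat 7 j 0 0
/-- The predecessor of a column. -/
def wayOf (s : Memory) : ℕ → ℕ := fun k => s.nat 8 k 0 0

/-- The initial dual solution of a plane, and the empty matching. -/
def initPlane : Program :=
  forLoop 13 (var 0) (.seq (setRealCell 2 (var 13) .zero) (.seq (setCell 5 (var 13) (var 0))
    (.seq (setRealCell 1 (var 13) .zero) (forLoop 14 (var 0)
      (.branch (.realLe (.get 0 (var 2) (var 13) (var 14)) (.cell 1 (var 13)))
        (setRealCell 1 (var 13) (.get 0 (var 2) (var 13) (var 14))) .skip)))))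

/-- The row duals are running minima started at 0. Only upper bounds are needed, so cutting off at 0
does no harm. The value `n` in array 5 marks an unmatched column. -/
lemma runs_initPlane {n : ℕ} {s : Memory} (hn : s.nat 0 0 0 0 = n) :
    Runs initPlane s (n * ((1 + (1 + (1 + (n * (2 + 2) + 2)))) + 2) + 2) fun s' =>
      ∀ x < n, vOf s' x = 0 ∧ pOf s' x = n ∧ ∀ y < n, uOf s' x ≤ cOf s x y := by
  refine Runs.forLoop (Inv := fun x s' => ∀ x' < x, vOf s' x' = 0 ∧ pOf s' x' = n ∧
    ∀ y < n, uOf s' x' ≤ cOf s x' y) rfl (fun s' hf => ?_) (fun x s' v h => h) ?_ (by simp)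
  · simp only [NatExpr.eval, hf.1 0 rfl, hn]
  intro x hx s₁ hf hcx hI
  have hf0 := hf.1 0 rfl
  have hf2 := hf.1 2 rfl
  have hr0 := hf.2 0 rfl
  refine Runs.seq (Runs.setReal (Runs.seq (Runs.setNat (Runs.seq (Runs.setReal ?_)))))
  simp only [NatExpr.eval, RealExpr.eval, hcx]
  refine (Runs.forLoop (c := 14) (N := n) (T := 2) (Inv := fun y s' =>
    vOf s' x = 0 ∧ pOf s' x = n ∧ (∀ y' < y, uOf s' x ≤ cOf s x y') ∧
      ∀ x' < x, vOf s' x' = 0 ∧ pOf s' x' = n ∧ ∀ y < n, uOf s' x' ≤ cOf s x' y)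
      rfl (fun s' hf => ?_) (fun x s' v h => h) ?_ ?_).mono le_rfl ?_
  · rw [NatExpr.eval, hf.1 0 rfl]; simp [NatExpr.eval, write, hf0, hn]
  · intro y hy s₂ hf' hcy hI'
    have h13 : s₂.nat 13 0 0 0 = x := by rw [hf'.1 13 rfl]; simp [write, hcx]
    have hc : ∀ j k, s₂.real 0 (s₂.nat 2 0 0 0) j k = cOf s j k := by
      intro j k
      rw [hf'.1 2 rfl, hf'.2 0 rfl, cOf]; simp [write, hf2, hr0]
    obtain ⟨h1, h2, h3, h4⟩ := hI'
    refine Runs.branch (T := 1) (fun hb => Runs.setReal ?_) (fun hb => Runs.skip ?_)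
    · simp only [Test.Holds, RealExpr.eval, NatExpr.eval, h13, hcy, hc] at hb ⊢
      refine ⟨by simpa [vOf, write] using h1, by simpa [pOf] using h2, fun y' hy' => ?_,
        fun x' hx' => ?_⟩
      · simp only [uOf, write, and_self, if_true]
        rcases Nat.lt_succ_iff_lt_or_eq.1 hy' with h5 | rfl
        · exact hb.trans (h3 y' h5)
        · exact le_rfl
      · obtain ⟨h5, h6, h7⟩ := h4 x' hx'
        refine ⟨by simpa [vOf, write] using h5, h6, fun y hy => ?_⟩
        simpa [uOf, write, hx'.ne] using h7 y hy
    · simp only [Test.Holds, RealExpr.eval, NatExpr.eval, h13, hcy, hc] at hb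
      refine ⟨h1, h2, fun y' hy' => ?_, h4⟩
      rcases Nat.lt_succ_iff_lt_or_eq.1 hy' with h5 | rfl
      · exact h3 y' h5
      · exact (not_le.1 hb).le
  · refine ⟨by simp [vOf, write], by simp [pOf, write, hf0, hn], by simp, fun x' hx' => ?_⟩
    obtain ⟨h5, h6, h7⟩ := hI x' hx'
    refine ⟨by simpa [vOf, write, hx'.ne] using h5, by simpa [pOf, write, hx'.ne] using h6,
      fun y hy => ?_⟩
    simpa [uOf, write, hcx, hx'.ne] using h7 y hy
  · rintro s' ⟨h1, h2, h3, h4⟩ x' hx'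
    rcases Nat.lt_succ_iff_lt_or_eq.1 hx' with h5 | rfl
    · exact h4 x' h5
    · exact ⟨h1, h2, h3⟩

/-- The slack of the edge from the row of the column `13` to the column `14`. -/
abbrev slackExpr : RealExpr :=
  .sub (.sub (.get 0 (var 2) (cell 5 (var 13)) (var 14)) (.cell 1 (cell 5 (var 13))))
    (.cell 2 (var 14))

/-- Find the edge with the least slack that leaves the search tree. -/
def findMin : Program :=
  .seq (setVar 12 (.lit 0)) (forLoop 13 (.add (var 0) (.lit 1)) (forLoop 14 (var 0)
    (.branch (.and (.natLe (.lit 1) (cell 6 (var 13))) (.and (.natLe (cell 6 (var 14)) (.lit 0))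
        (.natLe (.get 4 (cell 5 (var 13)) (var 14) (.lit 0)) (.lit 0))))
      (.branch (.not (.and (.natLe (.lit 1) (var 12))
          (.not (.realLe slackExpr (.cell 3 (.lit 0))))))
        (.seq (setVar 12 (.lit 1)) (.seq (setVar 10 (var 13)) (.seq (setVar 11 (var 14))
          (setRealCell 3 (.lit 0) slackExpr)))) .skip) .skip)))

/-- The edge from the row of the column `a` to the column `b` leaves the search tree. -/
def IsCandidate (s : Memory) (a b : ℕ) : Prop := TOf s a ∧ ¬ TOf s b ∧ okOf s (pOf s a) b

/-- The slack of the edge from the row of the column `a` to the column `b`. -/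
def slack (s : Memory) (a b : ℕ) : ℝ := cOf s (pOf s a) b - uOf s (pOf s a) - vOf s b

/-- The memory `s'` holds the best candidate of `s` among the pairs with the property `X`. -/
def HoldsBest (s s' : Memory) (X : ℕ → ℕ → Prop) : Prop :=
  (s'.nat 12 0 0 0 = 0 ∧ ∀ a b, X a b → ¬ IsCandidate s a b) ∨
  (s'.nat 12 0 0 0 = 1 ∧ X (s'.nat 10 0 0 0) (s'.nat 11 0 0 0) ∧
    IsCandidate s (s'.nat 10 0 0 0) (s'.nat 11 0 0 0) ∧
    s'.real 3 0 0 0 = slack s (s'.nat 10 0 0 0) (s'.nat 11 0 0 0) ∧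
    ∀ a b, X a b → IsCandidate s a b → s'.real 3 0 0 0 ≤ slack s a b)

lemma HoldsBest.congr {s s' : Memory} {X Y : ℕ → ℕ → Prop} (h : HoldsBest s s' X)
    (hXY : ∀ a b, X a b ↔ Y a b) : HoldsBest s s' Y := by
  have : X = Y := by ext a b; exact hXY a b
  rwa [← this]

/-- The pairs are scanned in lexicographic order. No infinite initial slack is available, so a flag
tells whether a candidate has been seen; `hex` excludes that the scan ends without one. -/
lemma runs_findMin {n : ℕ} {s : Memory} (hn : s.nat 0 0 0 0 = n)
    (hex : ∃ a ≤ n, ∃ b < n, IsCandidate s a b) :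
    Runs findMin s (1 + ((n + 1) * ((n * (6 + 2) + 2) + 2) + 2)) fun s' =>
      s'.nat 10 0 0 0 ≤ n ∧ s'.nat 11 0 0 0 < n ∧
      IsCandidate s (s'.nat 10 0 0 0) (s'.nat 11 0 0 0) ∧
      s'.real 3 0 0 0 = slack s (s'.nat 10 0 0 0) (s'.nat 11 0 0 0) ∧
      ∀ a ≤ n, ∀ b < n, IsCandidate s a b → s'.real 3 0 0 0 ≤ slack s a b := by
  refine Runs.seq (Runs.setNat ((Runs.forLoop (c := 13) (N := n + 1)
    (Inv := fun x s' => HoldsBest s s' fun a b => a < x ∧ b < n) rfl (fun s' hf => ?_)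
    (fun x s' v h => h) ?_ ?_).mono le_rfl ?_))
  · simp only [NatExpr.eval, hf.1 0 rfl]; simp [write, hn]
  · intro x hx s₁ hf hcx hI
    refine (Runs.forLoop (c := 14) (N := n)
      (Inv := fun y s' => HoldsBest s s' fun a b => (a < x ∧ b < n) ∨ (a = x ∧ b < y)) rfl
      (fun s' hf' => ?_) (fun x s' v h => h) ?_ ?_).mono le_rfl ?_
    · rw [NatExpr.eval, hf'.1 0 rfl, hf.1 0 rfl]; simp [NatExpr.eval, write, hn]
    · intro y hy s₂ hf' hcy hI'
      have h13 : s₂.nat 13 0 0 0 = x := by rw [hf'.1 13 rfl, hcx]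
      have e2 : s₂.nat 2 = s.nat 2 := by
        rw [hf'.1 2 rfl, hf.1 2 rfl]; funext i j k; simp [write]
      have e4 : s₂.nat 4 = s.nat 4 := by
        rw [hf'.1 4 rfl, hf.1 4 rfl]; funext i j k; simp [write]
      have e5 : s₂.nat 5 = s.nat 5 := by
        rw [hf'.1 5 rfl, hf.1 5 rfl]; funext i j k; simp [write]
      have e6 : s₂.nat 6 = s.nat 6 := by
        rw [hf'.1 6 rfl, hf.1 6 rfl]; funext i j k; simp [write]
      have r0 : s₂.real 0 = s.real 0 := by rw [hf'.2 0 rfl, hf.2 0 rfl]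
      have r1 : s₂.real 1 = s.real 1 := by rw [hf'.2 1 rfl, hf.2 1 rfl]
      have r2 : s₂.real 2 = s.real 2 := by rw [hf'.2 2 rfl, hf.2 2 rfl]
      refine Runs.branch (T := 5) (fun hb => Runs.branch (T := 4) (fun hb' => ?_)
        fun hb' => (Runs.skip ?_).mono (by norm_num) fun _ h => h)
        fun hb => (Runs.skip ?_).mono (by norm_num) fun _ h => h
      · refine (Runs.seq (Runs.setNat (Runs.seq (Runs.setNat (Runs.seq (Runs.setNat
          (Runs.setReal ?_))))))).mono (le_refl (1 + (1 + (1 + 1)))) fun _ h => h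
        simp only [Test.Holds, RealExpr.eval, NatExpr.eval, h13, hcy, e2, e4, e5, e6, r0, r1, r2]
          at hb hb'
        have hcand : IsCandidate s x y := ⟨hb.1, by simpa [TOf] using hb.2.1, by
          simpa [okOf, pOf] using hb.2.2⟩
        right
        simp only [NatExpr.eval, RealExpr.eval]
        simp [write, h13, hcy, e2, e5, r0, r1, r2]
        refine ⟨hcand, rfl, fun a b hab hcab => ?_⟩
        rcases hab with h1 | ⟨rfl, h1⟩
        · rcases hI' with ⟨h2, h3⟩ | ⟨h2, -, -, -, h3⟩
          · exact absurd hcab (h3 a b (Or.inl h1))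
          · have h4 := h3 a b (Or.inl h1) hcab
            rw [not_and, not_not] at hb'
            linarith [(hb' h2.ge).trans h4]
        · rcases h1.lt_or_eq with h5 | rfl
          · rcases hI' with ⟨h2, h3⟩ | ⟨h2, -, -, -, h3⟩
            · exact absurd hcab (h3 a b (Or.inr ⟨rfl, h5⟩))
            · have h4 := h3 a b (Or.inr ⟨rfl, h5⟩) hcab
              rw [not_and, not_not] at hb'
              linarith [(hb' h2.ge).trans h4]
          · unfold slack cOf uOf vOf pOf; linarith
      · simp only [Test.Holds, RealExpr.eval, NatExpr.eval, h13, hcy, e2, e4, e5, e6, r0, r1, r2]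
          at hb hb'
        rw [not_not] at hb'
        rcases hI' with ⟨h2, h3⟩ | ⟨h2, h3, h4, h5, h6⟩
        · omega
        · refine Or.inr ⟨h2, ?_, h4, h5, fun a b hab hcab => ?_⟩
          · rcases h3 with h3 | h3
            · exact Or.inl h3
            · exact Or.inr ⟨h3.1, by omega⟩
          · rcases hab with h1 | ⟨rfl, h1⟩
            · exact h6 a b (Or.inl h1) hcab
            · rcases Nat.lt_succ_iff_lt_or_eq.1 h1 with h7 | rfl
              · exact h6 a b (Or.inr ⟨rfl, h7⟩) hcab
              · exact (not_le.1 hb'.2).le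
      · simp only [Test.Holds, NatExpr.eval, h13, hcy, e4, e5, e6] at hb
        have hno : ¬ IsCandidate s x y := fun hc => hb ⟨hc.1, by
          have := hc.2.1; simp only [TOf] at this; omega, le_of_eq hc.2.2⟩
        rcases hI' with ⟨h2, h3⟩ | ⟨h2, h3, h4, h5, h6⟩
        · refine Or.inl ⟨h2, fun a b hab => ?_⟩
          rcases hab with h1 | ⟨rfl, h1⟩
          · exact h3 a b (Or.inl h1)
          · rcases Nat.lt_succ_iff_lt_or_eq.1 h1 with h7 | rfl
            · exact h3 a b (Or.inr ⟨rfl, h7⟩)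
            · exact hno
        · refine Or.inr ⟨h2, ?_, h4, h5, fun a b hab hcab => ?_⟩
          · rcases h3 with h3 | h3
            · exact Or.inl h3
            · exact Or.inr ⟨h3.1, by omega⟩
          · rcases hab with h1 | ⟨rfl, h1⟩
            · exact h6 a b (Or.inl h1) hcab
            · rcases Nat.lt_succ_iff_lt_or_eq.1 h1 with h7 | rfl
              · exact h6 a b (Or.inr ⟨rfl, h7⟩) hcab
              · exact absurd hcab hno
    · exact hI.congr fun a b => by simp
    · intro s' h
      refine h.congr fun a b => ?_
      constructor
      · rintro (⟨h1, h2⟩ | ⟨rfl, h2⟩)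
        · exact ⟨by omega, h2⟩
        · exact ⟨by omega, h2⟩
      · rintro ⟨h1, h2⟩
        rcases Nat.lt_succ_iff_lt_or_eq.1 h1 with h3 | h3
        · exact Or.inl ⟨h3, h2⟩
        · exact Or.inr ⟨h3, h2⟩
  · exact Or.inl ⟨by simp [write, NatExpr.eval], fun a b h => absurd h.1 (Nat.not_lt_zero _)⟩
  · intro s' h
    obtain ⟨a₀, ha₀, b₀, hb₀, hc₀⟩ := hex
    rcases h with ⟨-, h2⟩ | ⟨-, h1, h2, h3, h4⟩
    · exact absurd hc₀ (h2 a₀ b₀ ⟨by omega, hb₀⟩)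
    · exact ⟨by omega, h1.2, h2, h3, fun a ha b hb hc => h4 a b ⟨by omega, hb⟩ hc⟩

/-- Change the dual solution along the search tree. -/
def updateDuals : Program :=
  forLoop 13 (var 0) (.seq
    (.branch (.natLe (.lit 1) (cell 7 (var 13)))
      (setRealCell 1 (var 13) (.add (.cell 1 (var 13)) (.cell 3 (.lit 0)))) .skip)
    (.branch (.natLe (.lit 1) (cell 6 (var 13)))
      (setRealCell 2 (var 13) (.sub (.cell 2 (var 13)) (.cell 3 (.lit 0)))) .skip))

/-- The update is in place, so the invariant also records that the entries not yet visited hold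
their old values. -/
lemma runs_updateDuals {n : ℕ} {s : Memory} (hn : s.nat 0 0 0 0 = n) :
    Runs updateDuals s (n * ((2 + 2) + 2) + 2) fun s' =>
      ∀ x < n, ((SOf s x → uOf s' x = uOf s x + s.real 3 0 0 0) ∧ (¬ SOf s x → uOf s' x = uOf s x)) ∧
        (TOf s x → vOf s' x = vOf s x - s.real 3 0 0 0) ∧ (¬ TOf s x → vOf s' x = vOf s x) := by
  refine (Runs.forLoop (c := 13) (N := n) (T := 2 + 2) (Inv := fun x s' =>
      (∀ x' < x, ((SOf s x' → uOf s' x' = uOf s x' + s.real 3 0 0 0) ∧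
        (¬ SOf s x' → uOf s' x' = uOf s x')) ∧
        (TOf s x' → vOf s' x' = vOf s x' - s.real 3 0 0 0) ∧ (¬ TOf s x' → vOf s' x' = vOf s x')) ∧
      ∀ x' ≥ x, uOf s' x' = uOf s x' ∧ vOf s' x' = vOf s x') rfl (fun s' hf => ?_)
      (fun x s' v h => h) ?_ (by simp)).mono le_rfl fun s' h => h.1
  · simp only [NatExpr.eval, hf.1 0 rfl, hn]
  intro x hx s₁ hf hcx hI
  have e6 := hf.1 6 rfl
  have e7 := hf.1 7 rfl
  have r3 := hf.2 3 rfl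
  obtain ⟨h1, h2⟩ := hI
  have hux := (h2 x le_rfl).1
  have hvx := (h2 x le_rfl).2
  refine Runs.seq ((Runs.frame (Runs.branch (T := 1) (Q := fun s' =>
    ((SOf s x → uOf s' x = uOf s x + s.real 3 0 0 0) ∧ (¬ SOf s x → uOf s' x = uOf s x)) ∧
    ∀ x' ≠ x, uOf s' x' = uOf s₁ x') (fun hb => Runs.setReal ?_) (fun hb => Runs.skip ?_))).mono
      le_rfl ?_)
  · simp only [Test.Holds, NatExpr.eval, hcx, e7] at hb
    refine ⟨⟨fun _ => ?_, fun h => absurd hb h⟩, fun x' hx' => ?_⟩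
    · simp only [uOf] at hux ⊢
      simp [write, NatExpr.eval, RealExpr.eval, hcx, r3, hux]
    · simp [uOf, write, NatExpr.eval, hcx, hx']
  · simp only [Test.Holds, NatExpr.eval, hcx, e7] at hb
    exact ⟨⟨fun h => absurd h hb, fun _ => hux⟩, fun _ _ => rfl⟩
  · rintro s₂ ⟨⟨h3, h4⟩, hf'⟩
    have e6' := (hf'.1 6 rfl).trans e6
    have hcx' : s₂.nat 13 0 0 0 = x := by rw [hf'.1 13 rfl, hcx]
    have r3' := (hf'.2 3 rfl).trans r3
    have r2' := hf'.2 2 rfl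
    have hv₂ : ∀ y, vOf s₂ y = vOf s₁ y := fun y => by simp only [vOf, r2']
    refine Runs.branch (T := 1) (fun hb => Runs.setReal ?_) (fun hb => Runs.skip ?_)
    · simp only [Test.Holds, NatExpr.eval, hcx', e6'] at hb
      refine ⟨fun x' hx' => ?_, fun x' hx' => ?_⟩
      · rcases Nat.lt_succ_iff_lt_or_eq.1 hx' with h5 | rfl
        · have h6 := h1 x' h5
          rw [← h4 x' h5.ne, ← hv₂ x'] at h6
          simp only [uOf, vOf] at h6 ⊢
          simpa [write, NatExpr.eval, hcx', h5.ne] using h6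
        · refine ⟨by simpa [uOf, write] using h3, fun _ => ?_, fun h => absurd hb h⟩
          rw [← hvx, ← hv₂]
          simp [vOf, write, NatExpr.eval, RealExpr.eval, hcx', r3']
      · have hne : x' ≠ x := by omega
        have h6 := h2 x' (by omega)
        rw [← h4 x' hne, ← hv₂ x'] at h6
        simp only [uOf, vOf] at h6 ⊢
        simpa [write, NatExpr.eval, hcx', hne] using h6
    · simp only [Test.Holds, NatExpr.eval, hcx', e6'] at hb
      refine ⟨fun x' hx' => ?_, fun x' hx' => ?_⟩
      · rcases Nat.lt_succ_iff_lt_or_eq.1 hx' with h5 | rfl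
        · have h6 := h1 x' h5
          rwa [← h4 x' h5.ne, ← hv₂ x'] at h6
        · exact ⟨h3, fun h => absurd h hb, fun _ => by rw [hv₂, hvx]⟩
      · have h6 := h2 x' (by omega)
        rwa [← h4 x' (by omega), ← hv₂ x'] at h6

end GreedyProgram
end AxialAssignment

namespace AxialAssignment

/-! ### Search, augmentation and the complete program. -/

section GreedyProgram
open Program NatExpr

/-- Start the search tree at the current row. -/
def initSearch : Program :=
  .seq (forLoop 13 (var 0) (.seq (setCell 6 (var 13) (.lit 0)) (setCell 7 (var 13) (.lit 0))))
    (.seq (setCell 6 (var 0) (.lit 1)) (.seq (setCell 7 (var 3) (.lit 1))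
      (.seq (setCell 5 (var 0) (var 3)) (setVar 9 (var 0)))))

/-- The memory holds a state of the search. -/
def SearchMemory (n q : ℕ) (s : Memory) (τ : ℕ) : Prop :=
  SearchState n q (cOf s) (okOf s) (uOf s) (vOf s) (pOf s) (TOf s) (SOf s) (wayOf s)
    (s.nat 9 0 0 0) τ

/-- The memory holds a dual solution and a matching of the first `q` rows. -/
def DualMemory (n q : ℕ) (s : Memory) : Prop :=
  DualState n q (cOf s) (okOf s) (uOf s) (vOf s) (pOf s)

lemma runs_initSearch {n q : ℕ} {s : Memory} (hn : s.nat 0 0 0 0 = n) (hq : s.nat 3 0 0 0 = q)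
    (hqn : q < n) (h : DualMemory n q s) :
    Runs initSearch s ((n * ((1 + 1) + 2) + 2) + (1 + (1 + (1 + 1)))) fun s' =>
      SearchMemory n q s' 0 := by
  refine Runs.seq ((Runs.frame (Runs.forLoop (c := 13) (N := n) (T := 1 + 1) (Inv := fun x s' =>
    ∀ x' < x, s'.nat 6 x' 0 0 = 0 ∧ s'.nat 7 x' 0 0 = 0) rfl (fun s' hf => ?_)
      (fun x s' v h => h) ?_ (by simp))).mono le_rfl ?_)
  · simp only [NatExpr.eval, hf.1 0 rfl, hn]
  · intro x hx s₁ hf hcx hI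
    refine Runs.seq (Runs.setNat (Runs.setNat fun x' hx' => ?_))
    rcases Nat.lt_succ_iff_lt_or_eq.1 hx' with h1 | rfl
    · simpa [write, NatExpr.eval, hcx, h1.ne] using hI x' h1
    · simp [write, NatExpr.eval, hcx]
  rintro s₁ ⟨hI, hf⟩
  have e0 : s₁.nat 0 0 0 0 = n := by rw [hf.1 0 rfl, hn]
  have e3 : s₁.nat 3 0 0 0 = q := by rw [hf.1 3 rfl, hq]
  refine Runs.seq (Runs.setNat (Runs.seq (Runs.setNat (Runs.seq (Runs.setNat (Runs.setNat ?_))))))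
  have hc : cOf s₁ = cOf s := by funext j k; simp only [cOf, hf.1 2 rfl, hf.2 0 rfl]
  have hok : okOf s₁ = okOf s := by funext j k; simp only [okOf, hf.1 4 rfl]
  have hu : uOf s₁ = uOf s := by funext j; simp only [uOf, hf.2 1 rfl]
  have hv : vOf s₁ = vOf s := by funext j; simp only [vOf, hf.2 2 rfl]
  have hp : pOf s₁ = pOf s := by funext j; simp only [pOf, hf.1 5 rfl]
  have h' : DualState n q (cOf s₁) (okOf s₁) (uOf s₁) (vOf s₁) (pOf s₁) := by
    rw [hc, hok, hu, hv, hp]; exact h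
  have hcur : ∀ s' : Memory, s'.nat 9 0 0 0 = n → (cOf s', okOf s', uOf s', vOf s') =
      (cOf s₁, okOf s₁, uOf s₁, vOf s₁) → (∀ k < n, pOf s' k = pOf s₁ k) → pOf s' n = q →
      (∀ k < n, ¬ TOf s' k) → TOf s' n → (∀ j < n, SOf s' j ↔ j = q) → SearchMemory n q s' 0 := by
    intro s' h9 heq hp' hpn hT hTn hS
    simp only [Prod.mk.injEq] at heq
    obtain ⟨h1, h2, h3, h4⟩ := heq
    rw [SearchMemory, h1, h2, h3, h4, h9]
    exact SearchState.start h' hqn hp' hpn hT hTn hS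
  refine hcur _ ?_ ?_ ?_ ?_ ?_ ?_ ?_
  · simp [write, NatExpr.eval, e0]
  · simp only [Prod.mk.injEq]
    refine ⟨?_, ?_, rfl, rfl⟩
    · funext j k; simp [cOf, write]
    · funext j k; simp [okOf, write]
  · intro k hk; simp [pOf, write, NatExpr.eval, e0, hk.ne]
  · simp [pOf, write, NatExpr.eval, e0, e3]
  · intro k hk; simp [TOf, write, NatExpr.eval, e0, hk.ne, (hI k hk).1]
  · simp [TOf, write, NatExpr.eval, e0]
  · intro j hj
    by_cases hjq : j = q
    · simp [SOf, write, NatExpr.eval, e3, hjq]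
    · simp [SOf, write, NatExpr.eval, e3, hjq, (hI j hj).2]

/-- Add the end of the best edge to the search tree. -/
def addColumn : Program :=
  .seq (setCell 8 (var 11) (var 10)) (.seq (setCell 6 (var 11) (.lit 1))
    (.seq (setVar 9 (var 11)) (.branch (.natLt (cell 5 (var 11)) (var 0))
      (setCell 7 (cell 5 (var 11)) (.lit 1)) .skip)))

lemma runs_addColumn {n a b : ℕ} {s : Memory} (hn : s.nat 0 0 0 0 = n)
    (ha : s.nat 10 0 0 0 = a) (hb : s.nat 11 0 0 0 = b) :
    Runs addColumn s (1 + (1 + (1 + 2))) fun s' => s'.nat 9 0 0 0 = b ∧ wayOf s' b = a ∧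
      (∀ k, k ≠ b → wayOf s' k = wayOf s k) ∧ (∀ k, TOf s' k ↔ TOf s k ∨ k = b) ∧
      ∀ j < n, SOf s' j ↔ SOf s j ∨ j = pOf s b := by
  refine Runs.seq (Runs.setNat (Runs.seq (Runs.setNat (Runs.seq (Runs.setNat
    (Runs.branch (T := 1) (fun hlt => Runs.setNat ?_) (fun hlt => Runs.skip ?_)))))))
  · refine ⟨by simp [write, NatExpr.eval, hb], by simp [wayOf, write, NatExpr.eval, ha, hb],
      fun k hk => by simp [wayOf, write, NatExpr.eval, hb, hk], fun k => ?_, fun j hj => ?_⟩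
    · by_cases hk : k = b <;> simp [TOf, write, NatExpr.eval, hb, hk]
    · by_cases hj : j = s.nat 5 b 0 0 <;> simp [SOf, pOf, write, NatExpr.eval, hb, hj]
  · simp [Test.Holds, write, NatExpr.eval, hb, hn] at hlt
    refine ⟨by simp [write, NatExpr.eval, hb], by simp [wayOf, write, NatExpr.eval, ha, hb],
      fun k hk => by simp [wayOf, write, NatExpr.eval, hb, hk], fun k => ?_, fun j hj => ?_⟩
    · by_cases hk : k = b <;> simp [TOf, write, NatExpr.eval, hb, hk]
    · have hne : j ≠ pOf s b := by simp only [pOf]; omega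
      simp [hne, SOf, write]

/-- Search for an augmenting path. -/
def searchLoop : Program :=
  .loop (.natLt (cell 5 (var 9)) (var 0)) (.seq findMin (.seq updateDuals addColumn))

/-- The number of steps of one round of the search. -/
def searchTime (n : ℕ) : ℕ :=
  (1 + ((n + 1) * ((n * (6 + 2) + 2) + 2) + 2)) + ((n * ((2 + 2) + 2) + 2) + (1 + (1 + (1 + 2))))

/-- The variant is n + 1 - τ, where τ counts the real columns reached. -/
lemma runs_searchLoop {n q : ℕ} {s : Memory} (hn : s.nat 0 0 0 0 = n)
    (h : SearchMemory n q s 0) {g : ℕ → ℕ} (hg : ∀ j < n, g j < n ∧ okOf s j (g j))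
    (hgi : ∀ j < n, ∀ j' < n, g j = g j' → j = j') :
    Runs searchLoop s ((n + 1) * (searchTime n + 1) + 1) fun s' =>
      ∃ τ ≤ n, SearchMemory n q s' τ ∧ ¬ pOf s' (s'.nat 9 0 0 0) < n := by
  refine (Runs.frame (Runs.loop (T := searchTime n) (Inv := fun m s' =>
    ∃ τ, τ + m = n + 1 ∧ SearchMemory n q s' τ) ?_ (m := n + 1) ⟨0, by simp, h⟩)).mono le_rfl ?_
  · rintro m s₁ hf hb ⟨τ, hτ, hS⟩
    have e0 : s₁.nat 0 0 0 0 = n := by rw [hf.1 0 rfl, hn]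
    have hcur : pOf s₁ (s₁.nat 9 0 0 0) < n := by
      have h1 : s₁.nat 5 (s₁.nat 9 0 0 0) 0 0 + 1 ≤ s₁.nat 0 0 0 0 := hb
      rw [e0] at h1; exact h1
    have hok : okOf s₁ = okOf s := by funext j k; simp only [okOf, hf.1 4 rfl]
    have hτn := hS.card_le
    refine Runs.seq ((runs_findMin e0 (hS.exists_candidate hcur (hok ▸ hg) hgi)).frame.mono le_rfl ?_)
    rintro s₂ ⟨⟨ha, hb, ⟨hTa, hTb, hoka⟩, hδ, hmin⟩, hf₂⟩
    refine Runs.seq ((runs_updateDuals ((congrFun (congrFun (congrFun (hf₂.1 0 rfl) 0) 0) 0).trans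
      e0)).frame.mono le_rfl ?_)
    rintro s₃ ⟨hdual, hf₃⟩
    have e0' : s₃.nat 0 0 0 0 = n := by rw [hf₃.1 0 rfl, hf₂.1 0 rfl, e0]
    refine (runs_addColumn e0' rfl rfl).frame.mono le_rfl ?_
    rintro s₄ ⟨⟨h9, hwb, hw, hT', hS'⟩, hf₄⟩
    refine ⟨m - 1, by omega, τ + 1, by omega, ?_⟩
    have hT₂ : TOf s₂ = TOf s₁ := by funext k; simp only [TOf, hf₂.1 6 rfl]
    have hS₂ : SOf s₂ = SOf s₁ := by funext k; simp only [SOf, hf₂.1 7 rfl]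
    have hT₃ : TOf s₃ = TOf s₁ := by funext k; simp only [TOf, hf₃.1 6 rfl, hf₂.1 6 rfl]
    have hS₃ : SOf s₃ = SOf s₁ := by funext k; simp only [SOf, hf₃.1 7 rfl, hf₂.1 7 rfl]
    have hw₃ : wayOf s₃ = wayOf s₁ := by funext k; simp only [wayOf, hf₃.1 8 rfl, hf₂.1 8 rfl]
    have hp₃ : pOf s₃ = pOf s₁ := by funext k; simp only [pOf, hf₃.1 5 rfl, hf₂.1 5 rfl]
    have hu₂ : uOf s₂ = uOf s₁ := by funext k; simp only [uOf, hf₂.2 1 rfl]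
    have hv₂ : vOf s₂ = vOf s₁ := by funext k; simp only [vOf, hf₂.2 2 rfl]
    have hu₄ : uOf s₄ = uOf s₃ := by funext k; simp only [uOf, hf₄.2 1 rfl]
    have hv₄ : vOf s₄ = vOf s₃ := by funext k; simp only [vOf, hf₄.2 2 rfl]
    have hc₄ : cOf s₄ = cOf s₁ := by
      funext j k
      simp only [cOf, hf₄.1 2 rfl, hf₄.2 0 rfl, hf₃.1 2 rfl, hf₃.2 0 rfl, hf₂.1 2 rfl, hf₂.2 0 rfl]
    have hok₄ : okOf s₄ = okOf s₁ := by
      funext j k; simp only [okOf, hf₄.1 4 rfl, hf₃.1 4 rfl, hf₂.1 4 rfl]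
    have hp₄ : pOf s₄ = pOf s₁ := by
      funext k; simp only [pOf, hf₄.1 5 rfl, hf₃.1 5 rfl, hf₂.1 5 rfl]
    have e10 : s₃.nat 10 0 0 0 = s₂.nat 10 0 0 0 := by rw [hf₃.1 10 rfl]
    have e11 : s₃.nat 11 0 0 0 = s₂.nat 11 0 0 0 := by rw [hf₃.1 11 rfl]
    rw [e11] at h9 hwb hw hT' hS'
    rw [e10] at hwb
    rw [hw₃] at hw
    rw [hT₃] at hT'
    rw [hS₃, hp₃] at hS'
    rw [hT₂, hS₂, hu₂, hv₂] at hdual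
    rw [SearchMemory, hc₄, hok₄, hp₄, hu₄, hv₄, h9]
    exact SearchState.step hS hcur ha hb hTa hTb hoka hδ
      (fun a' ha' b' hb' h1 h2 h3 => hmin a' ha' b' hb' ⟨h1, h2, h3⟩)
      (fun j hj => (hdual j hj).1) (fun k hk => (hdual k hk).2) (fun k _ => hT' k) hS' hwb
      (fun k _ => hw k)
  · rintro s' ⟨⟨⟨m, τ, hτ, hS⟩, hb⟩, hf⟩
    refine ⟨τ, hS.card_le, hS, fun hlt => hb ?_⟩
    change s'.nat 5 (s'.nat 9 0 0 0) 0 0 + 1 ≤ s'.nat 0 0 0 0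
    rw [hf.1 0 rfl, hn]; exact hlt

/-- Augment the matching along the path found. -/
def augmentLoop : Program :=
  .loop (.natLt (var 9) (var 0)) (.seq (setCell 5 (var 9) (cell 5 (cell 8 (var 9))))
    (setVar 9 (cell 8 (var 9))))

lemma runs_augmentLoop {n q m : ℕ} {s : Memory} (hn : s.nat 0 0 0 0 = n) (hm : m ≤ n)
    (h : AugmentState n q (cOf s) (okOf s) (uOf s) (vOf s) (pOf s) (wayOf s) (s.nat 9 0 0 0) m) :
    Runs augmentLoop s (n * ((1 + 1) + 1) + 1) fun s' => DualMemory n (q + 1) s' := by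
  refine (Runs.frame (Runs.loop (T := 1 + 1) (Inv := fun m s' => AugmentState n q (cOf s')
    (okOf s') (uOf s') (vOf s') (pOf s') (wayOf s') (s'.nat 9 0 0 0) m) ?_ (m := m) h)).mono
      (by gcongr) ?_
  · rintro m s₁ hf hb hA
    have e0 : s₁.nat 0 0 0 0 = n := by rw [hf.1 0 rfl, hn]
    have hcur : s₁.nat 9 0 0 0 < n := by
      have h1 : s₁.nat 9 0 0 0 + 1 ≤ s₁.nat 0 0 0 0 := hb
      rw [e0] at h1; exact h1
    have key : ∀ s' : Memory, (cOf s', okOf s', uOf s', vOf s', wayOf s') =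
        (cOf s₁, okOf s₁, uOf s₁, vOf s₁, wayOf s₁) → s'.nat 9 0 0 0 = wayOf s₁ (s₁.nat 9 0 0 0) →
        pOf s' (s₁.nat 9 0 0 0) = pOf s₁ (wayOf s₁ (s₁.nat 9 0 0 0)) →
        (∀ k ≤ n, k ≠ s₁.nat 9 0 0 0 → pOf s' k = pOf s₁ k) →
        ∃ m' < m, AugmentState n q (cOf s') (okOf s') (uOf s') (vOf s') (pOf s') (wayOf s')
          (s'.nat 9 0 0 0) m' := by
      intro s' heq h9 h1 h2
      simp only [Prod.mk.injEq] at heq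
      obtain ⟨h3, h4, h5, h6, h7⟩ := heq
      rw [h3, h4, h5, h6, h7, h9]
      exact hA.step hcur h1 h2
    refine Runs.seq (Runs.setNat (Runs.setNat (key _ ?_ ?_ ?_ ?_)))
    · simp only [Prod.mk.injEq]
      refine ⟨?_, ?_, rfl, rfl, ?_⟩
      · funext j k; simp [cOf, write]
      · funext j k; simp [okOf, write]
      · funext k; simp [wayOf, write]
    · simp [wayOf, write, NatExpr.eval]
    · simp [wayOf, pOf, write, NatExpr.eval]
    · intro k _ hk; simp [pOf, write, NatExpr.eval, hk]
  · rintro s' ⟨⟨⟨m, hA⟩, hb⟩, hf⟩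
    refine hA.finish fun hlt => hb ?_
    change s'.nat 9 0 0 0 + 1 ≤ s'.nat 0 0 0 0
    rw [hf.1 0 rfl, hn]; exact hlt

/-- Find a minimum-cost perfect matching of the unused edges in the current plane. -/
def matchPlane : Program :=
  .seq initPlane (forLoop 3 (var 0) (.seq initSearch (.seq searchLoop augmentLoop)))

/-- The number of steps of the insertion of one row. -/
def phaseTime (n : ℕ) : ℕ :=
  ((n * ((1 + 1) + 2) + 2) + (1 + (1 + (1 + 1)))) +
    (((n + 1) * (searchTime n + 1) + 1) + (n * ((1 + 1) + 1) + 1))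

/-- The number of steps in one plane. -/
def matchTime (n : ℕ) : ℕ :=
  (n * ((1 + (1 + (1 + (n * (2 + 2) + 2)))) + 2) + 2) + (n * (phaseTime n + 2) + 2)

lemma runs_matchPlane {n : ℕ} {s : Memory} (hn : s.nat 0 0 0 0 = n) {g : ℕ → ℕ}
    (hg : ∀ j < n, g j < n ∧ okOf s j (g j))
    (hgi : ∀ j < n, ∀ j' < n, g j = g j' → j = j') :
    Runs matchPlane s (matchTime n) fun s' => DualMemory n n s' := by
  refine Runs.seq ((runs_initPlane hn).frame.mono le_rfl ?_)
  rintro s₁ ⟨hI, hf⟩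
  have e0 : s₁.nat 0 0 0 0 = n := by rw [hf.1 0 rfl, hn]
  have hok : okOf s₁ = okOf s := by funext j k; simp only [okOf, hf.1 4 rfl]
  have hc : cOf s₁ = cOf s := by funext j k; simp only [cOf, hf.1 2 rfl, hf.2 0 rfl]
  refine Runs.forLoop (c := 3) (N := n) (Inv := fun q s' => DualMemory n q s')
    rfl (fun s' hf => ?_) (fun x s' v h => ?_) ?_ ?_
  · simp only [NatExpr.eval, hf.1 0 rfl, e0]
  · exact h
  · intro q hq s₂ hf₂ h3 hD
    have e0' : s₂.nat 0 0 0 0 = n := by rw [hf₂.1 0 rfl, e0]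
    refine Runs.seq ((runs_initSearch e0' h3 hq hD).frame.mono le_rfl ?_)
    rintro s₃ ⟨hS, hf₃⟩
    have hok₃ : okOf s₃ = okOf s := by
      rw [← hok]; funext j k; simp only [okOf, hf₃.1 4 rfl, hf₂.1 4 rfl]
    have e0₃ : s₃.nat 0 0 0 0 = n := by rw [hf₃.1 0 rfl, e0']
    refine Runs.seq ((runs_searchLoop e0₃ hS (hok₃ ▸ hg) hgi).frame.mono le_rfl ?_)
    rintro s₄ ⟨⟨τ, hτ, hS₄, hfree⟩, hf₄⟩
    have e0₄ : s₄.nat 0 0 0 0 = n := by rw [hf₄.1 0 rfl, e0₃]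
    exact runs_augmentLoop e0₄ hτ (hS₄.toAugmentState hfree)
  · exact
    { feas := fun j hj k hk _ => by
        obtain ⟨-, -, h1⟩ := hI j hj
        rw [(hI k hk).1, add_zero, hc]
        exact h1 k hk
      tight := fun k hk hlt => absurd hlt (by rw [(hI k hk).2.1]; exact lt_irrefl n)
      inj := fun k hk _ _ hlt => absurd hlt (by rw [(hI k hk).2.1]; exact lt_irrefl n)
      lt := fun k hk hlt => absurd hlt (by rw [(hI k hk).2.1]; exact lt_irrefl n)
      surj := fun j hj => absurd hj (Nat.not_lt_zero j) }

/-- Output the matching of the current plane and mark its edges. -/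
def recordPlane : Program :=
  forLoop 13 (var 0) (.seq (.setNat 1 (var 2) (cell 5 (var 13)) (.lit 0) (var 13))
    (.setNat 4 (cell 5 (var 13)) (var 13) (.lit 0) (.lit 1)))

/-- Different columns have different rows (`hp`), so no output cell of this plane is overwritten
later. -/
lemma runs_recordPlane {n i : ℕ} {s : Memory} (hn : s.nat 0 0 0 0 = n) (hi : s.nat 2 0 0 0 = i)
    (hp : ∀ k < n, ∀ k' < n, pOf s k = pOf s k' → k = k') :
    Runs recordPlane s (n * ((1 + 1) + 2) + 2) fun s' =>
      (∀ i' < i, ∀ j, s'.nat 1 i' j 0 = s.nat 1 i' j 0) ∧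
      (∀ k < n, s'.nat 1 i (pOf s k) 0 = k) ∧
      ∀ j, ∀ k < n, s'.nat 4 j k 0 = 0 ↔ s.nat 4 j k 0 = 0 ∧ pOf s k ≠ j := by
  refine (Runs.forLoop (c := 13) (N := n) (T := 1 + 1) (Inv := fun x s' =>
    (∀ i' < i, ∀ j, s'.nat 1 i' j 0 = s.nat 1 i' j 0) ∧
    (∀ k < x, s'.nat 1 i (pOf s k) 0 = k) ∧
    ∀ j, ∀ k < n, s'.nat 4 j k 0 = 0 ↔ s.nat 4 j k 0 = 0 ∧ ¬ (k < x ∧ pOf s k = j))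
    rfl (fun s' hf => ?_) (fun x s' v h => h) ?_ (by simp)).mono le_rfl ?_
  · simp only [NatExpr.eval, hf.1 0 rfl, hn]
  · rintro x hx s₁ hf hcx ⟨h1, h2, h3⟩
    have e2 : s₁.nat 2 0 0 0 = i := by rw [hf.1 2 rfl, hi]
    have e5 : ∀ k, s₁.nat 5 k 0 0 = pOf s k := fun k => by rw [hf.1 5 rfl]; rfl
    refine Runs.seq (Runs.setNat (Runs.setNat ⟨fun i' hi' j => ?_, fun k hk => ?_,
      fun j k hk => ?_⟩))
    · simpa [write, NatExpr.eval, e2, hi'.ne] using h1 i' hi' j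
    · rcases Nat.lt_succ_iff_lt_or_eq.1 hk with h4 | rfl
      · have hne : pOf s k ≠ pOf s x := fun e => h4.ne (hp k (h4.trans hx) x hx e)
        simpa [write, NatExpr.eval, e2, e5, hcx, hne] using h2 k h4
      · simp [write, NatExpr.eval, e2, e5, hcx]
    · by_cases hkx : k = x
      · subst hkx
        by_cases hj : j = pOf s k
        · subst hj; simp [write, NatExpr.eval, e5, hcx]
        · have := h3 j k hk
          simp only [lt_self_iff_false, false_and, not_false_eq_true, and_true] at this
          simp [write, NatExpr.eval, e5, hcx, hj, this, Ne.symm hj]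
      · have h5 : k < x + 1 ↔ k < x := by omega
        have := h3 j k hk
        simp only [h5]
        simpa [write, NatExpr.eval, e5, hcx, hkx] using this
  · rintro s' ⟨h1, h2, h3⟩
    refine ⟨h1, h2, fun j k hk => ?_⟩
    rw [h3 j k hk]; simp [hk]

/-- The greedy program. -/
def greedyProgram : Program := forLoop 2 (var 0) (.seq matchPlane recordPlane)

/-- The number of steps of the greedy program. -/
def greedyTime (n : ℕ) : ℕ := n * ((matchTime n + (n * ((1 + 1) + 2) + 2)) + 2) + 2

lemma runs_greedyProgram {n : ℕ} (X : CostArray 3 n) :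
    Runs greedyProgram (inputMemory X) (greedyTime n) fun s =>
      ∃ M : Fin n → Equiv.Perm (Fin n), Outputs s M ∧ IsGreedyOutcome X M := by
  have hn : (inputMemory X).nat 0 0 0 0 = n := by simp [inputMemory]
  -- The invariant takes the costs from the input memory; the program never writes to the array that
  -- holds them.
  refine (Runs.forLoop (c := 2) (N := n) (Inv := fun i s' =>
    PlaneState n i (fun i j k => (inputMemory X).real 0 i j k) (fun i j => s'.nat 1 i j 0)
      (fun j k => s'.nat 4 j k 0)) rfl (fun s' hf => ?_) (fun x s' v h => h) ?_ ?_).mono le_rfl ?_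
  · simp only [NatExpr.eval, hf.1 0 rfl, hn]
  · intro i hi s₁ hf h2 hP
    have e0 : s₁.nat 0 0 0 0 = n := by rw [hf.1 0 rfl, hn]
    obtain ⟨g, hg, hgi⟩ := hP.exists_allowed hi
    refine Runs.seq ((runs_matchPlane e0 hg hgi).frame.mono le_rfl ?_)
    rintro s₂ ⟨hD, hf₂⟩
    have e0' : s₂.nat 0 0 0 0 = n := by rw [hf₂.1 0 rfl, e0]
    have e2' : s₂.nat 2 0 0 0 = i := by rw [hf₂.1 2 rfl, h2]
    have e1 := hf₂.1 1 rfl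
    have e4 := hf₂.1 4 rfl
    have hlt := DualState.lt_of_complete hD
    refine (runs_recordPlane e0' e2' fun k hk k' hk' heq =>
      hD.inj k hk k' hk' (hlt k hk) heq).mono le_rfl ?_
    rintro s₃ ⟨h3, h4, h5⟩
    have hc : cOf s₂ = fun j k => (inputMemory X).real 0 i j k := by
      funext j k
      simp only [cOf, e2', hf₂.2 0 rfl, hf.2 0 rfl]
    have hok : okOf s₂ = fun j k => s₁.nat 4 j k 0 = 0 := by
      funext j k; simp only [okOf, e4]
    rw [DualMemory, hc, hok] at hD
    refine hP.step hD (fun i' hi' j _ => ?_) (fun k hk => h4 k hk) fun j hj k hk => ?_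
    · rw [h3 i' hi' j, e1]
    · rw [h5 j k hk, e4]
  · exact PlaneState.start fun j _ k _ => by simp [inputMemory]
  · intro s' hP
    obtain ⟨M, hM, hG⟩ := hP.exists_isGreedyOutcome X fun i j k => by
      simp [inputMemory]
    exact ⟨M, fun i j => (hM i j).symm, hG⟩

lemma exists_polynomial_greedyTime : ∃ p : Polynomial ℕ, ∀ n, p.eval n = greedyTime n := by
  open Polynomial in
  let search : ℕ[X] := (1 + ((X + 1) * ((X * (6 + 2) + 2) + 2) + 2)) +
    ((X * ((2 + 2) + 2) + 2) + (1 + (1 + (1 + 2))))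
  let phase : ℕ[X] := ((X * ((1 + 1) + 2) + 2) + (1 + (1 + (1 + 1)))) +
    (((X + 1) * (search + 1) + 1) + (X * ((1 + 1) + 1) + 1))
  let plane : ℕ[X] := (X * ((1 + (1 + (1 + (X * (2 + 2) + 2)))) + 2) + 2) +
    (X * (phase + 2) + 2)
  refine ⟨X * ((plane + (X * ((1 + 1) + 2) + 2)) + 2) + 2, fun n => ?_⟩
  simp [search, phase, plane, greedyTime, matchTime, phaseTime, searchTime]

end GreedyProgram
end AxialAssignment

open AxialAssignment
theorem theorem3 :
    (∃ c : ℝ, 0 < c ∧ ∀ d : ℕ, 3 ≤ d →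
      Tendsto (fun n : ℕ => costLaw d n {C | ¬ c * (n : ℝ) ^ (d - 2) ≤ optimalValue C})
        atTop (𝓝 0)) ∧
    (∃ (P : Program) (f : ∀ n : ℕ, CostArray 3 n → Fin n → Equiv.Perm (Fin n)),
      ComputesInPolyTime P f ∧
      (∀ (n : ℕ) (C : CostArray 3 n),
        IsGreedyOutcome C (f n C) ∧ IsAxialAssignment (triples (f n C))) ∧
      ∃ K : ℝ, Tendsto
        (fun n : ℕ =>
          costLaw 3 n {C | ¬ cost C (triples (f n C)) ≤ K * ((n : ℝ) * Real.log n)})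
        atTop (𝓝 0)) := by
  refine ⟨⟨1 / 16, by norm_num, tendsto_costLaw_optimalValue⟩, ?_⟩
  -- Greedy outcomes need not be unique, so `f` is read off from runs of the program; the
  -- probabilistic bound holds for every selection of outcomes.
  choose t s hexec ht f hout hgreedy using fun (n : ℕ) (C : CostArray 3 n) =>
    runs_greedyProgram C
  obtain ⟨p, hp⟩ := exists_polynomial_greedyTime
  exact ⟨greedyProgram, f, ⟨p, fun n C => ⟨t n C, s n C, hexec n C, (ht n C).trans (hp n).ge,
    hout n C⟩⟩, fun n C => ⟨hgreedy n C, triples_isAxialAssignment (hgreedy n C).pairwiseDisjoint⟩,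
    exists_tendsto_costLaw_greedy f hgreedy⟩
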